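/- Consider the problem \textsc{Maximum Common Connected Induced Subgraph} (MCCIS): given two finite simple graphs $G_1$ and $G_2$, find vertex sets $S_1\subseteq V(G_1)$ and $S_2\subseteq V(G_2)$ such that the induced subgraph $G_1[S_1]$ is connected and isomorphic to $G_2[S_2]$, with $|S_1|$ as large as possible. (The empty subgraph is admitted; this affects the maximum only if one of the graphs has no vertices.) For a finite graph $G$, let $\mathrm{vc}(G)$ be the minimum number of vertices in a vertex cover of $G$. MCCIS is fixed-parameter tractable when parameterized by $k=\max(\mathrm{vc}(G_1),\mathrm{vc}(G_2))$: there are a computable function $f:\mathbb{N}\to\mathbb{N}$, a constant $c$ and an algorithm that solves every instance $(G_1,G_2)$ in $O\bigl(f(k)\cdot |I|^{c}\bigr)$ steps, where $|I|=|V(G_1)|^2+|V(G_2)|^2+2$ is the size of the input (two adjacency matrices and the two numbers of vertices). Moreover, there is an algorithm for MCCIS whose running time is $O^*\bigl((9k)^k\,2^{k^2}\bigr)$, that is, at most $C\cdot(9k)^k\,2^{k^2}\cdot|I|^{c}$ steps on every instance, with constants $C$ and $c$, where $0^0=1$. The algorithms are programs of a random access machine with indirect addressing, with one step for each instruction and each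 test; neither $k$ nor vertex covers are part of the input. -/

import Mathlib

/-! ## Random access machines with a step count

The machine has registers and finitely many (those the program names) arrays of natural numbers
with indirect addressing. The only instruction that increases a stored number is `succ`, so after
`t` steps every number is at most `t` plus the largest number in the input or in the program text:
words stay of logarithmic length, and charging one unit per instruction is the same as charging
bit lengths, up to a logarithmic factor. (There is no addition or multiplication instruction.) -/

namespace RAM

/-- `reg x` is the content of register `x`, and `mem a i` is the cell of index `i` of array `a`. -/
structure State where
  reg : ℕ → ℕ
  mem : ℕ → ℕ → ℕ

namespace State

/-- Write `v` into register `x`. -/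
def setReg (s : State) (x v : ℕ) : State :=
  { s with reg := Function.update s.reg x v }

/-- Write `v` into the cell of index `i` of array `a`. -/
def setMem (s : State) (a i v : ℕ) : State :=
  { s with mem := Function.update s.mem a (Function.update (s.mem a) i v) }

end State

/-- Instructions; `x y z` are names of registers, `a` is the name of an array. -/
inductive Instr where
  /-- `x := c` for a number `c` written in the program text. -/
  | const (x c : ℕ)
  /-- `x := y` -/
  | copy (x y : ℕ)
  /-- `x := x + 1` -/
  | succ (x : ℕ)
  /-- `x := y - z`, truncated at `0` -/
  | sub (x y z : ℕ)
  /-- `x := a[y]` -/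
  | load (x a y : ℕ)
  /-- `a[x] := y` -/
  | store (a x y : ℕ)

/-- The effect of one instruction. -/
def Instr.run : Instr → State → State
  | .const x c, s => s.setReg x c
  | .copy x y, s => s.setReg x (s.reg y)
  | .succ x, s => s.setReg x (s.reg x + 1)
  | .sub x y z, s => s.setReg x (s.reg y - s.reg z)
  | .load x a y, s => s.setReg x (s.mem a (s.reg y))
  | .store a x y, s => s.setMem a (s.reg x) (s.reg y)

/-- Tests: comparisons of two registers. -/
inductive Test where
  | eq (x y : ℕ)
  | lt (x y : ℕ)

/-- The outcome of a test. -/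
def Test.holds : Test → State → Prop
  | .eq x y, s => s.reg x = s.reg y
  | .lt x y, s => s.reg x < s.reg y

/-- Programs: finite texts built from instructions by sequencing, branching and `while` loops. -/
inductive Prog where
  | skip
  | instr (i : Instr)
  | seq (p q : Prog)
  | ite (b : Test) (p q : Prog)
  | loop (b : Test) (p : Prog)

/-- `Exec p s s' t`: started in state `s`, the program `p` halts in state `s'` after exactly `t`
steps, where every executed instruction and every evaluation of a test is one step. -/
inductive Exec : Prog → State → State → ℕ → Prop where
  | skip (s : State) : Exec .skip s s 1
  | instr (i : Instr) (s : State) : Exec (.instr i) s (i.run s) 1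
  | seq {p q : Prog} {s s' s'' : State} {t t' : ℕ} (hp : Exec p s s' t) (hq : Exec q s' s'' t') :
      Exec (.seq p q) s s'' (t + t')
  | ite_true {b : Test} {p q : Prog} {s s' : State} {t : ℕ} (hb : b.holds s)
      (hp : Exec p s s' t) : Exec (.ite b p q) s s' (1 + t)
  | ite_false {b : Test} {p q : Prog} {s s' : State} {t : ℕ} (hb : ¬ b.holds s)
      (hq : Exec q s s' t) : Exec (.ite b p q) s s' (1 + t)
  | loop_true {b : Test} {p : Prog} {s s' s'' : State} {t t' : ℕ} (hb : b.holds s)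
      (hp : Exec p s s' t) (hl : Exec (.loop b p) s' s'' t') :
      Exec (.loop b p) s s'' (1 + t + t')
  | loop_false {b : Test} {p : Prog} {s : State} (hb : ¬ b.holds s) : Exec (.loop b p) s s 1

end RAM

/-! ## Parameterized problems and fixed-parameter tractability -/

/-- A parameterized (search or optimization) problem: instances with their size, their parameter,
the initial machine state that presents them, and the final states that present a solution. -/
structure ParamProblem where
  Inst : Type
  size : Inst → ℕ
  param : Inst → ℕ
  input : Inst → RAM.State
  IsOutput : Inst → RAM.State → Prop

/-- One program solves every instance in time `O*(f(k))`: in at most `C * f k * |I| ^ c` steps,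
where `k` is the parameter, `|I|` the size of the instance, and `C`, `c` are constants. -/
def ParamProblem.SolvableInOStar (Q : ParamProblem) (f : ℕ → ℕ) : Prop :=
  ∃ (P : RAM.Prog) (C c : ℕ), ∀ I : Q.Inst, ∃ (s : RAM.State) (t : ℕ),
    RAM.Exec P (Q.input I) s t ∧ t ≤ C * f (Q.param I) * Q.size I ^ c ∧ Q.IsOutput I s

/-- Fixed-parameter tractability: solvable in time `f(k) * |I| ^ O(1)` for some computable `f`. -/
def ParamProblem.IsFPT (Q : ParamProblem) : Prop :=
  ∃ f : ℕ → ℕ, Computable f ∧ Q.SolvableInOStar f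

/-! ## Maximum common connected induced subgraph -/

/-- The subgraph of `G₁` induced by `S₁` is connected and isomorphic to the subgraph of `G₂` induced
by `S₂`. (The empty subgraph is admitted. As a single vertex is always a common connected induced
subgraph of two nonempty graphs, this affects the maximum only if one of the graphs is empty.) -/
def IsCommonConnectedInducedSubgraph {V₁ V₂ : Type} (G₁ : SimpleGraph V₁) (G₂ : SimpleGraph V₂)
    (S₁ : Set V₁) (S₂ : Set V₂) : Prop :=
  (G₁.induce S₁).Preconnected ∧ Nonempty (G₁.induce S₁ ≃g G₂.induce S₂)

/-- A common connected induced subgraph with the maximum number of vertices. -/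
def IsMaxCommonConnectedInducedSubgraph {V₁ V₂ : Type} (G₁ : SimpleGraph V₁) (G₂ : SimpleGraph V₂)
    (S₁ : Set V₁) (S₂ : Set V₂) : Prop :=
  IsCommonConnectedInducedSubgraph G₁ G₂ S₁ S₂ ∧
    ∀ (T₁ : Set V₁) (T₂ : Set V₂), IsCommonConnectedInducedSubgraph G₁ G₂ T₁ T₂ →
      T₁.ncard ≤ S₁.ncard

/-- A pair of finite graphs, each with its vertices numbered from `0`. -/
structure GraphPair where
  n₁ : ℕ
  n₂ : ℕ
  G₁ : SimpleGraph (Fin n₁)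
  G₂ : SimpleGraph (Fin n₂)

open Classical in
/-- The adjacency matrix of `G` as an array, row by row (and `0` beyond the last entry). -/
noncomputable def adjArray {n : ℕ} (G : SimpleGraph (Fin n)) (p : ℕ) : ℕ :=
  if ∃ i j : Fin n, p = i * n + j ∧ G.Adj i j then 1 else 0

/-- Registers `0` and `1` hold the numbers of vertices, arrays `0` and `1` the adjacency matrices;
everything else is `0`. -/
noncomputable def GraphPair.input (I : GraphPair) : RAM.State where
  reg := fun x => if x = 0 then I.n₁ else if x = 1 then I.n₂ else 0
  mem := fun a => if a = 0 then adjArray I.G₁ else if a = 1 then adjArray I.G₂ else fun _ => 0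

/-- The set of vertices `v` with a nonzero entry at index `v` of array `a`. -/
def RAM.State.vertexSet (s : RAM.State) (a n : ℕ) : Set (Fin n) :=
  {v | s.mem a v ≠ 0}

/-- Maximum Common Connected Induced Subgraph, parameterized by `max (vc G₁) (vc G₂)`. The size of
an instance is the number of words of the input, and arrays `2` and `3` hold the output, as the
indicator functions of the two vertex sets. The parameter is not part of the input. -/
noncomputable def MCCIS : ParamProblem where
  Inst := GraphPair
  size := fun I => I.n₁ ^ 2 + I.n₂ ^ 2 + 2
  param := fun I => (max I.G₁.vertexCoverNum I.G₂.vertexCoverNum).toNat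
  input := GraphPair.input
  IsOutput := fun I s => IsMaxCommonConnectedInducedSubgraph I.G₁ I.G₂
    (s.vertexSet 2 I.n₁) (s.vertexSet 3 I.n₂)

/-!
# Maximum common connected induced subgraphs and vertex covers

**Guesses.** Let `C₁` and `C₂` be vertex covers of the two graphs with at most `k` elements, and let
`P` be an isomorphism between induced subgraphs. Of `P` it suffices to know (`Guess`): which
elements of `C₁` are mapped to which elements of `C₂`; which elements of `C₁` are mapped out of
`C₂` (the set `B`); which elements of `C₂` are images of vertices outside of `C₁` (the set `D`);
and the adjacency of `B` to the preimages of `D`. This determines for each remaining vertex the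
adjacency that its partner must have (`Guess.Compat`). The relation "may be partners" is a disjoint
union of complete bipartite graphs, so that a maximal matching in it is found by comparing ranks
(`isMaximalMatching_rankMatch`). Every maximal matching, together with the guessed pairs, is
again an isomorphism between induced subgraphs (`IsPartialIso.extend`), because an edge always has
an end in the cover. If the domain of `P` is connected, its vertices can be moved injectively and
with preservation of edges into the domain of the new isomorphism, hence some component of the
latter is at least as large (`IsPartialIso.exists_connected`).

**Counting.** The vertex covers are guessed as well: the edges are scanned, and for each edge that is
not yet covered a bit tells which end to add, so `2 * k` bits suffice for both graphs
(`exists_coverFold_subset`). Each element of `C₁` has one of `k + 2` roles (outside of the subgraph,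
in `B`, or mapped to one of `k` elements), `D` takes `k` bits and the adjacency `k ^ 2` bits. This
makes `(k + 2) ^ k * 2 ^ (3 * k + k ^ 2)` strings, which is at most `9 * (9 * k) ^ k * 2 ^ k ^ 2`
because `(1 + 2 / k) ^ k ≤ 9` and `2 ^ 3 ≤ 9` (`add_two_pow_mul_le`). One of them leads to an optimal solution
(`exists_guess`).

**The program.** It runs through the strings for `k = 0, 1, 2, …` in the manner of an odometer, and
stops at the end of the first level on which vertex covers have been found; this level is the
parameter. For each string it verifies that the candidate is an isomorphism and compares each
of its components with the best solution so far, so that only optimality depends on the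
completeness of the guesses. `SearchInv.round` describes one round, `SearchInv.exists_end` bounds
the number of rounds, and `SearchEnd.isOutput` derives optimality.

**The running time.** The body of the search is written in a small language of arithmetic expressions
with bounded sums (`Expr`) and of statements with bounded loops (`Stmt`), which is compiled to
machine programs. All values that a statement stores and all numbers of rounds are truncated at a cap
that the input determines; hence every statement takes time polynomial in the cap, whatever it does
(`Stmt.exists_time`, `exists_time_whileProg`), and only the number of rounds of the search depends on
the parameter.
-/

namespace RAM

/-! ### Total correctness of machine programs -/

/-- Total correctness with a time bound: from `s`, the program halts after at most `T` steps in a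
state that satisfies `Q`. -/
def Ensures (p : Prog) (s : State) (T : ℕ) (Q : State → Prop) : Prop :=
  ∃ s' t, Exec p s s' t ∧ t ≤ T ∧ Q s'

namespace Ensures

variable {p q : Prog} {s : State} {T T' : ℕ} {Q Q' : State → Prop}

theorem mono (h : Ensures p s T Q) (hT : T ≤ T') (hQ : ∀ s', Q s' → Q' s') :
    Ensures p s T' Q' := by
  obtain ⟨s', t, he, ht, hq⟩ := h
  exact ⟨s', t, he, ht.trans hT, hQ _ hq⟩

theorem skip (h : Q s) : Ensures .skip s 1 Q := ⟨s, 1, .skip s, le_rfl, h⟩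

theorem instr {i : Instr} (h : Q (i.run s)) : Ensures (.instr i) s 1 Q :=
  ⟨_, 1, .instr i s, le_rfl, h⟩

theorem seq (h : Ensures p s T fun s' => Ensures q s' T' Q) :
    Ensures (.seq p q) s (T + T') Q := by
  obtain ⟨s', t, he, ht, s'', t', he', ht', hq⟩ := h
  exact ⟨s'', t + t', .seq he he', by omega, hq⟩

theorem ite {b : Test} (h₁ : b.holds s → Ensures p s T Q)
    (h₂ : ¬ b.holds s → Ensures q s T Q) : Ensures (.ite b p q) s (1 + T) Q := by
  by_cases hb : b.holds s
  · obtain ⟨s', t, he, ht, hq⟩ := h₁ hb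
    exact ⟨s', 1 + t, .ite_true hb he, by omega, hq⟩
  · obtain ⟨s', t, he, ht, hq⟩ := h₂ hb
    exact ⟨s', 1 + t, .ite_false hb he, by omega, hq⟩

/-- A loop that runs exactly `m` times, with an invariant `I i` before round `i`. -/
theorem loop {b : Test} (I : ℕ → State → Prop) (m : ℕ)
    (hstep : ∀ i s, i < m → I i s → b.holds s ∧ Ensures p s T (I (i + 1)))
    (hend : ∀ s, I m s → ¬ b.holds s) (hs : I 0 s) :
    Ensures (.loop b p) s (m * (1 + T) + 1) (I m) := by
  have key : ∀ j i s, i + j = m → I i s → Ensures (.loop b p) s (j * (1 + T) + 1) (I m) := by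
    intro j
    induction j with
    | zero =>
      intro i s hi hI
      obtain rfl : i = m := by omega
      exact ⟨s, 1, .loop_false (hend s hI), by omega, hI⟩
    | succ j ih =>
      intro i s hi hI
      obtain ⟨hb, s', t, he, ht, hI'⟩ := hstep i s (by omega) hI
      obtain ⟨s'', t', he', ht', hI''⟩ := ih (i + 1) s' (by omega) hI'
      exact ⟨s'', 1 + t + t', .loop_true hb he he', by rw [Nat.succ_mul]; omega, hI''⟩
  exact key m 0 s (by omega) hs

end Ensures

/-! ### Polynomially bounded functions -/

/-- The function is bounded by a polynomial. Powers of `N + 2` are used because they absorb every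
constant. -/
def PolyBd (f : ℕ → ℕ) : Prop := ∃ D, ∀ N, f N ≤ (N + 2) ^ D

namespace PolyBd

variable {f g : ℕ → ℕ}

theorem const (c : ℕ) : PolyBd fun _ => c :=
  ⟨c, fun N => (Nat.lt_two_pow_self).le.trans (Nat.pow_le_pow_left (by omega) c)⟩

theorem id : PolyBd fun N => N := ⟨1, fun N => by simp⟩

theorem mul (hf : PolyBd f) (hg : PolyBd g) : PolyBd fun N => f N * g N := by
  obtain ⟨D, hD⟩ := hf
  obtain ⟨E, hE⟩ := hg
  exact ⟨D + E, fun N => by rw [pow_add]; exact Nat.mul_le_mul (hD N) (hE N)⟩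

theorem add (hf : PolyBd f) (hg : PolyBd g) : PolyBd fun N => f N + g N := by
  obtain ⟨D, hD⟩ := hf
  obtain ⟨E, hE⟩ := hg
  refine ⟨D + E + 1, fun N => ?_⟩
  have h1 := (hD N).trans (Nat.pow_le_pow_right (show 0 < N + 2 by omega) (Nat.le_add_right D E))
  have h2 := (hE N).trans (Nat.pow_le_pow_right (show 0 < N + 2 by omega) (Nat.le_add_left E D))
  rw [pow_succ]
  nlinarith [Nat.zero_le ((N + 2) ^ (D + E))]

theorem comp (hf : PolyBd f) (hg : PolyBd g) : PolyBd fun N => f (g N) := by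
  obtain ⟨D, hD⟩ := hf
  obtain ⟨E, hE⟩ := hg.add (const 2)
  exact ⟨E * D, fun N => (hD _).trans (by rw [pow_mul]; exact Nat.pow_le_pow_left (hE N) D)⟩

end PolyBd

/-! ### Arithmetic expressions and their compilation -/

/-- Arithmetic expressions over the variables and arrays of a state. -/
inductive Expr where
  | var (x : ℕ)
  | const (c : ℕ)
  | add (e f : Expr)
  | sub (e f : Expr)
  /-- The cell of index `e` of array `a`. -/
  | get (a : ℕ) (e : Expr)
  /-- `1` if the values are equal, else `0`. -/
  | eq (e f : Expr)
  /-- `1` if the first value is smaller, else `0`. -/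
  | lt (e f : Expr)
  /-- The sum of the values of `f` where the variable `x` runs over the numbers below `e`. -/
  | sum (x : ℕ) (e f : Expr)

/-- The value of an expression. -/
def Expr.eval : Expr → State → ℕ
  | .var x, s => s.reg x
  | .const c, _ => c
  | .add e f, s => e.eval s + f.eval s
  | .sub e f, s => e.eval s - f.eval s
  | .get a e, s => s.mem a (e.eval s)
  | .eq e f, s => if e.eval s = f.eval s then 1 else 0
  | .lt e f, s => if e.eval s < f.eval s then 1 else 0
  | .sum x e f, s => ∑ i ∈ Finset.range (e.eval s), f.eval (s.setReg x i)

/-- `N` bounds all numbers in the state. -/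
def Bounded (N : ℕ) (s : State) : Prop := (∀ x, s.reg x ≤ N) ∧ ∀ a i, s.mem a i ≤ N

theorem Bounded.mono {N N' : ℕ} {s : State} (h : Bounded N s) (hN : N ≤ N') : Bounded N' s :=
  ⟨fun x => (h.1 x).trans hN, fun a i => (h.2 a i).trans hN⟩

theorem Bounded.setReg {N v : ℕ} {s : State} (h : Bounded N s) (hv : v ≤ N) (x : ℕ) :
    Bounded N (s.setReg x v) := by
  refine ⟨fun y => ?_, h.2⟩
  simp only [State.setReg, Function.update_apply]
  split_ifs
  exacts [hv, h.1 y]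

theorem Bounded.setMem {N v : ℕ} {s : State} (h : Bounded N s) (hv : v ≤ N) (a i : ℕ) :
    Bounded N (s.setMem a i v) := by
  refine ⟨h.1, fun b j => ?_⟩
  simp only [State.setMem, Function.update_apply]
  split_ifs with h1
  · simp only [Function.update_apply]
    split_ifs
    exacts [hv, h.2 a j]
  · exact h.2 b j

/-- The values of an expression are polynomially bounded. -/
theorem Expr.exists_eval_le (e : Expr) :
    ∃ V, PolyBd V ∧ ∀ N s, Bounded N s → e.eval s ≤ V N := by
  induction e with
  | var x => exact ⟨_, PolyBd.id, fun N s h => h.1 x⟩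
  | const c => exact ⟨_, PolyBd.const c, fun N s h => le_rfl⟩
  | add e f he hf =>
    obtain ⟨V, hV, hV'⟩ := he
    obtain ⟨W, hW, hW'⟩ := hf
    exact ⟨_, hV.add hW, fun N s h => Nat.add_le_add (hV' N s h) (hW' N s h)⟩
  | sub e f he hf =>
    obtain ⟨V, hV, hV'⟩ := he
    exact ⟨_, hV, fun N s h => (Nat.sub_le _ _).trans (hV' N s h)⟩
  | get a e he => exact ⟨_, PolyBd.id, fun N s h => h.2 _ _⟩
  | eq e f he hf =>
    exact ⟨_, PolyBd.const 1, fun N s h => by simp only [Expr.eval]; split_ifs <;> simp⟩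
  | lt e f he hf =>
    exact ⟨_, PolyBd.const 1, fun N s h => by simp only [Expr.eval]; split_ifs <;> simp⟩
  | sum x e f he hf =>
    obtain ⟨V, hV, hV'⟩ := he
    obtain ⟨W, hW, hW'⟩ := hf
    refine ⟨_, hV.mul (hW.comp (PolyBd.id.add hV)), fun N s h => ?_⟩
    have h1 : e.eval s ≤ V N := hV' N s h
    refine (Finset.sum_le_card_nsmul _ _ (W (N + V N)) fun i hi => ?_).trans ?_
    · rw [Finset.mem_range] at hi
      exact hW' _ _ ((h.mono (by omega)).setReg (by omega) x)
    · simpa using Nat.mul_le_mul_right _ h1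

/-- The scratch register number `d` of compiled programs. The even registers hold the variables. -/
def tmp (d : ℕ) : ℕ := 2 * d + 1

theorem tmp_inj {c d : ℕ} : tmp c = tmp d ↔ c = d := by unfold tmp; omega

theorem tmp_ne (x d : ℕ) : tmp d ≠ 2 * x := by unfold tmp; omega

theorem ne_tmp (x d : ℕ) : 2 * x ≠ tmp d := by unfold tmp; omega

/-- The machine state `s` represents the source state `σ`: variables are in the even registers, and
the arrays are the same. -/
def Agree (σ s : State) : Prop := (∀ x, s.reg (2 * x) = σ.reg x) ∧ s.mem = σ.mem

theorem Agree.setTmp {σ s : State} (h : Agree σ s) (d v : ℕ) : Agree σ (s.setReg (tmp d) v) :=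
  ⟨fun x => by simp [State.setReg, ne_tmp, h.1], h.2⟩

theorem Agree.setReg {σ s : State} (h : Agree σ s) (x v : ℕ) :
    Agree (σ.setReg x v) (s.setReg (2 * x) v) :=
  ⟨fun y => by simp [State.setReg, Function.update_apply, h.1], h.2⟩

/-- `tmp d := tmp d + tmp a`, with `tmp c` as a counter. -/
def addTo (d a c : ℕ) : Prog :=
  .seq (.instr (.const (tmp c) 0))
    (.loop (.lt (tmp c) (tmp a)) (.seq (.instr (.succ (tmp d))) (.instr (.succ (tmp c)))))

theorem ensures_addTo {d a c : ℕ} (hda : d ≠ a) (hdc : d ≠ c) (hac : a ≠ c) (s : State) :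
    Ensures (addTo d a c) s (3 * s.reg (tmp a) + 2) fun s' =>
      s'.reg (tmp d) = s.reg (tmp d) + s.reg (tmp a) ∧
      (∀ r, r ≠ tmp d → r ≠ tmp c → s'.reg r = s.reg r) ∧ s'.mem = s.mem := by
  have h1 : tmp d ≠ tmp a := by simpa [tmp_inj] using hda
  have h2 : tmp d ≠ tmp c := by simpa [tmp_inj] using hdc
  have h3 : tmp a ≠ tmp c := by simpa [tmp_inj] using hac
  refine Ensures.mono (Ensures.seq (T := 1) (T' := s.reg (tmp a) * (1 + 2) + 1) ?_)
    (by omega) (fun _ h => h)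
  refine Ensures.instr ?_
  refine (Ensures.loop (T := 2) (fun i s' => s'.reg (tmp d) = s.reg (tmp d) + i ∧
      s'.reg (tmp c) = i ∧
      (∀ r, r ≠ tmp d → r ≠ tmp c → s'.reg r = s.reg r) ∧ s'.mem = s.mem) (s.reg (tmp a))
      ?_ ?_ ?_).mono le_rfl ?_
  · rintro i s' hi ⟨ha, hb, hr, hm⟩
    refine ⟨?_, ?_⟩
    · simp only [Test.holds, hb, hr _ h1.symm h3, hi]
    · refine Ensures.seq (T := 1) (T' := 1) (Ensures.instr (Ensures.instr ?_))
      refine ⟨?_, ?_, fun r hrd hrc => ?_, hm⟩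
      · simp [Instr.run, State.setReg, h2, ha, add_assoc]
      · simp [Instr.run, State.setReg, h2.symm, hb]
      · simp [Instr.run, State.setReg, hrd, hrc, hr]
  · rintro s' ⟨ha, hb, hr, hm⟩
    simp only [Test.holds, hb, hr _ h1.symm h3, lt_irrefl, not_false_eq_true]
  · refine ⟨?_, ?_, fun r hrd hrc => ?_, rfl⟩
    · simp [Instr.run, State.setReg, h2]
    · simp [Instr.run, State.setReg]
    · simp [Instr.run, State.setReg, hrc]
  · rintro s' ⟨ha, hb, hr, hm⟩
    exact ⟨ha, hr, hm⟩

/-- A program that computes the value of the expression into `tmp d`; it changes no variable and no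
`tmp j` with `j < d`. -/
def Expr.comp : Expr → ℕ → Prog
  | .var x, d => .instr (.copy (tmp d) (2 * x))
  | .const c, d => .instr (.const (tmp d) c)
  | .add e f, d => .seq (e.comp d) (.seq (f.comp (d + 1)) (addTo d (d + 1) (d + 2)))
  | .sub e f, d =>
    .seq (e.comp d) (.seq (f.comp (d + 1)) (.instr (.sub (tmp d) (tmp d) (tmp (d + 1)))))
  | .get a e, d => .seq (e.comp d) (.instr (.load (tmp d) a (tmp d)))
  | .eq e f, d =>
    .seq (e.comp d) (.seq (f.comp (d + 1)) (.ite (.eq (tmp d) (tmp (d + 1)))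
      (.instr (.const (tmp d) 1)) (.instr (.const (tmp d) 0))))
  | .lt e f, d =>
    .seq (e.comp d) (.seq (f.comp (d + 1)) (.ite (.lt (tmp d) (tmp (d + 1)))
      (.instr (.const (tmp d) 1)) (.instr (.const (tmp d) 0))))
  -- The number of rounds is in `tmp (d + 1)`, the counter in `tmp (d + 2)`, and the old value of the
  -- bound variable is kept in `tmp (d + 3)` and restored at the end.
  | .sum x e f, d =>
    .seq (e.comp (d + 1)) <| .seq (.instr (.const (tmp d) 0)) <|
    .seq (.instr (.const (tmp (d + 2)) 0)) <| .seq (.instr (.copy (tmp (d + 3)) (2 * x))) <|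
    .seq (.loop (.lt (tmp (d + 2)) (tmp (d + 1))) <|
        .seq (.instr (.copy (2 * x) (tmp (d + 2)))) <| .seq (f.comp (d + 4)) <|
        .seq (addTo d (d + 4) (d + 5)) (.instr (.succ (tmp (d + 2))))) <|
    .instr (.copy (2 * x) (tmp (d + 3)))

/-- What a compiled expression guarantees about its final state `s'`. -/
def Computes (σ : State) (v d : ℕ) (s s' : State) : Prop :=
  Agree σ s' ∧ s'.reg (tmp d) = v ∧ ∀ j < d, s'.reg (tmp j) = s.reg (tmp j)

/-- Expressions compile to programs whose running time is polynomial in the numbers of the state. -/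
theorem Expr.exists_time (e : Expr) :
    ∃ T, PolyBd T ∧ ∀ N σ, Bounded N σ → ∀ d s, Agree σ s →
      Ensures (e.comp d) s (T N) (Computes σ (e.eval σ) d s) := by
  -- The binary operations share the evaluation of the operands; `q` combines the two values.
  have two : ∀ {e f : Expr} {q : ℕ → Prog} {Te Tf Tq : ℕ → ℕ} {op : ℕ → ℕ → ℕ}
      (_ : ∀ N σ, Bounded N σ → ∀ d s, Agree σ s →
        Ensures (e.comp d) s (Te N) (Computes σ (e.eval σ) d s))
      (_ : ∀ N σ, Bounded N σ → ∀ d s, Agree σ s →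
        Ensures (f.comp d) s (Tf N) (Computes σ (f.eval σ) d s))
      (_ : ∀ N σ, Bounded N σ → ∀ d s, Agree σ s → s.reg (tmp d) = e.eval σ →
        s.reg (tmp (d + 1)) = f.eval σ →
        Ensures (q d) s (Tq N) (Computes σ (op (e.eval σ) (f.eval σ)) d s)),
      ∀ N σ, Bounded N σ → ∀ d s, Agree σ s →
        Ensures (.seq (e.comp d) (.seq (f.comp (d + 1)) (q d))) s (Te N + (Tf N + Tq N))
          (Computes σ (op (e.eval σ) (f.eval σ)) d s) := by
    intro e f q Te Tf Tq op he hf hq N σ hN d s hs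
    refine Ensures.seq ((he N σ hN d s hs).mono le_rfl ?_)
    rintro s1 ⟨ha1, hv1, hf1⟩
    refine Ensures.seq ((hf N σ hN (d + 1) s1 ha1).mono le_rfl ?_)
    rintro s2 ⟨ha2, hv2, hf2⟩
    refine (hq N σ hN d s2 ha2 (by rw [hf2 d (by omega), hv1]) hv2).mono le_rfl ?_
    rintro s3 ⟨ha3, hv3, hf3⟩
    exact ⟨ha3, hv3, fun j hj => by rw [hf3 j hj, hf2 j (by omega), hf1 j hj]⟩
  have set : ∀ {σ s : State} (_ : Agree σ s) (d v : ℕ),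
      Computes σ v d s (s.setReg (tmp d) v) := by
    intro σ s h d v
    refine ⟨h.setTmp d v, by simp [State.setReg], fun j hj => ?_⟩
    have : tmp j ≠ tmp d := by rw [Ne, tmp_inj]; omega
    simp [State.setReg, this]
  induction e with
  | var x =>
    refine ⟨_, PolyBd.const 1, fun N σ hN d s hs => Ensures.instr ?_⟩
    simpa only [Instr.run, hs.1, Expr.eval] using set hs d (σ.reg x)
  | const c =>
    exact ⟨_, PolyBd.const 1, fun N σ hN d s hs => Ensures.instr (set hs d c)⟩
  | add e f he hf =>
    obtain ⟨Te, hTe, he⟩ := he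
    obtain ⟨Tf, hTf, hf⟩ := hf
    obtain ⟨V, hV, hV'⟩ := f.exists_eval_le
    refine ⟨_, hTe.add (hTf.add (((PolyBd.const 3).mul hV).add (PolyBd.const 2))),
      two (op := fun x y => x + y) he hf ?_⟩
    intro N σ hN d s hs h1 h2
    refine (ensures_addTo (by omega) (by omega) (by omega) s).mono ?_ ?_
    · rw [h2]; have := hV' N σ hN; omega
    · rintro s' ⟨hv, hr, hm⟩
      refine ⟨⟨fun x => ?_, hm.trans hs.2⟩, by rw [hv, h1, h2], fun j hj => ?_⟩
      · rw [hr _ (ne_tmp _ _) (ne_tmp _ _), hs.1]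
      · exact hr _ (by rw [Ne, tmp_inj]; omega) (by rw [Ne, tmp_inj]; omega)
  | sub e f he hf =>
    obtain ⟨Te, hTe, he⟩ := he
    obtain ⟨Tf, hTf, hf⟩ := hf
    refine ⟨_, hTe.add (hTf.add (PolyBd.const 1)), two (op := fun x y => x - y) he hf ?_⟩
    intro N σ hN d s hs h1 h2
    refine Ensures.instr ?_
    simpa only [Instr.run, h1, h2] using set hs d (e.eval σ - f.eval σ)
  | get a e he =>
    obtain ⟨Te, hTe, he⟩ := he
    refine ⟨_, hTe.add (PolyBd.const 1), fun N σ hN d s hs => ?_⟩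
    refine Ensures.seq ((he N σ hN d s hs).mono le_rfl ?_)
    rintro s1 ⟨ha1, hv1, hf1⟩
    refine Ensures.instr ?_
    obtain ⟨h1, h2, h3⟩ := set ha1 d (s1.mem a (s1.reg (tmp d)))
    refine ⟨h1, h2.trans ?_, fun j hj => (h3 j hj).trans (hf1 j hj)⟩
    rw [hv1, ha1.2]; rfl
  | eq e f he hf =>
    obtain ⟨Te, hTe, he⟩ := he
    obtain ⟨Tf, hTf, hf⟩ := hf
    refine ⟨_, hTe.add (hTf.add (PolyBd.const (1 + 1))),
      two (op := fun x y => if x = y then 1 else 0) he hf ?_⟩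
    intro N σ hN d s hs h1 h2
    refine Ensures.ite ?_ ?_ <;> intro hb <;> refine Ensures.instr ?_ <;>
      simp only [Test.holds, h1, h2] at hb <;> simp only [hb, if_true, if_false] <;>
      exact set hs d _
  | lt e f he hf =>
    obtain ⟨Te, hTe, he⟩ := he
    obtain ⟨Tf, hTf, hf⟩ := hf
    refine ⟨_, hTe.add (hTf.add (PolyBd.const (1 + 1))),
      two (op := fun x y => if x < y then 1 else 0) he hf ?_⟩
    intro N σ hN d s hs h1 h2
    refine Ensures.ite ?_ ?_ <;> intro hb <;> refine Ensures.instr ?_ <;>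
      simp only [Test.holds, h1, h2] at hb <;> simp only [hb, if_true, if_false] <;>
      exact set hs d _
  | sum x e f he hf =>
    obtain ⟨Te, hTe, he⟩ := he
    obtain ⟨Tf, hTf, hf⟩ := hf
    obtain ⟨V, hV, hV'⟩ := e.exists_eval_le
    obtain ⟨W, hW, hW'⟩ := f.exists_eval_le
    -- While the sum is evaluated, `N + V N` bounds the state, as `x` stays below the value of `e`.
    have hB := PolyBd.id.add hV
    let R : ℕ → ℕ := fun N => 1 + (Tf (N + V N) + ((3 * W (N + V N) + 2) + 1))
    have hR : PolyBd R := (PolyBd.const 1).add ((hTf.comp hB).add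
      ((((PolyBd.const 3).mul (hW.comp hB)).add (PolyBd.const 2)).add (PolyBd.const 1)))
    refine ⟨fun N => Te N + (1 + (1 + (1 + ((V N * (1 + R N) + 1) + 1)))),
      hTe.add ((PolyBd.const 1).add ((PolyBd.const 1).add ((PolyBd.const 1).add
        (((hV.mul ((PolyBd.const 1).add hR)).add (PolyBd.const 1)).add (PolyBd.const 1))))),
      fun N σ hN d s hs => ?_⟩
    have he1 := hV' N σ hN
    refine Ensures.seq ((he N σ hN (d + 1) s hs).mono le_rfl ?_)
    rintro s1 ⟨ha1, hv1, hf1⟩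
    refine Ensures.seq (Ensures.instr ?_)
    refine Ensures.seq (Ensures.instr ?_)
    refine Ensures.seq (Ensures.instr ?_)
    refine Ensures.seq ?_
    have n01 : tmp d ≠ tmp (d + 1) := by rw [Ne, tmp_inj]; omega
    have n02 : tmp d ≠ tmp (d + 2) := by rw [Ne, tmp_inj]; omega
    have n03 : tmp d ≠ tmp (d + 3) := by rw [Ne, tmp_inj]; omega
    have n12 : tmp (d + 1) ≠ tmp (d + 2) := by rw [Ne, tmp_inj]; omega
    have n13 : tmp (d + 1) ≠ tmp (d + 3) := by rw [Ne, tmp_inj]; omega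
    have n23 : tmp (d + 2) ≠ tmp (d + 3) := by rw [Ne, tmp_inj]; omega
    refine (Ensures.loop (T := R N) (fun i s' =>
      (∀ y, y ≠ x → s'.reg (2 * y) = σ.reg y) ∧ s'.mem = σ.mem ∧
      s'.reg (tmp d) = ∑ j ∈ Finset.range i, f.eval (σ.setReg x j) ∧
      s'.reg (tmp (d + 1)) = e.eval σ ∧ s'.reg (tmp (d + 2)) = i ∧
      s'.reg (tmp (d + 3)) = σ.reg x ∧ ∀ j < d, s'.reg (tmp j) = s.reg (tmp j)) (e.eval σ)
      ?_ ?_ ?_).mono (by gcongr) ?_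
    · rintro i s' hi ⟨hy, hm, h0, h1, h2, h3, hj⟩
      refine ⟨by simpa only [Test.holds, h1, h2] using hi, ?_⟩
      refine Ensures.seq (Ensures.instr ?_)
      have hag : Agree (σ.setReg x i) ((Instr.copy (2 * x) (tmp (d + 2))).run s') := by
        refine ⟨fun y => ?_, hm⟩
        by_cases hyx : y = x
        · subst hyx; simp [Instr.run, State.setReg, h2]
        · simp [Instr.run, State.setReg, hyx, hy]
      have hbd : Bounded (N + V N) (σ.setReg x i) :=
        (hN.mono (by omega)).setReg (by omega) x
      have hc : ∀ j, ((Instr.copy (2 * x) (tmp (d + 2))).run s').reg (tmp j) = s'.reg (tmp j) := by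
        intro j; simp [Instr.run, State.setReg, tmp_ne]
      refine Ensures.seq ((hf _ _ hbd (d + 4) _ hag).mono le_rfl ?_)
      rintro s2 ⟨ha2, hv2, hf2⟩
      have hf2' : ∀ j < d + 4, s2.reg (tmp j) = s'.reg (tmp j) :=
        fun j hj => (hf2 j hj).trans (hc j)
      refine Ensures.seq ((ensures_addTo (by omega) (by omega) (by omega) s2).mono ?_ ?_)
      · rw [hv2]; have := hW' _ _ hbd; omega
      rintro s3 ⟨hv3, hr3, hm3⟩
      refine Ensures.instr ?_
      have hr3' : ∀ j, j ≠ d → j < d + 4 → s3.reg (tmp j) = s'.reg (tmp j) := fun j hj hj' => by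
        rw [hr3 _ (by rwa [Ne, tmp_inj]) (by rw [Ne, tmp_inj]; omega), hf2' j hj']
      refine ⟨fun y hyx => ?_, ?_, ?_, ?_, ?_, ?_, fun j hjd => ?_⟩
      · simp only [Instr.run, State.setReg]
        rw [Function.update_of_ne (ne_tmp _ _), hr3 _ (ne_tmp _ _) (ne_tmp _ _), ha2.1]
        simp [State.setReg, hyx]
      · exact hm3.trans ha2.2
      · simp only [Instr.run, State.setReg]
        rw [Function.update_of_ne n02, hv3, hv2, hf2' d (by omega), h0]
        exact (Finset.sum_range_succ _ _).symm
      · simp only [Instr.run, State.setReg]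
        rw [Function.update_of_ne n12, hr3' _ (by omega) (by omega), h1]
      · simp only [Instr.run, State.setReg, Function.update_self]
        rw [hr3' _ (by omega) (by omega), h2]
      · simp only [Instr.run, State.setReg]
        rw [Function.update_of_ne n23.symm, hr3' _ (by omega) (by omega), h3]
      · simp only [Instr.run, State.setReg]
        rw [Function.update_of_ne (by rw [Ne, tmp_inj]; omega), hr3' _ (by omega) (by omega),
          hj j hjd]
    · rintro s' ⟨hy, hm, h0, h1, h2, h3, hj⟩
      simp only [Test.holds, h1, h2, lt_irrefl, not_false_eq_true]
    · have hx : ∀ j, 2 * j ≠ tmp d ∧ 2 * j ≠ tmp (d + 2) ∧ 2 * j ≠ tmp (d + 3) :=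
        fun j => ⟨ne_tmp _ _, ne_tmp _ _, ne_tmp _ _⟩
      refine ⟨fun y hyx => ?_, ha1.2, ?_, ?_, ?_, ?_, fun j hjd => ?_⟩
      · simp [Instr.run, State.setReg, hx, ha1.1]
      · simp [Instr.run, State.setReg, n02, n03]
      · simp [Instr.run, State.setReg, n01.symm, n12, n13, hv1]
      · simp [Instr.run, State.setReg, n23]
      · simp [Instr.run, State.setReg, hx, ha1.1]
      · have := hf1 j (by omega)
        have h4 : j ≠ d ∧ j ≠ d + 2 ∧ j ≠ d + 3 := by omega
        simp [Instr.run, State.setReg, tmp_inj, h4, this]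
    · rintro s' ⟨hy, hm, h0, h1, h2, h3, hj⟩
      refine Ensures.instr ⟨⟨fun y => ?_, hm⟩, ?_, fun j hjd => ?_⟩
      · by_cases hyx : y = x
        · subst hyx; simp [Instr.run, State.setReg, h3]
        · simp [Instr.run, State.setReg, hyx, hy]
      · simp only [Instr.run, State.setReg]
        rw [Function.update_of_ne (tmp_ne _ _), h0]; rfl
      · simp only [Instr.run, State.setReg]
        rw [Function.update_of_ne (tmp_ne _ _), hj j hjd]

namespace State

@[simp] theorem setReg_reg (s : State) (x v y : ℕ) :
    (s.setReg x v).reg y = if y = x then v else s.reg y := by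
  simp [setReg, Function.update_apply]

@[simp] theorem setReg_mem (s : State) (x v : ℕ) : (s.setReg x v).mem = s.mem := rfl

@[simp] theorem setMem_reg (s : State) (a i v : ℕ) : (s.setMem a i v).reg = s.reg := rfl

theorem setMem_mem (s : State) (a i v b j : ℕ) :
    (s.setMem a i v).mem b j = if b = a ∧ j = i then v else s.mem b j := by
  by_cases h : b = a
  · subst h; simp [setMem, Function.update_apply]
  · simp [setMem, h]

@[simp] theorem setMem_mem_of_ne (s : State) {a b : ℕ} (i v : ℕ) (h : b ≠ a) :
    (s.setMem a i v).mem b = s.mem b := by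
  simp [setMem, h]

end State

/-! ### Statements with bounded loops and their compilation -/

/-- The variable that holds the cap: no assignment stores a larger number. -/
def capVar : ℕ := 2

/-- Statements, with bounded loops as the only loops. -/
inductive Stmt where
  | skip
  | assign (x : ℕ) (e : Expr)
  | store (a : ℕ) (e f : Expr)
  | seq (p q : Stmt)
  /-- The first branch is taken if the value of `e` is not `0`. -/
  | ite (e : Expr) (p q : Stmt)
  /-- Run `p` for `x = 0, 1, …` below the value that `e` has at the start. -/
  | loop (x : ℕ) (e : Expr) (p : Stmt)

/-- The value of an expression, truncated at the cap. Because assigned values and numbers of rounds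
are truncated, the running time of a statement is polynomial in the cap for syntactic reasons. -/
def Expr.cval (e : Expr) (s : State) : ℕ := min (e.eval s) (s.reg capVar)

/-- The effect of a statement. -/
def Stmt.eval : Stmt → State → State
  | .skip, s => s
  | .assign x e, s => s.setReg x (e.cval s)
  | .store a e f, s => s.setMem a (e.eval s) (f.cval s)
  | .seq p q, s => q.eval (p.eval s)
  | .ite e p q, s => if e.eval s = 0 then q.eval s else p.eval s
  | .loop x e p, s => Nat.rec s (fun i τ => p.eval (τ.setReg x i)) (e.cval s)

theorem Expr.cval_le (e : Expr) {N : ℕ} {s : State} (h : Bounded N s) : e.cval s ≤ N :=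
  (min_le_right _ _).trans (h.1 _)

/-- The induction principle for bounded loops. -/
theorem Stmt.loop_induction {x : ℕ} {e : Expr} {p : Stmt} {s : State} (P : ℕ → State → Prop)
    (h0 : P 0 s) (hs : ∀ i τ, i < e.cval s → P i τ → P (i + 1) (p.eval (τ.setReg x i))) :
    P (e.cval s) ((Stmt.loop x e p).eval s) := by
  have : ∀ m ≤ e.cval s, P m (Nat.rec s (fun i τ => p.eval (τ.setReg x i)) m) := by
    intro m
    induction m with
    | zero => exact fun _ => h0
    | succ m ih => exact fun hm => hs m _ (by omega) (ih (by omega))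
  exact this _ le_rfl

theorem Stmt.bounded_eval (p : Stmt) {N : ℕ} {s : State} (h : Bounded N s) :
    Bounded N (p.eval s) := by
  induction p generalizing s with
  | skip => exact h
  | assign x e => exact h.setReg (e.cval_le h) x
  | store a e f => exact h.setMem (f.cval_le h) a _
  | seq p q hp hq => exact hq (hp h)
  | ite e p q hp hq =>
    simp only [Stmt.eval]
    split_ifs
    exacts [hq h, hp h]
  | loop x e p hp =>
    refine Stmt.loop_induction (fun _ τ => Bounded N τ) h fun i τ hi hτ => hp (hτ.setReg ?_ x)
    exact hi.le.trans (e.cval_le h)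

/-- The variables that a statement may change. -/
def Stmt.regs : Stmt → List ℕ
  | .skip => []
  | .assign x _ => [x]
  | .store _ _ _ => []
  | .seq p q => p.regs ++ q.regs
  | .ite _ p q => p.regs ++ q.regs
  | .loop x _ p => x :: p.regs

/-- The arrays that a statement may change. -/
def Stmt.arrs : Stmt → List ℕ
  | .skip => []
  | .assign _ _ => []
  | .store a _ _ => [a]
  | .seq p q => p.arrs ++ q.arrs
  | .ite _ p q => p.arrs ++ q.arrs
  | .loop _ _ p => p.arrs

theorem Stmt.eval_reg (p : Stmt) {x : ℕ} (h : x ∉ p.regs) (s : State) :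
    (p.eval s).reg x = s.reg x := by
  induction p generalizing s with
  | skip => rfl
  | assign y e => simpa [Stmt.eval, Stmt.regs] using fun h' => absurd h' (by simpa [regs] using h)
  | store a e f => rfl
  | seq p q hp hq =>
    simp only [regs, List.mem_append, not_or] at h
    simp only [eval, hq h.2, hp h.1]
  | ite e p q hp hq =>
    simp only [regs, List.mem_append, not_or] at h
    simp only [eval]
    split_ifs
    exacts [hq h.2 s, hp h.1 s]
  | loop y e p hp =>
    simp only [regs, List.mem_cons, not_or] at h
    refine Stmt.loop_induction (fun _ τ => τ.reg x = s.reg x) rfl fun i τ hi hτ => ?_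
    simp [hp h.2, h.1, hτ]

theorem Stmt.eval_mem (p : Stmt) {a : ℕ} (h : a ∉ p.arrs) (s : State) :
    (p.eval s).mem a = s.mem a := by
  induction p generalizing s with
  | skip => rfl
  | assign y e => rfl
  | store b e f => exact State.setMem_mem_of_ne _ _ _ (by simpa [arrs] using h)
  | seq p q hp hq =>
    simp only [arrs, List.mem_append, not_or] at h
    simp only [eval, hq h.2, hp h.1]
  | ite e p q hp hq =>
    simp only [arrs, List.mem_append, not_or] at h
    simp only [eval]
    split_ifs
    exacts [hq h.2 s, hp h.1 s]
  | loop y e p hp =>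
    refine Stmt.loop_induction (fun _ τ => τ.mem a = s.mem a) rfl fun i τ hi hτ => ?_
    simp [hp h, hτ]

/-- Compute the truncated value of the expression into `tmp d`. -/
def Expr.ccomp (e : Expr) (d : ℕ) : Prog :=
  .seq (e.comp d) (.ite (.lt (2 * capVar) (tmp d)) (.instr (.copy (tmp d) (2 * capVar))) .skip)

theorem Expr.exists_ctime (e : Expr) :
    ∃ T, PolyBd T ∧ ∀ N σ, Bounded N σ → ∀ d s, Agree σ s →
      Ensures (e.ccomp d) s (T N) (Computes σ (e.cval σ) d s) := by
  obtain ⟨T, hT, h⟩ := e.exists_time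
  refine ⟨_, hT.add (PolyBd.const (1 + 1)), fun N σ hN d s hs => ?_⟩
  refine Ensures.seq ((h N σ hN d s hs).mono le_rfl ?_)
  rintro s1 ⟨ha, hv, hj⟩
  refine Ensures.ite (fun hb => Ensures.instr ?_) (fun hb => Ensures.skip ?_) <;>
    simp only [Test.holds, ha.1, hv] at hb
  · refine ⟨ha.setTmp d _, ?_, fun j hjd => ?_⟩
    · simp [Instr.run, ha.1, Expr.cval, hb.le]
    · have : j ≠ d := by omega
      simp [Instr.run, tmp_inj, this, hj j hjd]
  · exact ⟨ha, by rw [hv, Expr.cval, min_eq_left (by omega)], hj⟩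

/-- A program with the effect of the statement that changes no `tmp j` with `j < d`. -/
def Stmt.comp : Stmt → ℕ → Prog
  | .skip, _ => .skip
  | .assign x e, d => .seq (e.ccomp d) (.instr (.copy (2 * x) (tmp d)))
  | .store a e f, d =>
    .seq (e.comp d) (.seq (f.ccomp (d + 1)) (.instr (.store a (tmp d) (tmp (d + 1)))))
  | .seq p q, d => .seq (p.comp d) (q.comp d)
  | .ite e p q, d =>
    .seq (e.comp d) (.seq (.instr (.const (tmp (d + 1)) 0))
      (.ite (.eq (tmp d) (tmp (d + 1))) (q.comp d) (p.comp d)))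
  | .loop x e p, d =>
    .seq (e.ccomp d) (.seq (.instr (.const (tmp (d + 1)) 0))
      (.loop (.lt (tmp (d + 1)) (tmp d))
        (.seq (.instr (.copy (2 * x) (tmp (d + 1))))
          (.seq (p.comp (d + 2)) (.instr (.succ (tmp (d + 1))))))))

/-- What a compiled statement guarantees about its final state `s'`. -/
def Performs (σ : State) (d : ℕ) (s s' : State) : Prop :=
  Agree σ s' ∧ ∀ j < d, s'.reg (tmp j) = s.reg (tmp j)

/-- Statements compile to programs whose running time is polynomial in the numbers of the state. -/
theorem Stmt.exists_time (p : Stmt) :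
    ∃ T, PolyBd T ∧ ∀ N σ, Bounded N σ → ∀ d s, Agree σ s →
      Ensures (p.comp d) s (T N) (Performs (p.eval σ) d s) := by
  induction p with
  | skip => exact ⟨_, PolyBd.const 1, fun N σ hN d s hs => Ensures.skip ⟨hs, fun _ _ => rfl⟩⟩
  | assign x e =>
    obtain ⟨T, hT, h⟩ := e.exists_ctime
    refine ⟨_, hT.add (PolyBd.const 1), fun N σ hN d s hs => ?_⟩
    refine Ensures.seq ((h N σ hN d s hs).mono le_rfl ?_)
    rintro s1 ⟨ha, hv, hj⟩
    refine Ensures.instr ⟨?_, fun j hjd => ?_⟩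
    · simpa only [Instr.run, Stmt.eval, hv] using ha.setReg x (e.cval σ)
    · simp [Instr.run, tmp_ne, hj j hjd]
  | store a e f =>
    obtain ⟨T, hT, h⟩ := e.exists_time
    obtain ⟨T', hT', h'⟩ := f.exists_ctime
    refine ⟨_, hT.add (hT'.add (PolyBd.const 1)), fun N σ hN d s hs => ?_⟩
    refine Ensures.seq ((h N σ hN d s hs).mono le_rfl ?_)
    rintro s1 ⟨ha1, hv1, hj1⟩
    refine Ensures.seq ((h' N σ hN (d + 1) s1 ha1).mono le_rfl ?_)
    rintro s2 ⟨ha2, hv2, hj2⟩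
    refine Ensures.instr ⟨⟨fun x => ha2.1 x, ?_⟩, fun j hjd => ?_⟩
    · simp only [Instr.run, Stmt.eval, State.setMem, ha2.2, hv2, hj2 d (by omega), hv1]
    · exact (hj2 j (by omega)).trans (hj1 j hjd)
  | seq p q hp hq =>
    obtain ⟨T, hT, h⟩ := hp
    obtain ⟨T', hT', h'⟩ := hq
    refine ⟨_, hT.add hT', fun N σ hN d s hs => ?_⟩
    refine Ensures.seq ((h N σ hN d s hs).mono le_rfl ?_)
    rintro s1 ⟨ha1, hj1⟩
    refine (h' N _ (p.bounded_eval hN) d s1 ha1).mono le_rfl ?_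
    rintro s2 ⟨ha2, hj2⟩
    exact ⟨ha2, fun j hjd => (hj2 j hjd).trans (hj1 j hjd)⟩
  | ite e p q hp hq =>
    obtain ⟨T, hT, h⟩ := e.exists_time
    obtain ⟨Tp, hTp, hp⟩ := hp
    obtain ⟨Tq, hTq, hq⟩ := hq
    refine ⟨_, hT.add ((PolyBd.const 1).add ((PolyBd.const 1).add (hTp.add hTq))),
      fun N σ hN d s hs => ?_⟩
    refine Ensures.seq ((h N σ hN d s hs).mono le_rfl ?_)
    rintro s1 ⟨ha1, hv1, hj1⟩
    refine Ensures.seq (Ensures.instr ?_)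
    have ha2 : Agree σ ((Instr.const (tmp (d + 1)) 0).run s1) := ha1.setTmp _ _
    have hj2 : ∀ j < d, ((Instr.const (tmp (d + 1)) 0).run s1).reg (tmp j) = s.reg (tmp j) := by
      intro j hjd
      have : j ≠ d + 1 := by omega
      simp [Instr.run, tmp_inj, this, hj1 j hjd]
    refine Ensures.ite (fun hb => ?_) (fun hb => ?_) <;>
      simp [Test.holds, Instr.run, tmp_inj, hv1] at hb
    · refine (hq N σ hN d _ ha2).mono (by omega) ?_
      rintro s3 ⟨ha3, hj3⟩
      exact ⟨by simpa [Stmt.eval, hb] using ha3, fun j hjd => (hj3 j hjd).trans (hj2 j hjd)⟩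
    · refine (hp N σ hN d _ ha2).mono (by omega) ?_
      rintro s3 ⟨ha3, hj3⟩
      exact ⟨by simpa [Stmt.eval, hb] using ha3, fun j hjd => (hj3 j hjd).trans (hj2 j hjd)⟩
  | loop x e p hp =>
    obtain ⟨T, hT, h⟩ := e.exists_ctime
    obtain ⟨Tp, hTp, hp⟩ := hp
    let R : ℕ → ℕ := fun N => 1 + (Tp N + 1)
    have hR : PolyBd R := (PolyBd.const 1).add (hTp.add (PolyBd.const 1))
    refine ⟨fun N => T N + (1 + (N * (1 + R N) + 1)),
      hT.add ((PolyBd.const 1).add ((PolyBd.id.mul ((PolyBd.const 1).add hR)).add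
        (PolyBd.const 1))), fun N σ hN d s hs => ?_⟩
    refine Ensures.seq ((h N σ hN d s hs).mono le_rfl ?_)
    rintro s1 ⟨ha1, hv1, hj1⟩
    refine Ensures.seq (Ensures.instr ?_)
    have hle : e.cval σ ≤ N := e.cval_le hN
    let it : ℕ → State := fun i => Nat.rec σ (fun i τ => p.eval (τ.setReg x i)) i
    have n1 : tmp d ≠ tmp (d + 1) := by rw [Ne, tmp_inj]; omega
    refine (Ensures.loop (T := R N) (fun i s' => Bounded N (it i) ∧ Agree (it i) s' ∧
      s'.reg (tmp d) = e.cval σ ∧ s'.reg (tmp (d + 1)) = i ∧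
      ∀ j < d, s'.reg (tmp j) = s.reg (tmp j)) (e.cval σ) ?_ ?_ ?_).mono (by gcongr) ?_
    · rintro i s' hi ⟨hb, ha, h0, h1, hj⟩
      refine ⟨by simpa only [Test.holds, h0, h1] using hi, ?_⟩
      have hb' : Bounded N ((it i).setReg x i) := hb.setReg (by omega) x
      refine Ensures.seq (Ensures.instr ?_)
      have ha' : Agree ((it i).setReg x i) ((Instr.copy (2 * x) (tmp (d + 1))).run s') := by
        simpa only [Instr.run, h1] using ha.setReg x i
      refine Ensures.seq ((hp N _ hb' (d + 2) _ ha').mono le_rfl ?_)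
      rintro s2 ⟨ha2, hj2⟩
      have hj2' : ∀ j < d + 2, s2.reg (tmp j) = s'.reg (tmp j) := by
        intro j hjd
        simp [hj2 j hjd, Instr.run, tmp_ne]
      refine Ensures.instr ⟨p.bounded_eval hb', ha2.setTmp _ _, ?_, ?_, fun j hjd => ?_⟩
      · simp [Instr.run, n1, hj2' d (by omega), h0]
      · simp [Instr.run, hj2' (d + 1) (by omega), h1]
      · have : j ≠ d + 1 := by omega
        simp [Instr.run, tmp_inj, this, hj2' j (by omega), hj j hjd]
    · rintro s' ⟨hb, ha, h0, h1, hj⟩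
      simp only [Test.holds, h0, h1, lt_irrefl, not_false_eq_true]
    · refine ⟨hN, ha1.setTmp _ _, ?_, ?_, fun j hjd => ?_⟩
      · simp [Instr.run, n1, hv1]
      · simp [Instr.run]
      · have : j ≠ d + 1 := by omega
        simp [Instr.run, tmp_inj, this, hj1 j hjd]
    · rintro s' ⟨hb, ha, h0, h1, hj⟩
      exact ⟨ha, hj⟩

/-- Repeat the statement as long as the value of the expression is not `0`. -/
def whileProg (e : Expr) (p : Stmt) : Prog :=
  .seq (.seq (e.comp 0) (.instr (.const (tmp 1) 0)))
    (.loop (.lt (tmp 1) (tmp 0))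
      (.seq (p.comp 0) (.seq (e.comp 0) (.instr (.const (tmp 1) 0)))))

/-- If the loop ends after `m` rounds, the compiled program takes `m + 1` times a number of steps that
is polynomial in the numbers of the initial state: statements never exceed the cap, so the bound is
the same for all rounds. -/
theorem exists_time_whileProg (e : Expr) (p : Stmt) :
    ∃ T, PolyBd T ∧ ∀ N σ, Bounded N σ → ∀ m, (∀ i < m, e.eval (p.eval^[i] σ) ≠ 0) →
      e.eval (p.eval^[m] σ) = 0 → ∀ s, Agree σ s →
        Ensures (whileProg e p) s ((m + 1) * T N) (Agree (p.eval^[m] σ)) := by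
  obtain ⟨Te, hTe, he⟩ := e.exists_time
  obtain ⟨Tp, hTp, hp⟩ := p.exists_time
  refine ⟨fun N => 1 + (Tp N + (Te N + 1)) + 1,
    ((PolyBd.const 1).add (hTp.add (hTe.add (PolyBd.const 1)))).add (PolyBd.const 1),
    fun N σ hN m hm hm' s hs => ?_⟩
  have test : ∀ τ, Bounded N τ → ∀ s, Agree τ s →
      Ensures (.seq (e.comp 0) (.instr (.const (tmp 1) 0))) s (Te N + 1) fun s' =>
        Agree τ s' ∧ s'.reg (tmp 0) = e.eval τ ∧ s'.reg (tmp 1) = 0 := by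
    intro τ hτ s hs
    refine Ensures.seq ((he N τ hτ 0 s hs).mono le_rfl ?_)
    rintro s1 ⟨ha1, hv1, -⟩
    exact Ensures.instr ⟨ha1.setTmp _ _, by simp [Instr.run, tmp_inj, hv1], by simp [Instr.run]⟩
  refine Ensures.mono (Ensures.seq (T := Te N + 1)
    (T' := m * (1 + (Tp N + (Te N + 1))) + 1) ?_) ?_ (fun _ h => h)
  · refine (test σ hN s hs).mono le_rfl fun s1 hs1 => ?_
    refine (Ensures.loop (T := Tp N + (Te N + 1)) (fun i s' => Bounded N (p.eval^[i] σ) ∧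
      Agree (p.eval^[i] σ) s' ∧ s'.reg (tmp 0) = e.eval (p.eval^[i] σ) ∧ s'.reg (tmp 1) = 0) m
      ?_ ?_ ?_).mono le_rfl fun s' h => h.2.1
    · rintro i s' hi ⟨hb, ha, h0, h1⟩
      refine ⟨by simpa only [Test.holds, h0, h1] using Nat.pos_of_ne_zero (hm i hi), ?_⟩
      refine Ensures.seq ((hp N _ hb 0 s' ha).mono le_rfl ?_)
      rintro s2 ⟨ha2, -⟩
      rw [Function.iterate_succ_apply']
      exact (test _ (p.bounded_eval hb) s2 ha2).mono le_rfl fun s3 h3 =>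
        ⟨p.bounded_eval hb, h3⟩
    · rintro s' ⟨hb, ha, h0, h1⟩
      simp only [Test.holds, h0, h1, hm', lt_irrefl, not_false_eq_true]
    · exact ⟨hN, hs1⟩
  · ring_nf
    nlinarith [Nat.zero_le (Tp N), Nat.zero_le (Te N)]

end RAM

/-! ### Partial isomorphisms and guesses -/

section Guess

variable {V₁ V₂ : Type*}

/-- `P` is the graph of an isomorphism between two induced subgraphs. -/
def IsPartialIso (G₁ : SimpleGraph V₁) (G₂ : SimpleGraph V₂) (P : V₁ → V₂ → Prop) : Prop :=
  ∀ u v u' v', P u v → P u' v' → ((u = u' ↔ v = v') ∧ (G₁.Adj u u' ↔ G₂.Adj v v'))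

/-- `M` is a maximal matching in the bipartite graph `K`. -/
structure IsMaximalMatching (K M : V₁ → V₂ → Prop) : Prop where
  le : ∀ u v, M u v → K u v
  inj : ∀ u v u' v', M u v → M u' v' → (u = u' ↔ v = v')
  maximal : ∀ u v, K u v → (∃ v', M u v') ∨ ∃ u', M u' v

/-- Whether two vertices are related depends only on a key of each. -/
def Difunctional (K : V₁ → V₂ → Prop) : Prop :=
  ∀ u v u' v', K u v → K u' v → K u' v' → K u v'

/-- If `Q` is a matching in `K` that saturates the left class of `u`, so does every maximal
matching. -/
theorem IsMaximalMatching.exists_of_saturated [Finite V₁] {K M Q : V₁ → V₂ → Prop}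
    (hM : IsMaximalMatching K M) (hK : Difunctional K)
    (hQ : ∀ u v u' v', Q u v → Q u' v' → (u = u' ↔ v = v')) {v : V₂}
    (hsat : ∀ u, K u v → ∃ v', Q u v' ∧ K u v') {u : V₁} (huv : K u v) : ∃ v', M u v' := by
  by_contra hu
  -- Otherwise all right partners of `u` are matched, and `Q` followed by the inverse of `M` is an
  -- injection of the left class of `u` into itself that misses `u`.
  have key : ∀ x : {x // K x v}, ∃ y : {y // K y v}, ∃ v', Q x v' ∧ M y v' := by
    rintro ⟨x, hx⟩
    obtain ⟨v', hq, hk⟩ := hsat x hx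
    have huv' : K u v' := hK u v x v' huv hx hk
    obtain h | ⟨y, hy⟩ := hM.maximal u v' huv'
    · exact absurd h hu
    · exact ⟨⟨y, hK y v' u v (hM.le _ _ hy) huv' huv⟩, v', hq, hy⟩
  choose f hf using key
  have hinj : Function.Injective f := by
    intro x y hxy
    obtain ⟨a, ha, ha'⟩ := hf x
    obtain ⟨b, hb, hb'⟩ := hf y
    rw [hxy] at ha'
    have hab : a = b := (hM.inj _ _ _ _ ha' hb').1 rfl
    exact Subtype.ext ((hQ _ _ _ _ ha hb).2 hab)
  obtain ⟨x, hx⟩ := Finite.injective_iff_surjective.1 hinj ⟨u, huv⟩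
  obtain ⟨a, -, ha⟩ := hf x
  rw [hx] at ha
  exact hu ⟨a, ha⟩

/-- What is guessed about a common induced subgraph, relative to vertex covers of the two graphs:
the isomorphism `A` between the vertices that lie in the cover on both sides; the cover vertices
`B` of the first graph whose partners are not in the cover; the cover vertices `D` of the second
graph whose partners are not in the cover; and the adjacency `H` of `B` and the partners of `D`. -/
structure Guess (V₁ V₂ : Type*) where
  A : V₁ → V₂ → Prop
  B : V₁ → Prop
  D : V₂ → Prop
  H : V₁ → V₂ → Prop

variable (G₁ : SimpleGraph V₁) (G₂ : SimpleGraph V₂) (C₁ : Set V₁) (C₂ : Set V₂)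

/-- A guess allows `u` and `v` to be partners: both are usable, and they have the same adjacency to
the part of the subgraph that the guess describes. -/
def Guess.Compat (g : Guess V₁ V₂) (u : V₁) (v : V₂) : Prop :=
  (u ∉ C₁ ∨ g.B u) ∧ (v ∉ C₂ ∨ g.D v) ∧
  (∀ x y, g.A x y → (G₁.Adj u x ↔ G₂.Adj v y)) ∧
  (∀ b, g.B b → (G₁.Adj u b ↔ g.D v ∧ g.H b v)) ∧
  (∀ d, g.D d → (G₂.Adj v d ↔ g.B u ∧ g.H u d))

theorem Guess.difunctional_compat (g : Guess V₁ V₂) :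
    Difunctional (g.Compat G₁ G₂ C₁ C₂) := by
  rintro u v u' v' ⟨h1, h2, h3, h4, h5⟩ ⟨i1, i2, i3, i4, i5⟩ ⟨j1, j2, j3, j4, j5⟩
  exact ⟨h1, j2,
    fun x y h => ((h3 x y h).trans (i3 x y h).symm).trans (j3 x y h),
    fun b h => ((h4 b h).trans (i4 b h).symm).trans (j4 b h),
    fun d h => ((j5 d h).trans (i5 d h).symm).trans (h5 d h)⟩

/-- The guess that describes a given partial isomorphism. -/
def Guess.ofIso (P : V₁ → V₂ → Prop) : Guess V₁ V₂ where
  A u v := P u v ∧ u ∈ C₁ ∧ v ∈ C₂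
  B u := u ∈ C₁ ∧ ∃ v, P u v ∧ v ∉ C₂
  D v := v ∈ C₂ ∧ ∃ u, P u v ∧ u ∉ C₁
  H b d := ∃ u, P u d ∧ G₁.Adj b u

variable {G₁ G₂ C₁ C₂} {P : V₁ → V₂ → Prop}

/-- The guess that describes a partial isomorphism allows all its pairs, except those that it
contains explicitly. If `u` is adjacent to an element `b` of `B`, the partner of `u` is in the second
cover, because the partner of `b` is not; this is why `H` need only be known on `D`. -/
theorem IsPartialIso.compat (hP : IsPartialIso G₁ G₂ P) (h₁ : G₁.IsVertexCover C₁)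
    (h₂ : G₂.IsVertexCover C₂) {u : V₁} {v : V₂} (huv : P u v) (hA : ¬ (u ∈ C₁ ∧ v ∈ C₂)) :
    (Guess.ofIso G₁ C₁ C₂ P).Compat G₁ G₂ C₁ C₂ u v := by
  refine ⟨?_, ?_, ?_, ?_, ?_⟩
  · by_cases hu : u ∈ C₁
    · exact .inr ⟨hu, v, huv, fun hv => hA ⟨hu, hv⟩⟩
    · exact .inl hu
  · by_cases hv : v ∈ C₂
    · exact .inr ⟨hv, u, huv, fun hu => hA ⟨hu, hv⟩⟩
    · exact .inl hv
  · rintro x y ⟨hxy, -⟩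
    exact (hP _ _ _ _ huv hxy).2
  · rintro b ⟨hb, c, hbc, hc⟩
    constructor
    · intro hub
      have hvc : G₂.Adj v c := (hP _ _ _ _ huv hbc).2.1 hub
      have hv : v ∈ C₂ := (h₂ hvc).resolve_right hc
      exact ⟨⟨hv, u, huv, fun hu => hA ⟨hu, hv⟩⟩, u, huv, hub.symm⟩
    · rintro ⟨-, u', hu', hbu'⟩
      obtain rfl : u = u' := (hP _ _ _ _ huv hu').1.2 rfl
      exact hbu'.symm
  · rintro d ⟨hd, c, hcd, hc⟩
    constructor
    · intro hvd
      have huc : G₁.Adj u c := (hP _ _ _ _ huv hcd).2.2 hvd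
      have hu : u ∈ C₁ := (h₁ huc).resolve_right hc
      exact ⟨⟨hu, v, huv, fun hv => hA ⟨hu, hv⟩⟩, c, hcd, huc⟩
    · rintro ⟨-, u', hu', huu'⟩
      exact (hP _ _ _ _ huv hu').2.1 huu'

/-- For the guess that describes a partial isomorphism, compatible pairs from any matching may be
added to the guessed pairs. -/
theorem IsPartialIso.extend (hP : IsPartialIso G₁ G₂ P) (h₁ : G₁.IsVertexCover C₁)
    (h₂ : G₂.IsVertexCover C₂) {M : V₁ → V₂ → Prop}
    (hM : IsMaximalMatching ((Guess.ofIso G₁ C₁ C₂ P).Compat G₁ G₂ C₁ C₂) M) :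
    IsPartialIso G₁ G₂ fun u v => (Guess.ofIso G₁ C₁ C₂ P).A u v ∨ M u v := by
  set g := Guess.ofIso G₁ C₁ C₂ P with hg
  -- Guessed pairs and matched pairs are disjoint on both sides.
  have hne : ∀ x y u v, g.A x y → M u v → x ≠ u ∧ y ≠ v := by
    rintro x y u v ⟨hxy, hx, hy⟩ huv
    obtain ⟨hL, hR, -⟩ := hM.le _ _ huv
    constructor
    · rintro rfl
      obtain h | ⟨-, v', h, hv'⟩ := hL
      · exact h hx
      · obtain rfl := (hP _ _ _ _ hxy h).1.1 rfl
        exact hv' hy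
    · rintro rfl
      obtain h | ⟨-, u', h, hu'⟩ := hR
      · exact h hy
      · obtain rfl := (hP _ _ _ _ hxy h).1.2 rfl
        exact hu' hx
  -- Both `B` and `D` are independent, being partners of vertices outside of a cover.
  have hB : ∀ b b', g.B b → g.B b' → ¬ G₁.Adj b b' := by
    rintro b b' ⟨-, c, hc, hc'⟩ ⟨-, d, hd, hd'⟩ h
    exact (h₂ ((hP _ _ _ _ hc hd).2.1 h)).elim hc' hd'
  have hD : ∀ d d', g.D d → g.D d' → ¬ G₂.Adj d d' := by
    rintro b b' ⟨-, c, hc, hc'⟩ ⟨-, d, hd, hd'⟩ h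
    exact (h₁ ((hP _ _ _ _ hc hd).2.2 h)).elim hc' hd'
  -- Compatible pairs preserve edges: one end of the edge is in the cover, hence in `B`, and the
  -- partner of the other end is then in `D` with the adjacency given by `H`.
  have key : ∀ u v u' v', g.Compat G₁ G₂ C₁ C₂ u v → g.Compat G₁ G₂ C₁ C₂ u' v' →
      G₁.Adj u u' → G₂.Adj v v' := by
    have aux : ∀ u v u' v', g.Compat G₁ G₂ C₁ C₂ u v → g.Compat G₁ G₂ C₁ C₂ u' v' →
        g.B u → G₁.Adj u u' → G₂.Adj v v' := by
      rintro u v u' v' ⟨-, -, -, -, i5⟩ ⟨-, -, -, j4, -⟩ hu h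
      obtain ⟨hd, hh⟩ := (j4 u hu).1 h.symm
      exact (i5 v' hd).2 ⟨hu, hh⟩
    intro u v u' v' hc hc' h
    obtain h' | h' := h₁ h
    · exact aux u v u' v' hc hc' (hc.1.resolve_left fun h => h h') h
    · exact (aux u' v' u v hc' hc (hc'.1.resolve_left fun h => h h') h.symm).symm
  have key' : ∀ u v u' v', g.Compat G₁ G₂ C₁ C₂ u v → g.Compat G₁ G₂ C₁ C₂ u' v' →
      G₂.Adj v v' → G₁.Adj u u' := by
    have aux : ∀ u v u' v', g.Compat G₁ G₂ C₁ C₂ u v → g.Compat G₁ G₂ C₁ C₂ u' v' →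
        g.D v → G₂.Adj v v' → G₁.Adj u u' := by
      rintro u v u' v' ⟨-, -, -, i4, -⟩ ⟨-, -, -, -, j5⟩ hv h
      obtain ⟨hb, hh⟩ := (j5 v hv).1 h.symm
      exact (i4 u' hb).2 ⟨hv, hh⟩
    intro u v u' v' hc hc' h
    obtain h' | h' := h₂ h
    · exact aux u v u' v' hc hc' (hc.2.1.resolve_left fun h => h h') h
    · exact (aux u' v' u v hc' hc (hc'.2.1.resolve_left fun h => h h') h.symm).symm
  rintro u v u' v' (huv | huv) (huv' | huv')
  · exact hP _ _ _ _ huv.1 huv'.1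
  · have := hne _ _ _ _ huv huv'
    refine ⟨by simp [this], ?_⟩
    rw [G₁.adj_comm, G₂.adj_comm]
    exact (hM.le _ _ huv').2.2.1 _ _ huv
  · have := hne _ _ _ _ huv' huv
    exact ⟨by simp [this.1.symm, this.2.symm], (hM.le _ _ huv).2.2.1 _ _ huv'⟩
  · have hc := hM.le _ _ huv
    have hc' := hM.le _ _ huv'
    exact ⟨hM.inj _ _ _ _ huv huv', key _ _ _ _ hc hc', key' _ _ _ _ hc hc'⟩

/-- The domain of a connected partial isomorphism embeds into the domain of every subgraph that is
built from its guess with a maximal matching. A vertex stays where it is if it belongs to the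
guessed pairs or if the matching saturates its left class; otherwise the matching saturates the
right class, and the vertex moves to the one that is matched with its partner. Only vertices of the
first kind occur as the end in the cover of an edge, so edges are preserved. -/
theorem IsPartialIso.exists_connected [Finite V₁] (hP : IsPartialIso G₁ G₂ P)
    (h₁ : G₁.IsVertexCover C₁) (h₂ : G₂.IsVertexCover C₂) {M : V₁ → V₂ → Prop}
    (hM : IsMaximalMatching ((Guess.ofIso G₁ C₁ C₂ P).Compat G₁ G₂ C₁ C₂) M)
    (hconn : (G₁.induce {u | ∃ v, P u v}).Preconnected) :
    ∃ Y : Set V₁, (∀ u ∈ Y, ∃ v, (Guess.ofIso G₁ C₁ C₂ P).A u v ∨ M u v) ∧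
      (G₁.induce Y).Preconnected ∧ Y.ncard = {u | ∃ v, P u v}.ncard := by
  have hcompat := fun u v => hP.compat h₁ h₂ (u := u) (v := v)
  have hK := (Guess.ofIso G₁ C₁ C₂ P).difunctional_compat G₁ G₂ C₁ C₂
  set g := Guess.ofIso G₁ C₁ C₂ P with hg
  set K := g.Compat G₁ G₂ C₁ C₂ with hKdef
  -- The matching saturates the left class of `u`.
  let Full : V₁ → Prop := fun u => ∀ u' v, K u v → K u' v → ∃ v', M u' v'
  have hex : ∀ u : {u | ∃ v, P u v}, ∃ w : V₁, ∃ v, P u v ∧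
      ((g.A u v ∧ w = u) ∨ (¬ (u.1 ∈ C₁ ∧ v ∈ C₂) ∧
        ((Full u ∧ w = u) ∨ (¬ Full u ∧ M w v)))) := by
    rintro ⟨u, v, huv⟩
    by_cases hA : u ∈ C₁ ∧ v ∈ C₂
    · exact ⟨u, v, huv, .inl ⟨⟨huv, hA⟩, rfl⟩⟩
    by_cases hF : Full u
    · exact ⟨u, v, huv, .inr ⟨hA, .inl ⟨hF, rfl⟩⟩⟩
    have hF' := hF
    simp only [Full, not_forall] at hF'
    obtain ⟨u', v', hu, hu', hno⟩ := hF'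
    obtain h | ⟨w, hw⟩ := hM.maximal u' v (hK _ _ _ _ hu' hu (hcompat _ _ huv hA))
    · exact absurd h hno
    · exact ⟨w, v, huv, .inr ⟨hA, .inr ⟨hF, hw⟩⟩⟩
  choose ψ hψ using hex
  have hFull : ∀ u u' v, K u v → K u' v → Full u → Full u' := fun u u' v hu hu' hF x y hx hx' =>
    hF x y (hK _ _ _ _ hu hu' hx) hx'
  have hinj : Function.Injective ψ := by
    have hAne : ∀ x y u v, g.A x y → K u v → x ≠ u := by
      rintro x y u v ⟨hxy, hx, hy⟩ ⟨hL, -⟩ rfl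
      obtain h | ⟨-, v', h, hv'⟩ := hL
      · exact h hx
      · obtain rfl := (hP _ _ _ _ hxy h).1.1 rfl
        exact hv' hy
    rintro x y hxy
    obtain ⟨v, hxv, hx⟩ := hψ x
    obtain ⟨v', hyv, hy⟩ := hψ y
    rw [← hxy] at hy
    rcases hx with ⟨hA, hx⟩ | ⟨hA, ⟨hF, hx⟩ | ⟨hF, hx⟩⟩ <;>
      rcases hy with ⟨hA', hy⟩ | ⟨hA', ⟨hF', hy⟩ | ⟨hF', hy⟩⟩
    · exact Subtype.ext (hx.symm.trans hy)
    · exact Subtype.ext (hx.symm.trans hy)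
    · exact absurd hx.symm (hAne _ _ _ _ hA (hM.le _ _ hy))
    · exact Subtype.ext (hx.symm.trans hy)
    · exact Subtype.ext (hx.symm.trans hy)
    · rw [hx] at hy
      exact absurd (hFull _ _ v' (hM.le _ _ hy) (hcompat _ _ hyv hA') hF) hF'
    · exact absurd hy.symm (hAne _ _ _ _ hA' (hM.le _ _ hx))
    · rw [hy] at hx
      exact absurd (hFull _ _ v (hM.le _ _ hx) (hcompat _ _ hxv hA) hF') hF
    · exact Subtype.ext ((hP _ _ _ _ hxv hyv).1.2 ((hM.inj _ _ _ _ hx hy).1 rfl))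
  -- Edges are preserved: an end in the cover stays where it is, and the other end keeps its
  -- adjacency to that vertex because it moves within its class.
  have hadj : ∀ x y : {u | ∃ v, P u v}, G₁.Adj x y → G₁.Adj (ψ x) (ψ y) := by
    have auxA : ∀ x y : {u | ∃ v, P u v}, (∃ v, g.A x v) → G₁.Adj x y →
        G₁.Adj (ψ x) (ψ y) := by
      rintro x y ⟨w, hw⟩ h
      obtain ⟨v, hxv, hx⟩ := hψ x
      obtain ⟨v', hyv, hy⟩ := hψ y
      have hvw : v = w := (hP _ _ _ _ hxv hw.1).1.1 rfl
      have hxx : ψ x = x := by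
        rcases hx with ⟨-, hx⟩ | ⟨hA, -⟩
        · exact hx
        · exact absurd (hvw ▸ hw.2) hA
      rw [hxx]
      rcases hy with ⟨hA', hy⟩ | ⟨hA', ⟨hF', hy⟩ | ⟨hF', hy⟩⟩
      · rwa [hy]
      · rwa [hy]
      · have h1 := (hM.le _ _ hy).2.2.1 _ _ hw
        have h2 := (hP _ _ _ _ hxv hyv).2.1 h
        exact (h1.2 (hvw ▸ h2.symm)).symm
    have aux : ∀ x y : {u | ∃ v, P u v}, x.1 ∈ C₁ → ¬ (∃ v, g.A x v) → ¬ (∃ v, g.A y v) →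
        G₁.Adj x y → G₁.Adj (ψ x) (ψ y) := by
      intro x y hxC hxA hyA h
      obtain ⟨v, hxv, hx⟩ := hψ x
      obtain ⟨v', hyv, hy⟩ := hψ y
      have hA : ¬ (x.1 ∈ C₁ ∧ v ∈ C₂) := fun hA => hxA ⟨v, hxv, hA⟩
      have hA' : ¬ (y.1 ∈ C₁ ∧ v' ∈ C₂) := fun hA => hyA ⟨v', hyv, hA⟩
      have hBx : g.B x := ⟨hxC, v, hxv, fun hv => hA ⟨hxC, hv⟩⟩
      have hvv : G₂.Adj v v' := (hP _ _ _ _ hxv hyv).2.1 h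
      have hv' : v' ∈ C₂ := (h₂ hvv).resolve_left fun hv => hA ⟨hxC, hv⟩
      have hDv : g.D v' := ⟨hv', y, hyv, fun hy => hA' ⟨hy, hv'⟩⟩
      have hxx : ψ x = x := by
        rcases hx with ⟨-, hx⟩ | ⟨-, ⟨-, hx⟩ | ⟨hF, -⟩⟩
        · exact hx
        · exact hx
        -- All vertices with the key of `x` are adjacent to a vertex of `D`, hence are in `B`.
        refine absurd (fun u' w hu hu' => ?_) hF
        refine hM.exists_of_saturated hK (fun a b c d h h' => (hP a b c d h h').1) (v := w) ?_ hu'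
        intro u'' hu''
        have hwv : G₂.Adj w v' := (hu.2.2.2.2 v' hDv).2 ⟨hBx, y, hyv, h⟩
        obtain ⟨hC, z, hz, hz'⟩ := ((hu''.2.2.2.2 v' hDv).1 hwv).1
        exact ⟨z, hz, hcompat _ _ hz fun h => hz' h.2⟩
      rw [hxx]
      rcases hy with ⟨-, hy⟩ | ⟨-, ⟨-, hy⟩ | ⟨-, hy⟩⟩
      · rwa [hy]
      · rwa [hy]
      · have h1 := (hM.le _ _ hy).2.2.2.1 _ hBx
        have h2 := (hcompat _ _ hyv hA').2.2.2.1 _ hBx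
        exact (h1.2 (h2.1 h.symm)).symm
    intro x y h
    by_cases hx : ∃ v, g.A x v
    · exact auxA x y hx h
    by_cases hy : ∃ v, g.A y v
    · exact (auxA y x hy h.symm).symm
    obtain hx' | hy' := h₁ h
    · exact aux x y hx' hx hy h
    · exact (aux y x hy' hy hx h.symm).symm
  refine ⟨Set.range ψ, ?_, ?_, ?_⟩
  · rintro _ ⟨x, rfl⟩
    obtain ⟨v, hxv, ⟨hA, hx⟩ | ⟨hA, ⟨hF, hx⟩ | ⟨hF, hx⟩⟩⟩ := hψ x
    · exact ⟨v, .inl (by rwa [hx])⟩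
    · have hk := hcompat _ _ hxv hA
      obtain ⟨v', hv'⟩ := hF x v hk hk
      exact ⟨v', .inr (by rwa [hx])⟩
    · exact ⟨v, .inr hx⟩
  · let f : G₁.induce {u | ∃ v, P u v} →g G₁.induce (Set.range ψ) :=
      { toFun := fun x => ⟨ψ x, x, rfl⟩
        map_rel' := fun {x y} h => hadj x y h }
    refine hconn.map f ?_
    rintro ⟨_, x, rfl⟩
    exact ⟨x, rfl⟩
  · rw [← Set.image_univ, Set.ncard_image_of_injective _ hinj, Set.ncard_univ]
    rfl

end Guess

/-! ### Matching by rank -/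

open Classical in
/-- Related vertices are matched if they have the same rank among the vertices with their key. -/
def RankMatch (K : ℕ → ℕ → Prop) (u v : ℕ) : Prop :=
  K u v ∧ Nat.count (K · v) u = Nat.count (K u ·) v

/-- In a difunctional relation, matching by rank within the classes is a maximal matching: of two
related classes, all of the smaller one is matched. -/
theorem isMaximalMatching_rankMatch {K : ℕ → ℕ → Prop} (hK : Difunctional K) {n₁ n₂ : ℕ}
    (hb : ∀ u v, K u v → u < n₁ ∧ v < n₂) : IsMaximalMatching K (RankMatch K) := by
  classical
  have hleft : ∀ {u v v'}, K u v → K u v' → (K · v) = (K · v') := fun {u v v'} h h' =>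
    funext fun x => propext ⟨fun hx => hK _ _ _ _ hx h h', fun hx => hK _ _ _ _ hx h' h⟩
  have hright : ∀ {u u' v}, K u v → K u' v → (K u ·) = (K u' ·) := fun {u u' v} h h' =>
    funext fun x => propext ⟨fun hx => hK _ _ _ _ h' h hx, fun hx => hK _ _ _ _ h h' hx⟩
  have hfin₁ : ∀ v, (Set.ofPred (K · v)).Finite := fun v =>
    (Set.finite_lt_nat n₁).subset fun u h => (hb u v h).1
  have hfin₂ : ∀ u, (Set.ofPred (K u ·)).Finite := fun u =>
    (Set.finite_lt_nat n₂).subset fun v h => (hb u v h).2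
  refine ⟨fun u v h => h.1, ?_, ?_⟩
  · rintro u v u' v' ⟨h, hc⟩ ⟨h', hc'⟩
    constructor
    · rintro rfl
      have e := hleft h h'
      simp only [e] at hc
      exact Nat.count_injective h h' (hc.symm.trans hc')
    · rintro rfl
      have e := hright h h'
      simp only [e] at hc
      exact Nat.count_injective (p := (K · v)) h h' (hc.trans hc'.symm)
  · intro u v h
    by_cases hr : Nat.count (K · v) u < (hfin₂ u).toFinset.card
    · left
      have hm : K u (Nat.nth (K u ·) (Nat.count (K · v) u)) :=
        Nat.nth_mem_of_lt_card (hfin₂ u) hr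
      refine ⟨_, hm, ?_⟩
      rw [Nat.count_nth fun _ => hr]
      have e := hleft hm h
      simp only [e]
    · right
      have h1 : Nat.count (K u ·) v < (hfin₂ u).toFinset.card :=
        Nat.count_lt_card (hfin₂ u) h
      have h2 : Nat.count (K · v) u < (hfin₁ v).toFinset.card :=
        Nat.count_lt_card (hfin₁ v) h
      have h3 : Nat.count (K u ·) v < (hfin₁ v).toFinset.card := by omega
      have hm : K (Nat.nth (K · v) (Nat.count (K u ·) v)) v :=
        Nat.nth_mem_of_lt_card (hfin₁ v) h3
      refine ⟨_, hm, ?_⟩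
      rw [Nat.count_nth (p := (K · v)) fun _ => h3]
      have e := hright hm h
      simp only [e]

/-! ### Mixed radix representations -/

section Radix

variable (b : ℕ → ℕ)

/-- The number of strings of length `i` with digits in base `b 0`, `b 1`, … -/
def weight (i : ℕ) : ℕ := ∏ j ∈ Finset.range i, b j

/-- The digit of index `i` of `T`, where digits have the bases `b 0`, `b 1`, … -/
def digit (T i : ℕ) : ℕ := T / weight b i % b i

variable {b}

theorem weight_succ (i : ℕ) : weight b (i + 1) = weight b i * b i := Finset.prod_range_succ _ _

theorem digit_lt (hb : ∀ i, 0 < b i) (T i : ℕ) : digit b T i < b i := Nat.mod_lt _ (hb i)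

theorem weight_pos (hb : ∀ i, 0 < b i) (i : ℕ) : 0 < weight b i := Finset.prod_pos fun j _ => hb j

theorem digit_zero (i : ℕ) : digit b 0 i = 0 := by simp [digit]

/-- Every string of digits represents a number. -/
theorem exists_digit_eq (hb : ∀ i, 0 < b i) (d : ℕ → ℕ) (hd : ∀ i, d i < b i) (L : ℕ) :
    ∃ T < weight b L, ∀ i < L, digit b T i = d i := by
  induction L with
  | zero => exact ⟨0, by simp [weight], by simp⟩
  | succ L ih =>
    obtain ⟨T, hT, hTd⟩ := ih
    refine ⟨T + d L * weight b L, ?_, fun i hi => ?_⟩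
    · rw [weight_succ]
      have := hd L
      nlinarith
    · rcases Nat.lt_succ_iff_lt_or_eq.1 hi with hi | rfl
      · rw [← hTd i hi]
        unfold digit
        rw [← Nat.mod_mul_right_div_self, ← Nat.mod_mul_right_div_self, ← weight_succ]
        have hdvd : weight b (i + 1) ∣ weight b L :=
          Finset.prod_dvd_prod_of_subset _ _ _ (by simpa using hi)
        rw [Nat.add_mod, Nat.mod_eq_zero_of_dvd (hdvd.mul_left (d L)), Nat.add_zero, Nat.mod_mod]
      · unfold digit
        rw [Nat.add_mul_div_right _ _ (weight_pos hb i), Nat.div_eq_of_lt hT, Nat.zero_add,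
          Nat.mod_eq_of_lt (hd i)]

theorem succ_mod_eq_ite {q m : ℕ} (hm : 0 < m) :
    (q + 1) % m = if q % m + 1 < m then q % m + 1 else 0 := by
  have h1 := Nat.mod_lt q hm
  rw [← Nat.mod_add_mod]
  split_ifs with h
  · exact Nat.mod_eq_of_lt h
  · rw [show q % m + 1 = m by omega, Nat.mod_self]

/-- How the addition of `1` changes a digit; a carry arrives at index `i` if `weight b i` divides
`T + 1`. -/
theorem digit_succ (hb : ∀ i, 0 < b i) (T i : ℕ) :
    digit b (T + 1) i = if weight b i ∣ T + 1 then
      (if digit b T i + 1 < b i then digit b T i + 1 else 0) else digit b T i := by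
  unfold digit
  rw [Nat.succ_div]
  split_ifs with h1 h2
  · rw [succ_mod_eq_ite (hb i), if_pos h2]
  · rw [succ_mod_eq_ite (hb i), if_neg h2]
  · rw [Nat.add_zero]

/-- The carry passes index `i` if it arrives there and the digit has its largest value. -/
theorem weight_dvd_succ (hb : ∀ i, 0 < b i) (T i : ℕ) :
    weight b (i + 1) ∣ T + 1 ↔ weight b i ∣ T + 1 ∧ ¬ digit b T i + 1 < b i := by
  have key : weight b i ∣ T + 1 → (weight b (i + 1) ∣ T + 1 ↔ ¬ digit b T i + 1 < b i) := by
    intro h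
    have h1 : (T + 1) / weight b i = T / weight b i + 1 := by rw [Nat.succ_div, if_pos h]
    rw [weight_succ]
    have h2 : weight b i * b i ∣ T + 1 ↔ b i ∣ (T + 1) / weight b i := by
      rw [Nat.dvd_div_iff_mul_dvd h]
    rw [h2, h1, Nat.dvd_iff_mod_eq_zero, succ_mod_eq_ite (hb i)]
    unfold digit
    split_ifs with h3 <;> simp [h3]
  constructor
  · intro h
    have h' : weight b i ∣ T + 1 := (Dvd.intro _ (weight_succ i).symm).trans h
    exact ⟨h', (key h').1 h⟩
  · rintro ⟨h, h'⟩
    exact (key h).2 h'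

end Radix

/-! ### Vertex covers from bit strings -/

section Cover

open Classical in
/-- One step of the construction of a vertex cover: if neither end of the edge `ij` is in the cover,
the next bit of `w` decides which one is added. Elements of the cover are numbered from `1` in
order of their addition by `st.1`, and `st.2` is their number. -/
noncomputable def coverStep (g : ℕ → ℕ → Prop) (w : ℕ → ℕ) (st : (ℕ → ℕ) × ℕ) (e : ℕ × ℕ) :
    (ℕ → ℕ) × ℕ :=
  if g e.1 e.2 ∧ st.1 e.1 = 0 ∧ st.1 e.2 = 0 then
    (Function.update st.1 (if w st.2 = 0 then e.1 else e.2) (st.2 + 1), st.2 + 1)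
  else st

/-- The cover that is constructed from the edges among the pairs in a list. -/
noncomputable def coverFold (g : ℕ → ℕ → Prop) (w : ℕ → ℕ) (st : (ℕ → ℕ) × ℕ)
    (es : List (ℕ × ℕ)) : (ℕ → ℕ) × ℕ := es.foldl (coverStep g w) st

/-- `st.1` numbers the elements of a set of `st.2` numbers below `n`. -/
structure CoverInv (n : ℕ) (st : (ℕ → ℕ) × ℕ) : Prop where
  lt : ∀ v, st.1 v ≠ 0 → v < n
  le : ∀ v, st.1 v ≤ st.2
  inj : ∀ v v', st.1 v ≠ 0 → st.1 v = st.1 v' → v = v'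
  card : ∃ s : Finset ℕ, s.card = st.2 ∧ ∀ v, v ∈ s ↔ st.1 v ≠ 0

variable {g : ℕ → ℕ → Prop} {w : ℕ → ℕ} {n : ℕ}

theorem CoverInv.update {a : ℕ → ℕ} {p v : ℕ} (h : CoverInv n (a, p)) (hv : v < n)
    (hav : a v = 0) : CoverInv n (Function.update a v (p + 1), p + 1) := by
  have hle := h.le
  dsimp only at hle
  refine ⟨fun x hx => ?_, fun x => ?_, fun x y hx hxy => ?_, ?_⟩
  · by_cases hxv : x = v
    · rwa [hxv]
    · exact h.lt x (by simpa [hxv] using hx)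
  · by_cases hxv : x = v
    · simp [hxv]
    · simpa [hxv] using (hle x).trans (Nat.le_succ p)
  · have h1 := hle x
    have h2 := hle y
    by_cases hxv : x = v <;> by_cases hyv : y = v
    · rw [hxv, hyv]
    · simp only [hxv, Function.update_self, Function.update_of_ne hyv] at hxy
      omega
    · simp only [hyv, Function.update_self, Function.update_of_ne hxv] at hxy
      omega
    · simp only [Function.update_of_ne hxv, Function.update_of_ne hyv] at hxy hx
      exact h.inj x y hx hxy
  · obtain ⟨s, hs, hmem⟩ := h.card
    refine ⟨insert v s, ?_, fun x => ?_⟩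
    · rw [Finset.card_insert_of_notMem (by simp [hmem, hav]), hs]
    · by_cases hxv : x = v
      · simp [hxv]
      · simp [hxv, hmem]

theorem CoverInv.step {st : (ℕ → ℕ) × ℕ} (h : CoverInv n st) {e : ℕ × ℕ}
    (he : e.1 < n ∧ e.2 < n) : CoverInv n (coverStep g w st e) := by
  unfold coverStep
  split_ifs with h1 h2
  · exact CoverInv.update (p := st.2) h he.1 h1.2.1
  · exact CoverInv.update (p := st.2) h he.2 h1.2.2
  · exact h

theorem CoverInv.fold {es : List (ℕ × ℕ)} {st : (ℕ → ℕ) × ℕ} (h : CoverInv n st)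
    (hes : ∀ e ∈ es, e.1 < n ∧ e.2 < n) : CoverInv n (coverFold g w st es) := by
  induction es generalizing st with
  | nil => exact h
  | cons e es ih =>
    exact ih (h.step (hes e (by simp))) fun e' he' => hes e' (by simp [he'])

theorem coverStep_ne_zero {st : (ℕ → ℕ) × ℕ} {e : ℕ × ℕ} {v : ℕ} (h : st.1 v ≠ 0) :
    (coverStep g w st e).1 v ≠ 0 := by
  unfold coverStep
  split_ifs with h1 h2
  · by_cases hv : v = e.1
    · simp [hv]
    · simpa [hv] using h
  · by_cases hv : v = e.2
    · simp [hv]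
    · simpa [hv] using h
  · exact h

theorem coverFold_ne_zero {es : List (ℕ × ℕ)} {st : (ℕ → ℕ) × ℕ} {v : ℕ} (h : st.1 v ≠ 0) :
    (coverFold g w st es).1 v ≠ 0 := by
  induction es generalizing st with
  | nil => exact h
  | cons e es ih => exact ih (coverStep_ne_zero h)

theorem coverFold_covers {es : List (ℕ × ℕ)} {st : (ℕ → ℕ) × ℕ} {e : ℕ × ℕ} (he : e ∈ es)
    (hg : g e.1 e.2) : (coverFold g w st es).1 e.1 ≠ 0 ∨ (coverFold g w st es).1 e.2 ≠ 0 := by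
  induction es generalizing st with
  | nil => simp at he
  | cons e' es ih =>
    rcases List.mem_cons.1 he with rfl | he
    · have key : (coverStep g w st e).1 e.1 ≠ 0 ∨ (coverStep g w st e).1 e.2 ≠ 0 := by
        unfold coverStep
        split_ifs with h1 h2
        · simp
        · simp
        · by_contra h3
          push Not at h3
          exact h1 ⟨hg, h3⟩
      exact key.imp (coverFold_ne_zero (es := es)) (coverFold_ne_zero (es := es))
    · exact ih he

/-- A vertex cover `X` with at most `k` elements determines `k` bits that lead to a subset
of `X`. -/
theorem exists_coverFold_subset {k : ℕ} {X : Finset ℕ} (hX : X.card ≤ k) {es : List (ℕ × ℕ)}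
    (hes : ∀ e ∈ es, e.1 < n ∧ e.2 < n) (hcov : ∀ e ∈ es, g e.1 e.2 → e.1 ∈ X ∨ e.2 ∈ X)
    {st : (ℕ → ℕ) × ℕ} (hst : CoverInv n st) (hsub : ∀ v, st.1 v ≠ 0 → v ∈ X) :
    ∃ (w : ℕ → ℕ) (st' : (ℕ → ℕ) × ℕ), (∀ p, w p < 2) ∧ (∀ v, st'.1 v ≠ 0 → v ∈ X) ∧
      ∀ w' : ℕ → ℕ, (∀ p, st.2 ≤ p → p < k → w' p = w p) → coverFold g w' st es = st' := by
  induction es generalizing st with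
  | nil => exact ⟨fun _ => 0, st, by simp, hsub, fun w' _ => rfl⟩
  | cons e es ih =>
    have hes' : ∀ e ∈ es, e.1 < n ∧ e.2 < n := fun e' he' => hes e' (by simp [he'])
    have hcov' : ∀ e ∈ es, g e.1 e.2 → e.1 ∈ X ∨ e.2 ∈ X := fun e' he' => hcov e' (by simp [he'])
    by_cases h : g e.1 e.2 ∧ st.1 e.1 = 0 ∧ st.1 e.2 = 0
    · obtain ⟨β, hβ, hβX⟩ : ∃ β, β < 2 ∧ (if β = 0 then e.1 else e.2) ∈ X := by
        rcases hcov e (by simp) h.1 with h' | h'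
        exacts [⟨0, by simp, by simpa⟩, ⟨1, by simp, by simpa⟩]
      set x := if β = 0 then e.1 else e.2 with hx
      have hx0 : st.1 x = 0 := by rw [hx]; split_ifs; exacts [h.2.1, h.2.2]
      have hxn : x < n := by rw [hx]; split_ifs; exacts [(hes e (by simp)).1, (hes e (by simp)).2]
      have hnew : CoverInv n (Function.update st.1 x (st.2 + 1), st.2 + 1) :=
        CoverInv.update (p := st.2) hst hxn hx0
      have hsub' : ∀ v, Function.update st.1 x (st.2 + 1) v ≠ 0 → v ∈ X := by
        intro v hv
        by_cases hvx : v = x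
        · rwa [hvx]
        · exact hsub v (by simpa [hvx] using hv)
      obtain ⟨w, st', hw, hst', hw'⟩ := ih hes' hcov' hnew hsub'
      have hlt : st.2 < k := by
        obtain ⟨s, hs, hmem⟩ := hnew.card
        have : s ⊆ X := fun v hv => hsub' v ((hmem v).1 hv)
        have := Finset.card_le_card this
        dsimp only at hs
        omega
      refine ⟨Function.update w st.2 β, st', fun p => ?_, hst', fun w' hww => ?_⟩
      · by_cases hp : p = st.2
        · simpa [hp] using hβ
        · simpa [hp] using hw p
      · have hb : w' st.2 = β := by simpa using hww st.2 le_rfl hlt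
        have hstep : coverStep g w' st e = (Function.update st.1 x (st.2 + 1), st.2 + 1) := by
          unfold coverStep
          rw [if_pos h, hb]
        change coverFold g w' (coverStep g w' st e) es = st'
        rw [hstep]
        refine hw' w' fun p hp hpk => ?_
        dsimp only at hp
        have : p ≠ st.2 := by omega
        simpa [this] using hww p (by omega) hpk
    · obtain ⟨w, st', hw, hst', hw'⟩ := ih hes' hcov' hst hsub
      refine ⟨w, st', hw, hst', fun w' hww => ?_⟩
      change coverFold g w' (coverStep g w' st e) es = st'
      unfold coverStep
      rw [if_neg h]
      exact hw' w' hww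

end Cover

/-! ### Arithmetic of the running time -/

/-- This is `(1 + 2 / k) ^ k ≤ exp 2 ≤ 9`. -/
theorem add_two_pow_le (k : ℕ) : (k + 2) ^ k ≤ 9 * k ^ k := by
  rcases Nat.eq_zero_or_pos k with rfl | hk
  · simp
  have hk' : (0 : ℝ) < k := by exact_mod_cast hk
  have h1 : (k + 2 : ℝ) ≤ k * Real.exp (2 / k) := by
    have := Real.add_one_le_exp (2 / (k : ℝ))
    calc (k + 2 : ℝ) = k * (2 / k + 1) := by field_simp; ring
      _ ≤ _ := by gcongr
  have h2 : Real.exp (2 / k) ^ k ≤ 9 := by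
    rw [← Real.exp_nat_mul, mul_div_cancel₀ _ hk'.ne']
    have := Real.exp_one_lt_d9
    have h0 := Real.exp_pos 1
    rw [show (2 : ℝ) = 1 + 1 by norm_num, Real.exp_add]
    nlinarith
  have h3 : ((k + 2 : ℝ)) ^ k ≤ 9 * (k : ℝ) ^ k := by
    calc (k + 2 : ℝ) ^ k ≤ (k * Real.exp (2 / k)) ^ k := by gcongr
      _ = k ^ k * Real.exp (2 / k) ^ k := mul_pow _ _ _
      _ ≤ k ^ k * 9 := by gcongr
      _ = _ := by ring
  exact_mod_cast h3

/-- The claimed dependence on the parameter. -/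
def fptBound (k : ℕ) : ℕ := (9 * k) ^ k * 2 ^ (k ^ 2)

theorem add_two_pow_mul_le (k : ℕ) :
    (k + 2) ^ k * 2 ^ (3 * k + k ^ 2) ≤ 9 * fptBound k := by
  calc (k + 2) ^ k * 2 ^ (3 * k + k ^ 2) = (k + 2) ^ k * (8 ^ k * 2 ^ k ^ 2) := by
        rw [pow_add, pow_mul]; norm_num
    _ ≤ (9 * k ^ k) * (9 ^ k * 2 ^ k ^ 2) := by
        gcongr
        · exact add_two_pow_le k
        · norm_num
    _ = 9 * fptBound k := by rw [fptBound, mul_pow]; ring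

theorem computable_fptBound : Computable fptBound := by
  have hmul : Primrec₂ fun (a : ℕ) (q : ℕ × ℕ) => q.2 * a :=
    Primrec.nat_mul.comp (Primrec.snd.comp Primrec.snd) Primrec.fst
  have hpow : Primrec₂ fun a b : ℕ => a ^ b :=
    (Primrec.nat_rec (Primrec.const 1) hmul).of_eq fun a b => by
        induction b with
        | zero => rfl
        | succ b ih => simp only [pow_succ, ← ih]
  have h9 : Primrec fun k : ℕ => 9 * k := Primrec.nat_mul.comp (Primrec.const 9) Primrec.id
  have hsq : Primrec fun k : ℕ => k ^ 2 := hpow.comp Primrec.id (Primrec.const 2)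
  exact (Primrec.nat_mul.comp (hpow.comp h9 Primrec.id)
    (hpow.comp (Primrec.const 2) hsq)).to_comp

namespace RAM

/-! ### Logical connectives for expressions -/

namespace Expr

/-- Nonzero values stand for truth. -/
def Holds (e : Expr) (s : State) : Prop := e.eval s ≠ 0

/-- Negation. -/
def not (e : Expr) : Expr := .eq e (.const 0)

/-- Disjunction. -/
def or (e f : Expr) : Expr := .add e f

/-- Conjunction. -/
def and (e f : Expr) : Expr := (e.not.or f.not).not

/-- Implication. -/
def imp (e f : Expr) : Expr := e.not.or f

/-- Equivalence. -/
def iff (e f : Expr) : Expr := .eq e.not f.not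

/-- Bounded existential quantification. -/
def ex (x : ℕ) (e f : Expr) : Expr := .sum x e f

/-- Bounded universal quantification. -/
def all (x : ℕ) (e f : Expr) : Expr := (ex x e f.not).not

/-- The product of a number and a number that does not depend on the variable `99`. -/
def mul (e f : Expr) : Expr := .sum 99 e f

variable (e f : Expr) (s : State) (x : ℕ)

theorem holds_not : e.not.Holds s ↔ ¬ e.Holds s := by
  by_cases h : e.eval s = 0 <;> simp [Holds, Expr.not, eval, h]

theorem holds_or : (e.or f).Holds s ↔ e.Holds s ∨ f.Holds s := by
  simp only [Holds, Expr.or, eval]; omega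

theorem holds_and : (e.and f).Holds s ↔ e.Holds s ∧ f.Holds s := by
  rw [Expr.and, holds_not, holds_or, holds_not, holds_not]; tauto

theorem holds_imp : (e.imp f).Holds s ↔ (e.Holds s → f.Holds s) := by
  rw [Expr.imp, holds_or, holds_not]; tauto

theorem holds_iff : (e.iff f).Holds s ↔ (e.Holds s ↔ f.Holds s) := by
  by_cases h1 : e.eval s = 0 <;> by_cases h2 : f.eval s = 0 <;>
    simp [Holds, Expr.iff, Expr.not, eval, h1, h2]

theorem holds_ex : (ex x e f).Holds s ↔ ∃ i < e.eval s, f.Holds (s.setReg x i) := by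
  simp [Holds, ex, eval]

theorem holds_all : (all x e f).Holds s ↔ ∀ i < e.eval s, f.Holds (s.setReg x i) := by
  rw [all, holds_not, holds_ex]; simp [holds_not]

theorem holds_eq : (Expr.eq e f).Holds s ↔ e.eval s = f.eval s := by simp [Holds, eval]

theorem holds_lt : (Expr.lt e f).Holds s ↔ e.eval s < f.eval s := by simp [Holds, eval]

theorem eval_and [Decidable ((e.and f).Holds s)] :
    (e.and f).eval s = if (e.and f).Holds s then 1 else 0 := by
  simp only [Holds, Expr.and, Expr.not, eval]
  split_ifs <;> simp_all

end Expr

theorem Stmt.eval_ite_pos {e : Expr} {s : State} (h : e.Holds s) (p q : Stmt) :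
    (Stmt.ite e p q).eval s = p.eval s := if_neg h

theorem Stmt.eval_ite_neg {e : Expr} {s : State} (h : ¬ e.Holds s) (p q : Stmt) :
    (Stmt.ite e p q).eval s = q.eval s := if_pos (not_not.1 h)

open RAM.Expr

/-! ### The program

Variables `0`, `1`: the numbers of vertices; `2`: the cap; `3`: the current bound `k` on the size of
the vertex covers; `4`: whether vertex covers of this size have been found; `5`: whether the search
is complete; `6`: the carry in the addition of `1` to the guess; `7`: the size of the best solution;
`8`, `9`: the sizes of the vertex covers; `10` to `19`: loops; from `20`: bound in expressions.
Arrays `0`, `1`: the graphs; `2`, `3`: the best solution; `4`: the guess; `5`, `6`: the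
vertex covers, with elements numbered from `1`; `7`: a connected component. -/

/-- Adjacency of the vertices in variables `i`, `j`, for the matrix in array `g` with the number of
vertices in variable `n`. -/
def adjE (g n i j : ℕ) : Expr := .get g (.add (mul (.var i) (.var n)) (.var j))

/-- The digit of the guess that tells the role of the cover vertex `u` of the first graph. -/
def roleE (u : ℕ) : Expr :=
  .get 4 (.sub (.add (.add (.var 3) (.var 3)) (.get 5 (.var u))) (.const 1))

/-- The guess maps the cover vertex `u` to the cover vertex `v`. -/
def mapE (u v : ℕ) : Expr :=
  (Expr.get 5 (.var u)).and
    ((Expr.get 6 (.var v)).and (.eq (roleE u) (.add (.get 6 (.var v)) (.const 1))))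

/-- The guess says that the cover vertex `u` has a partner outside of the cover. -/
def leftE (u : ℕ) : Expr := (Expr.get 5 (.var u)).and (.eq (roleE u) (.const 1))

/-- The guess says that the cover vertex `v` of the second graph has a partner outside of the
cover. -/
def rightE (v : ℕ) : Expr :=
  (Expr.get 6 (.var v)).and (.eq (.get 4 (.sub (.add (.add (.add (.var 3) (.var 3)) (.var 3))
    (.get 6 (.var v))) (.const 1))) (.const 1))

/-- The guess says that the cover vertex `b` is adjacent to the partner of `d`. -/
def crossE (b d : ℕ) : Expr :=
  .eq (.get 4 (.add (.add (.add (.add (.var 3) (.var 3)) (.add (.var 3) (.var 3)))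
    (mul (.sub (.get 5 (.var b)) (.const 1)) (.var 3))) (.sub (.get 6 (.var d)) (.const 1))))
    (.const 1)

/-- The guess allows `u` and `v` to be partners. -/
def compatE (u v : ℕ) : Expr :=
  ((Expr.get 5 (.var u)).not.or (leftE u)).and <| ((Expr.get 6 (.var v)).not.or (rightE v)).and <|
  (all 20 (.var 0) <| all 21 (.var 1) <|
    (mapE 20 21).imp ((adjE 0 0 u 20).iff (adjE 1 1 v 21))).and <|
  (all 22 (.var 0) <| (leftE 22).imp ((adjE 0 0 u 22).iff ((rightE v).and (crossE 22 v)))).and <|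
  all 23 (.var 1) <| (rightE 23).imp ((adjE 1 1 v 23).iff ((leftE u).and (crossE u 23)))

/-- The candidate for an isomorphism that belongs to the guess relates `u` and `v`. -/
def matchE (u v : ℕ) : Expr :=
  (mapE u v).or ((compatE u v).and
    (.eq (.sum 24 (.var u) (compatE 24 v)) (.sum 25 (.var v) (compatE u 25))))

/-- The candidate relates `u` to some vertex. -/
def domE (u : ℕ) : Expr := ex 27 (.var 1) (matchE u 27)

/-- The candidate is an isomorphism between induced subgraphs. -/
def checkE : Expr :=
  all 26 (.var 0) <| all 27 (.var 1) <| all 28 (.var 0) <| all 29 (.var 1) <|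
    ((matchE 26 27).and (matchE 28 29)).imp
      ((Expr.iff (.eq (.var 26) (.var 28)) (.eq (.var 27) (.var 29))).and
        ((adjE 0 0 26 28).iff (adjE 1 1 27 29)))

/-- Add an end of the edge between the vertices in variables `10` and `11` to the vertex cover in
array `a`, of size `p`, if neither end is in the cover. -/
def coverStepS (g n a p : ℕ) (off : Expr) : Stmt :=
  .ite ((adjE g n 10 11).and ((Expr.get a (.var 10)).not.and (Expr.get a (.var 11)).not))
    (.seq (.ite (.get 4 (.add off (.var p)))
        (.store a (.var 11) (.add (.var p) (.const 1)))
        (.store a (.var 10) (.add (.var p) (.const 1))))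
      (.assign p (.add (.var p) (.const 1))))
    .skip

/-- Compute a vertex cover in array `a` and its size in variable `p`, with the bits of the guess from
index `off` on. -/
def coverS (g n a p : ℕ) (off : Expr) : Stmt :=
  .seq (.assign p (.const 0)) <| .seq (.loop 10 (.var n) (.store a (.var 10) (.const 0))) <|
  .loop 10 (.var n) <| .loop 11 (.var n) <| coverStepS g n a p off

/-- Compute the component of the vertex in variable `12` in array `7`. -/
def componentS : Stmt :=
  .seq (.loop 13 (.var 0)
    (.store 7 (.var 13) ((Expr.eq (.var 13) (.var 12)).and (domE 13)))) <|
  .loop 15 (.var 0) <| .loop 13 (.var 0) <|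
    .ite ((domE 13).and (ex 16 (.var 0) ((Expr.get 7 (.var 16)).and (adjE 0 0 16 13))))
      (.store 7 (.var 13) (.const 1)) .skip

/-- Output the component if it is larger than all earlier ones. -/
def updateS : Stmt :=
  .ite (.lt (.var 7) (.sum 13 (.var 0) (.get 7 (.var 13))))
    (.seq (.assign 7 (.sum 13 (.var 0) (.get 7 (.var 13)))) <|
      .seq (.loop 13 (.var 0) (.store 2 (.var 13) (.get 7 (.var 13)))) <|
      .loop 14 (.var 1) (.store 3 (.var 14)
        (ex 13 (.var 0) ((Expr.get 7 (.var 13)).and (matchE 13 14)))))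
    .skip

/-- The length of a guess. -/
def lengthE : Expr :=
  .add (.add (.add (.var 3) (.var 3)) (.add (.var 3) (.var 3))) (mul (.var 3) (.var 3))

/-- The base of the digit whose index is in variable `10`. -/
def baseE : Expr :=
  .add (.const 2) (mul ((Expr.lt (.var 10) (.add (.var 3) (.var 3))).not.and
    (.lt (.var 10) (.add (.add (.var 3) (.var 3)) (.var 3)))) (.var 3))

/-- Add the carry to the digit whose index is in variable `10`. -/
def carryS : Stmt :=
  .ite (.var 6)
    (.ite (.lt (.add (.get 4 (.var 10)) (.const 1)) baseE)
      (.seq (.store 4 (.var 10) (.add (.get 4 (.var 10)) (.const 1))) (.assign 6 (.const 0)))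
      (.store 4 (.var 10) (.const 0)))
    .skip

/-- Add `1` to the guess. -/
def incrementS : Stmt := .seq (.assign 6 (.const 1)) <| .loop 10 lengthE carryS

/-- Try all components of the candidate that belongs to the guess. -/
def tryS : Stmt :=
  .ite checkE (.loop 12 (.var 0) (.seq componentS updateS)) .skip

/-- One round of the search. -/
def roundS : Stmt :=
  .seq (coverS 0 0 5 8 (.const 0)) <| .seq (coverS 1 1 6 9 (.var 3)) <|
  .seq (.ite ((Expr.lt (.var 3) (.var 8)).or (.lt (.var 3) (.var 9))) .skip
    (.seq (.assign 4 (.const 1)) tryS)) <|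
  .seq incrementS <|
  .ite (.var 6)
    (.ite (.var 4) (.assign 5 (.const 1)) (.assign 3 (.add (.var 3) (.const 1)))) .skip

/-- The cap, as a function of the numbers of vertices. -/
def capE : Expr :=
  mul (.add (.add (.var 0) (.var 1)) (.const 5)) (.add (.add (.var 0) (.var 1)) (.const 5))

/-- The whole program; the second number of vertices is moved from register `1`, which is a scratch
register of compiled code. -/
def mainProg : Prog :=
  .seq (.instr (.copy 2 1)) <| .seq (capE.comp 0) <| .seq (.instr (.copy (2 * capVar) (tmp 0))) <|
  whileProg (Expr.not (.var 5)) roundS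

/-! ### The meaning of the expressions -/

/-- The guess that the digits `w` describe, where `a₁` and `a₂` number the vertex covers. -/
def guessOf (n₁ n₂ k : ℕ) (w a₁ a₂ : ℕ → ℕ) : Guess (Fin n₁) (Fin n₂) where
  A u v := a₁ u ≠ 0 ∧ a₂ v ≠ 0 ∧ w (k + k + a₁ u - 1) = a₂ v + 1
  B u := a₁ u ≠ 0 ∧ w (k + k + a₁ u - 1) = 1
  D v := a₂ v ≠ 0 ∧ w (k + k + k + a₂ v - 1) = 1
  H u v := w (k + k + (k + k) + (a₁ u - 1) * k + (a₂ v - 1)) = 1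

/-- The state contains the instance `I`, the cap, the bound `k`, the guess `w` and the vertex covers
`a₁`, `a₂`. -/
structure Env (I : GraphPair) (k : ℕ) (w a₁ a₂ : ℕ → ℕ) (s : State) : Prop where
  n₁ : s.reg 0 = I.n₁
  n₂ : s.reg 1 = I.n₂
  cap : s.reg capVar = (I.n₁ + I.n₂ + 5) * (I.n₁ + I.n₂ + 5)
  k : s.reg 3 = k
  g₁ : s.mem 0 = adjArray I.G₁
  g₂ : s.mem 1 = adjArray I.G₂
  w : s.mem 4 = w
  a₁ : s.mem 5 = a₁
  a₂ : s.mem 6 = a₂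

/-- Row-by-row addressing is faithful for indices within the matrix. -/
theorem adjArray_ne_zero {n : ℕ} (G : SimpleGraph (Fin n)) {i j : ℕ} (hi : i < n) (hj : j < n) :
    adjArray G (i * n + j) ≠ 0 ↔ G.Adj ⟨i, hi⟩ ⟨j, hj⟩ := by
  unfold adjArray
  constructor
  · intro h
    split_ifs at h with h'
    · obtain ⟨a, b, hab, hG⟩ := h'
      have h1 : j = b := by
        have := congrArg (· % n) hab
        simpa [Nat.mul_add_mod', Nat.mod_eq_of_lt hj, Nat.mod_eq_of_lt b.2] using this
      have h2 : i = a := by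
        rw [h1] at hab
        exact Nat.eq_of_mul_eq_mul_right (by omega) (Nat.add_right_cancel hab)
      subst h1 h2
      exact hG
    · exact absurd rfl h
  · intro h
    rw [if_pos ⟨⟨i, hi⟩, ⟨j, hj⟩, rfl, h⟩]
    exact one_ne_zero

section Meaning

variable {I : GraphPair} {k : ℕ} {w a₁ a₂ : ℕ → ℕ} {s : State}

theorem Env.setReg (h : Env I k w a₁ a₂ s) {x : ℕ} (hx : 9 < x) (v : ℕ) :
    Env I k w a₁ a₂ (s.setReg x v) := by
  have h0 : x ≠ 0 ∧ x ≠ 1 ∧ x ≠ 2 ∧ x ≠ 3 := by omega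
  obtain ⟨h1, h2, h3, h4, h5, h6, h7, h8, h9⟩ := h
  constructor <;> simp_all [capVar, eq_comm]

theorem holds_adjE {g n i j : ℕ} (hn : n ≠ 99) :
    (adjE g n i j).Holds s ↔ s.mem g (s.reg i * s.reg n + s.reg j) ≠ 0 := by
  simp [Holds, adjE, mul, eval, hn]

theorem Env.holds_adjE₁ (h : Env I k w a₁ a₂ s) {i j : ℕ} (hi : s.reg i < I.n₁)
    (hj : s.reg j < I.n₁) :
    (adjE 0 0 i j).Holds s ↔ I.G₁.Adj ⟨s.reg i, hi⟩ ⟨s.reg j, hj⟩ := by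
  rw [holds_adjE (by decide), h.n₁, h.g₁, adjArray_ne_zero _ hi hj]

theorem Env.holds_adjE₂ (h : Env I k w a₁ a₂ s) {i j : ℕ} (hi : s.reg i < I.n₂)
    (hj : s.reg j < I.n₂) :
    (adjE 1 1 i j).Holds s ↔ I.G₂.Adj ⟨s.reg i, hi⟩ ⟨s.reg j, hj⟩ := by
  rw [holds_adjE (by decide), h.n₂, h.g₂, adjArray_ne_zero _ hi hj]

theorem Env.holds_mapE (h : Env I k w a₁ a₂ s) {u v : ℕ} (hu : s.reg u < I.n₁)
    (hv : s.reg v < I.n₂) :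
    (mapE u v).Holds s ↔ (guessOf I.n₁ I.n₂ k w a₁ a₂).A ⟨s.reg u, hu⟩ ⟨s.reg v, hv⟩ := by
  rw [mapE, holds_and, holds_and, holds_eq]
  simp [Holds, roleE, eval, h.k, h.w, h.a₁, h.a₂, guessOf]

theorem Env.holds_leftE (h : Env I k w a₁ a₂ s) {u : ℕ} (hu : s.reg u < I.n₁) :
    (leftE u).Holds s ↔ (guessOf I.n₁ I.n₂ k w a₁ a₂).B ⟨s.reg u, hu⟩ := by
  rw [leftE, holds_and, holds_eq]
  simp [Holds, roleE, eval, h.k, h.w, h.a₁, guessOf]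

theorem Env.holds_rightE (h : Env I k w a₁ a₂ s) {v : ℕ} (hv : s.reg v < I.n₂) :
    (rightE v).Holds s ↔ (guessOf I.n₁ I.n₂ k w a₁ a₂).D ⟨s.reg v, hv⟩ := by
  rw [rightE, holds_and, holds_eq]
  simp [Holds, eval, h.k, h.w, h.a₂, guessOf]

theorem Env.holds_crossE (h : Env I k w a₁ a₂ s) {u v : ℕ} (hu : s.reg u < I.n₁)
    (hv : s.reg v < I.n₂) :
    (crossE u v).Holds s ↔ (guessOf I.n₁ I.n₂ k w a₁ a₂).H ⟨s.reg u, hu⟩ ⟨s.reg v, hv⟩ := by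
  rw [crossE, holds_eq]
  simp [mul, eval, h.k, h.w, h.a₁, h.a₂, guessOf]

variable (I k w a₁ a₂) in
/-- The pairs of vertex numbers that the guess allows to be partners. -/
def CompatN (u v : ℕ) : Prop :=
  ∃ (hu : u < I.n₁) (hv : v < I.n₂), (guessOf I.n₁ I.n₂ k w a₁ a₂).Compat I.G₁ I.G₂
    {u | a₁ u ≠ 0} {v | a₂ v ≠ 0} ⟨u, hu⟩ ⟨v, hv⟩

theorem Env.holds_compatE (h : Env I k w a₁ a₂ s) {u v : ℕ}
    (hu' : 9 < u ∧ u < 20 ∨ 23 < u) (hv' : 9 < v ∧ v < 20 ∨ 23 < v) (hu : s.reg u < I.n₁)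
    (hv : s.reg v < I.n₂) :
    (compatE u v).Holds s ↔ CompatN I k w a₁ a₂ (s.reg u) (s.reg v) := by
  have h00 : u ≠ 20 ∧ u ≠ 21 ∧ u ≠ 22 ∧ u ≠ 23 ∧ v ≠ 20 ∧ v ≠ 21 ∧ v ≠ 22 ∧ v ≠ 23 := by omega
  obtain ⟨u0, u1, u2, u3, v0, v1, v2, v3⟩ := h00
  have e1 : (Expr.get 5 (.var u)).not.Holds s ↔ ¬ a₁ (s.reg u) ≠ 0 := by
    rw [holds_not]; simp [Holds, eval, h.a₁]
  have e2 : (Expr.get 6 (.var v)).not.Holds s ↔ ¬ a₂ (s.reg v) ≠ 0 := by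
    rw [holds_not]; simp [Holds, eval, h.a₂]
  rw [compatE, holds_and, holds_and, holds_and, holds_and, holds_or, holds_or, e1, e2,
    h.holds_leftE hu, h.holds_rightE hv, CompatN]
  simp only [hu, hv, exists_true_left, Guess.Compat, holds_all, Set.mem_ofPred_eq]
  refine and_congr Iff.rfl (and_congr Iff.rfl (and_congr ?_ (and_congr ?_ ?_)))
  · have key : ∀ i (hi : i < I.n₁) j (hj : j < I.n₂),
        ((mapE 20 21).imp ((adjE 0 0 u 20).iff (adjE 1 1 v 21))).Holds
          ((s.setReg 20 i).setReg 21 j) ↔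
        ((guessOf I.n₁ I.n₂ k w a₁ a₂).A ⟨i, hi⟩ ⟨j, hj⟩ →
          (I.G₁.Adj ⟨s.reg u, hu⟩ ⟨i, hi⟩ ↔ I.G₂.Adj ⟨s.reg v, hv⟩ ⟨j, hj⟩)) := by
      intro i hi j hj
      have h' := (h.setReg (x := 20) (by decide) i).setReg (x := 21) (by decide) j
      have r1 : ((s.setReg 20 i).setReg 21 j).reg 20 = i := by simp
      have r2 : ((s.setReg 20 i).setReg 21 j).reg 21 = j := by simp
      have r3 : ((s.setReg 20 i).setReg 21 j).reg u = s.reg u := by simp [u0, u1]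
      have r4 : ((s.setReg 20 i).setReg 21 j).reg v = s.reg v := by simp [v0, v1]
      rw [holds_imp, holds_iff, h'.holds_mapE (by rwa [r1]) (by rwa [r2]),
        h'.holds_adjE₁ (by rwa [r3]) (by rwa [r1]), h'.holds_adjE₂ (by rwa [r4]) (by rwa [r2])]
      simp only [r1, r2, r3, r4]
    constructor
    · rintro H ⟨i, hi⟩ ⟨j, hj⟩
      exact (key i hi j hj).1 (H i (by simpa [eval, h.n₁] using hi) j
        (by simpa [eval, h.n₂] using hj))
    · intro H i hi j hj
      have hi' : i < I.n₁ := by simpa [eval, h.n₁] using hi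
      have hj' : j < I.n₂ := by simpa [eval, h.n₂] using hj
      exact (key i hi' j hj').2 (H ⟨i, hi'⟩ ⟨j, hj'⟩)
  · have key : ∀ i (hi : i < I.n₁),
        ((leftE 22).imp ((adjE 0 0 u 22).iff ((rightE v).and (crossE 22 v)))).Holds
          (s.setReg 22 i) ↔
        ((guessOf I.n₁ I.n₂ k w a₁ a₂).B ⟨i, hi⟩ →
          (I.G₁.Adj ⟨s.reg u, hu⟩ ⟨i, hi⟩ ↔ (guessOf I.n₁ I.n₂ k w a₁ a₂).D ⟨s.reg v, hv⟩ ∧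
            (guessOf I.n₁ I.n₂ k w a₁ a₂).H ⟨i, hi⟩ ⟨s.reg v, hv⟩)) := by
      intro i hi
      have h' := h.setReg (x := 22) (by decide) i
      have r1 : (s.setReg 22 i).reg 22 = i := by simp
      have r3 : (s.setReg 22 i).reg u = s.reg u := by simp [u2]
      have r4 : (s.setReg 22 i).reg v = s.reg v := by simp [v2]
      rw [holds_imp, holds_iff, holds_and, h'.holds_leftE (by rwa [r1]),
        h'.holds_adjE₁ (by rwa [r3]) (by rwa [r1]), h'.holds_rightE (by rwa [r4]),
        h'.holds_crossE (by rwa [r1]) (by rwa [r4])]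
      simp only [r1, r3, r4]
    constructor
    · rintro H ⟨i, hi⟩
      exact (key i hi).1 (H i (by simpa [eval, h.n₁] using hi))
    · intro H i hi
      have hi' : i < I.n₁ := by simpa [eval, h.n₁] using hi
      exact (key i hi').2 (H ⟨i, hi'⟩)
  · have key : ∀ i (hi : i < I.n₂),
        ((rightE 23).imp ((adjE 1 1 v 23).iff ((leftE u).and (crossE u 23)))).Holds
          (s.setReg 23 i) ↔
        ((guessOf I.n₁ I.n₂ k w a₁ a₂).D ⟨i, hi⟩ →
          (I.G₂.Adj ⟨s.reg v, hv⟩ ⟨i, hi⟩ ↔ (guessOf I.n₁ I.n₂ k w a₁ a₂).B ⟨s.reg u, hu⟩ ∧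
            (guessOf I.n₁ I.n₂ k w a₁ a₂).H ⟨s.reg u, hu⟩ ⟨i, hi⟩)) := by
      intro i hi
      have h' := h.setReg (x := 23) (by decide) i
      have r1 : (s.setReg 23 i).reg 23 = i := by simp
      have r3 : (s.setReg 23 i).reg u = s.reg u := by simp [u3]
      have r4 : (s.setReg 23 i).reg v = s.reg v := by simp [v3]
      rw [holds_imp, holds_iff, holds_and, h'.holds_rightE (by rwa [r1]),
        h'.holds_adjE₂ (by rwa [r4]) (by rwa [r1]), h'.holds_leftE (by rwa [r3]),
        h'.holds_crossE (by rwa [r3]) (by rwa [r1])]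
      simp only [r1, r3, r4]
    constructor
    · rintro H ⟨i, hi⟩
      exact (key i hi).1 (H i (by simpa [eval, h.n₂] using hi))
    · intro H i hi
      have hi' : i < I.n₂ := by simpa [eval, h.n₂] using hi
      exact (key i hi').2 (H ⟨i, hi'⟩)

open Classical in
theorem Env.eval_compatE (h : Env I k w a₁ a₂ s) {u v : ℕ}
    (hu' : 9 < u ∧ u < 20 ∨ 23 < u) (hv' : 9 < v ∧ v < 20 ∨ 23 < v) (hu : s.reg u < I.n₁)
    (hv : s.reg v < I.n₂) :
    (compatE u v).eval s = if CompatN I k w a₁ a₂ (s.reg u) (s.reg v) then 1 else 0 := by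
  simp only [← h.holds_compatE hu' hv' hu hv]
  exact eval_and _ _ s

variable (I k w a₁ a₂) in
/-- The candidate for an isomorphism that belongs to a guess. -/
def Candidate (u : Fin I.n₁) (v : Fin I.n₂) : Prop :=
  (guessOf I.n₁ I.n₂ k w a₁ a₂).A u v ∨ RankMatch (CompatN I k w a₁ a₂) u v

theorem Env.holds_matchE (h : Env I k w a₁ a₂ s) {u v : ℕ}
    (hu' : 9 < u ∧ u < 20 ∨ 25 < u) (hv' : 9 < v ∧ v < 20 ∨ 25 < v) (hu : s.reg u < I.n₁)
    (hv : s.reg v < I.n₂) :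
    (matchE u v).Holds s ↔ Candidate I k w a₁ a₂ ⟨s.reg u, hu⟩ ⟨s.reg v, hv⟩ := by
  classical
  rw [matchE, holds_or, holds_and, holds_eq, h.holds_mapE hu hv,
    h.holds_compatE (by omega) (by omega) hu hv, Candidate, RankMatch]
  have h1 : (Expr.sum 24 (.var u) (compatE 24 v)).eval s =
      Nat.count (CompatN I k w a₁ a₂ · (s.reg v)) (s.reg u) := by
    rw [Nat.count_eq_card_filter_range, Finset.card_filter]
    simp only [eval]
    refine Finset.sum_congr rfl fun i hi => ?_
    rw [Finset.mem_range] at hi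
    have h' := h.setReg (x := 24) (by decide) i
    have r1 : (s.setReg 24 i).reg 24 = i := by simp
    have r2 : (s.setReg 24 i).reg v = s.reg v := by
      have : v ≠ 24 := by omega
      simp [this]
    rw [h'.eval_compatE (by omega) (by omega) (by rw [r1]; omega) (by rwa [r2])]
    simp only [r1, r2]
  have h2 : (Expr.sum 25 (.var v) (compatE u 25)).eval s =
      Nat.count (CompatN I k w a₁ a₂ (s.reg u) ·) (s.reg v) := by
    rw [Nat.count_eq_card_filter_range, Finset.card_filter]
    simp only [eval]
    refine Finset.sum_congr rfl fun i hi => ?_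
    rw [Finset.mem_range] at hi
    have h' := h.setReg (x := 25) (by decide) i
    have r1 : (s.setReg 25 i).reg 25 = i := by simp
    have r2 : (s.setReg 25 i).reg u = s.reg u := by
      have : u ≠ 25 := by omega
      simp [this]
    rw [h'.eval_compatE (by omega) (by omega) (by rwa [r2]) (by rw [r1]; omega)]
    simp only [r1, r2]
  rw [h1, h2]

theorem Env.holds_domE (h : Env I k w a₁ a₂ s) {u : ℕ}
    (hu' : 9 < u ∧ u < 20) (hu : s.reg u < I.n₁) :
    (domE u).Holds s ↔ ∃ v, Candidate I k w a₁ a₂ ⟨s.reg u, hu⟩ v := by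
  have key : ∀ i (hi : i < I.n₂), (matchE u 27).Holds (s.setReg 27 i) ↔
      Candidate I k w a₁ a₂ ⟨s.reg u, hu⟩ ⟨i, hi⟩ := by
    intro i hi
    have h' := h.setReg (x := 27) (by decide) i
    have r1 : (s.setReg 27 i).reg 27 = i := by simp
    have r2 : (s.setReg 27 i).reg u = s.reg u := by
      have : u ≠ 27 := by omega
      simp [this]
    rw [h'.holds_matchE (by omega) (by omega) (by rwa [r2]) (by rwa [r1])]
    simp only [r1, r2]
  rw [domE, holds_ex]
  constructor
  · rintro ⟨i, hi, H⟩
    exact ⟨⟨i, by simpa [eval, h.n₂] using hi⟩, (key i _).1 H⟩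
  · rintro ⟨⟨i, hi⟩, H⟩
    exact ⟨i, by simpa [eval, h.n₂] using hi, (key i hi).2 H⟩

theorem Env.holds_checkE (h : Env I k w a₁ a₂ s) :
    checkE.Holds s ↔ IsPartialIso I.G₁ I.G₂ (Candidate I k w a₁ a₂) := by
  have key : ∀ i (hi : i < I.n₁) j (hj : j < I.n₂) i' (hi' : i' < I.n₁) j' (hj' : j' < I.n₂),
      (((matchE 26 27).and (matchE 28 29)).imp
      ((Expr.iff (.eq (.var 26) (.var 28)) (.eq (.var 27) (.var 29))).and
        ((adjE 0 0 26 28).iff (adjE 1 1 27 29)))).Holds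
        ((((s.setReg 26 i).setReg 27 j).setReg 28 i').setReg 29 j') ↔
      (Candidate I k w a₁ a₂ ⟨i, hi⟩ ⟨j, hj⟩ → Candidate I k w a₁ a₂ ⟨i', hi'⟩ ⟨j', hj'⟩ →
        ((i = i' ↔ j = j') ∧
        (I.G₁.Adj ⟨i, hi⟩ ⟨i', hi'⟩ ↔ I.G₂.Adj ⟨j, hj⟩ ⟨j', hj'⟩))) := by
    intro i hi j hj i' hi' j' hj'
    have h' := (((h.setReg (x := 26) (by decide) i).setReg (x := 27) (by decide) j).setReg
      (x := 28) (by decide) i').setReg (x := 29) (by decide) j'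
    set t := (((s.setReg 26 i).setReg 27 j).setReg 28 i').setReg 29 j' with ht
    have r1 : t.reg 26 = i := by simp [ht]
    have r2 : t.reg 27 = j := by simp [ht]
    have r3 : t.reg 28 = i' := by simp [ht]
    have r4 : t.reg 29 = j' := by simp [ht]
    rw [holds_imp, holds_and, holds_and, holds_iff, holds_iff, holds_eq, holds_eq,
      h'.holds_matchE (by omega) (by omega) (by rwa [r1]) (by rwa [r2]),
      h'.holds_matchE (by omega) (by omega) (by rwa [r3]) (by rwa [r4]),
      h'.holds_adjE₁ (by rwa [r1]) (by rwa [r3]), h'.holds_adjE₂ (by rwa [r2]) (by rwa [r4])]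
    simp only [eval, r1, r2, r3, r4, and_imp]
  rw [checkE]
  simp only [holds_all]
  constructor
  · rintro H ⟨i, hi⟩ ⟨j, hj⟩ ⟨i', hi'⟩ ⟨j', hj'⟩ h1 h2
    have := (key i hi j hj i' hi' j' hj').1 (H i (by simpa [eval, h.n₁] using hi) j
      (by simpa [eval, h.n₂] using hj) i' (by simpa [eval, h.n₁] using hi') j'
      (by simpa [eval, h.n₂] using hj')) h1 h2
    simpa using this
  · intro H i hi j hj i' hi' j' hj'
    refine (key i (by simpa [eval, h.n₁] using hi) j (by simpa [eval, h.n₂] using hj) i'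
      (by simpa [eval, h.n₁] using hi') j' (by simpa [eval, h.n₂] using hj')).2 fun h1 h2 => ?_
    simpa using H _ _ _ _ h1 h2

end Meaning

/-! ### The computation of vertex covers -/

/-- The pairs of a number below `i` and a number below `N`, in the order of nested loops. -/
def pairs (N i : ℕ) : List (ℕ × ℕ) := (List.range i).flatMap fun i => (List.range N).map (i, ·)

theorem mem_pairs {N i : ℕ} {e : ℕ × ℕ} : e ∈ pairs N i ↔ e.1 < i ∧ e.2 < N := by
  obtain ⟨a, b⟩ := e
  simp [pairs]

theorem coverInv_zero (n : ℕ) : CoverInv n (fun _ => 0, 0) :=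
  ⟨by simp, by simp, by simp, ∅, by simp⟩

theorem _root_.CoverInv.le_bound {n : ℕ} {st : (ℕ → ℕ) × ℕ} (h : CoverInv n st) : st.2 ≤ n := by
  obtain ⟨s, hs, hmem⟩ := h.card
  have : s ⊆ Finset.range n := fun v hv => by simpa using h.lt v ((hmem v).1 hv)
  simpa [hs] using Finset.card_le_card this

/-- The two nested loops of `coverS` compute `coverFold` on the pairs in lexicographic order. -/
theorem eval_coverS {g n a p N o : ℕ} {off : Expr} {s : State} (hga : g ≠ a) (ha : 4 ≠ a)
    (hn : n < 2) (hp : 7 < p ∧ p < 10) (hN : s.reg n = N) (hcap : N < s.reg capVar)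
    (hoff : ∀ τ : State, τ.reg 3 = s.reg 3 → off.eval τ = o) (h0 : ∀ v, N ≤ v → s.mem a v = 0) :
    (((coverS g n a p off).eval s).mem a, ((coverS g n a p off).eval s).reg p) =
      coverFold (fun i j => s.mem g (i * N + j) ≠ 0) (fun q => s.mem 4 (o + q)) (fun _ => 0, 0)
        (pairs N N) := by
  have n1 : n ≠ p ∧ n ≠ 10 ∧ n ≠ 11 ∧ 2 ≠ p ∧ 3 ≠ p ∧ p ≠ 10 ∧ p ≠ 11 ∧ n ≠ 99 := by omega
  obtain ⟨hnp, hn10, hn11, h2p, h3p, hp10, hp11, hn99⟩ := n1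
  set g' : ℕ → ℕ → Prop := fun i j => s.mem g (i * N + j) ≠ 0 with hg'
  set w : ℕ → ℕ := fun q => s.mem 4 (o + q) with hw
  let E : State → Prop := fun τ => τ.reg n = N ∧ τ.reg 2 = s.reg 2 ∧ τ.reg 3 = s.reg 3 ∧
    ∀ b ≠ a, τ.mem b = s.mem b
  have E1 : ∀ {τ x v}, E τ → x = 10 ∨ x = 11 ∨ x = p → E (τ.setReg x v) := by
    rintro τ x v ⟨h1, h2, h3, h4⟩ hx
    have : n ≠ x ∧ 2 ≠ x ∧ 3 ≠ x := by omega
    exact ⟨by simp [this, h1], by simp [this, h2], by simp [this, h3], h4⟩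
  have E2 : ∀ {τ i v}, E τ → E (τ.setMem a i v) := by
    rintro τ i v ⟨h1, h2, h3, h4⟩
    exact ⟨h1, h2, h3, fun b hb => by rw [State.setMem_mem_of_ne _ _ _ hb, h4 b hb]⟩
  have hcap' : N < s.reg 2 := hcap
  simp only [coverS, Stmt.eval.eq_4]
  set s1 := (Stmt.assign p (.const 0)).eval s with hs1
  have hE1 : E s1 := E1 ⟨hN, rfl, rfl, fun _ _ => rfl⟩ (.inr (.inr rfl))
  have hp1 : s1.reg p = 0 := by simp [hs1, Stmt.eval, Expr.cval, eval]
  have hm1 : s1.mem = s.mem := rfl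
  clear_value s1
  set s2 := (Stmt.loop 10 (.var n) (.store a (.var 10) (.const 0))).eval s1 with hs2
  have hs2' : E s2 ∧ s2.reg p = 0 ∧ s2.mem a = fun _ => 0 := by
    have hc : (Expr.var n).cval s1 = N := by
      simp only [Expr.cval, eval, hE1.1, capVar, hE1.2.1]; omega
    have := Stmt.loop_induction (x := 10) (e := .var n) (p := .store a (.var 10) (.const 0))
      (s := s1) (fun i τ => E τ ∧ τ.reg p = 0 ∧ ∀ v, v < i ∨ N ≤ v → τ.mem a v = 0)
      ⟨hE1, hp1, fun v hv => by rw [hm1]; exact h0 v (by omega)⟩ (by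
        rintro i τ hi ⟨h1, h2, h3⟩
        refine ⟨E2 (E1 h1 (.inl rfl)), by simp [Stmt.eval, hp10, h2], fun v hv => ?_⟩
        simp only [Stmt.eval, State.setMem_mem, State.setReg_mem, eval, State.setReg_reg]
        by_cases hv' : v = i
        · simp [hv', Expr.cval, eval]
        · simp only [hv', if_true, and_false, if_false]
          exact h3 v (by omega))
    rw [hc] at this
    exact ⟨this.1, this.2.1, funext fun v => this.2.2 v (by omega)⟩
  clear_value s2
  obtain ⟨hE2, hp2, hm2⟩ := hs2'
  have step : ∀ τ i j, i < N → j < N → E τ → τ.reg 10 = i → τ.reg 11 = j →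
      CoverInv N (τ.mem a, τ.reg p) →
      ∀ τ', τ' = (coverStepS g n a p off).eval τ → E τ' ∧ τ'.reg 10 = i ∧
        (τ'.mem a, τ'.reg p) = coverStep g' w (τ.mem a, τ.reg p) (i, j) := by
    intro τ i j hi hj hE h10 h11 hI τ' hτ'
    have hcond : ((adjE g n 10 11).and
        ((Expr.get a (.var 10)).not.and (Expr.get a (.var 11)).not)).Holds τ ↔
        g' i j ∧ τ.mem a i = 0 ∧ τ.mem a j = 0 := by
      rw [holds_and, holds_and, holds_not, holds_not, holds_adjE hn99, h10, h11, hE.1,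
        hE.2.2.2 g hga]
      simp [Holds, eval, h10, h11, hg']
    have hle := hI.le_bound
    dsimp only at hle
    unfold coverStep
    by_cases hc : g' i j ∧ τ.mem a i = 0 ∧ τ.mem a j = 0
    · rw [coverStepS, Stmt.eval_ite_pos (hcond.2 hc)] at hτ'
      rw [if_pos hc]
      have hbit : (Expr.get 4 (.add off (.var p))).eval τ = w (τ.reg p) := by
        simp only [eval, hoff τ hE.2.2.1, hE.2.2.2 4 ha, hw]
      have hval : ∀ t : State, t.reg p = τ.reg p → t.reg 2 = τ.reg 2 →
          (Expr.add (.var p) (.const 1)).cval t = τ.reg p + 1 := by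
        intro t ht ht'
        have := hE.2.1
        simp only [Expr.cval, eval, ht, capVar, ht']
        omega
      have hst : ∀ x y, τ.reg x = y →
          ∀ t, t = (Stmt.assign p (.add (.var p) (.const 1))).eval
            ((Stmt.store a (.var x) (.add (.var p) (.const 1))).eval τ) →
          E t ∧ t.reg 10 = i ∧ (t.mem a, t.reg p) =
            (Function.update (τ.mem a) y (τ.reg p + 1), τ.reg p + 1) := by
        intro x y hx t ht
        simp only [Stmt.eval, eval, hx] at ht
        rw [hval τ rfl rfl, hval _ (by simp) (by simp)] at ht
        subst ht
        refine ⟨E1 (E2 hE) (.inr (.inr rfl)), by simp [hp10.symm, h10], ?_⟩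
        simp [State.setMem]
      simp only [Stmt.eval.eq_4, Stmt.eval.eq_5, hbit] at hτ'
      by_cases hb : w (τ.reg p) = 0
      · rw [if_pos hb] at hτ' ⊢
        exact hst 10 i h10 τ' hτ'
      · rw [if_neg hb] at hτ' ⊢
        exact hst 11 j h11 τ' hτ'
    · rw [coverStepS, Stmt.eval_ite_neg (fun h => hc (hcond.1 h))] at hτ'
      rw [if_neg hc]
      subst hτ'
      exact ⟨hE, h10, rfl⟩
  have hc : ∀ τ, E τ → (Expr.var n).cval τ = N := by
    intro τ hE
    simp only [Expr.cval, eval, hE.1, capVar, hE.2.1]; omega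
  have hfin := Stmt.loop_induction (x := 10) (e := .var n)
    (p := .loop 11 (.var n) (coverStepS g n a p off)) (s := s2)
    (fun i τ => E τ ∧ (τ.mem a, τ.reg p) = coverFold g' w (fun _ => 0, 0) (pairs N i))
    ⟨hE2, by rw [hp2, hm2]; rfl⟩ (by
      rw [hc _ hE2]
      rintro i τ hi ⟨hE, hst⟩
      have hE' : E (τ.setReg 10 i) := E1 hE (.inl rfl)
      have hin := Stmt.loop_induction (x := 11) (e := .var n)
        (p := coverStepS g n a p off) (s := τ.setReg 10 i)
        (fun j τ => E τ ∧ τ.reg 10 = i ∧ (τ.mem a, τ.reg p) =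
          coverFold g' w (fun _ => 0, 0) (pairs N i ++ (List.range j).map (i, ·)))
        ⟨hE', by simp, by simpa [hp10] using hst⟩ (by
          rw [hc _ hE']
          rintro j τ hj ⟨hE, h10, hst⟩
          have hI : CoverInv N (τ.mem a, τ.reg p) := by
            rw [hst]
            refine (coverInv_zero N).fold fun e he => ?_
            rw [List.mem_append, mem_pairs] at he
            rcases he with he | he
            · exact ⟨he.1.trans hi, he.2⟩
            · obtain ⟨x, hx, rfl⟩ := List.mem_map.1 he
              exact ⟨hi, (List.mem_range.1 hx).trans hj⟩
          have := step (τ.setReg 11 j) i j hi hj (E1 hE (.inr (.inl rfl))) (by simpa using h10)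
            (by simp) (by simpa [hp11] using hI) _ rfl
          refine ⟨this.1, this.2.1, ?_⟩
          rw [this.2.2, List.range_succ, List.map_append, ← List.append_assoc, coverFold,
            List.foldl_append]
          simp only [State.setReg_mem, State.setReg_reg, if_neg hp11]
          rw [hst]
          rfl)
      rw [hc _ hE'] at hin
      refine ⟨hin.1, hin.2.2.trans ?_⟩
      simp [pairs, List.range_succ])
  rw [hc _ hE2] at hfin
  exact hfin.2

/-! ### The increment of the guess -/

/-- The bases of the digits of a guess. -/
def guessBase (k i : ℕ) : ℕ := 2 + if k + k ≤ i ∧ i < k + k + k then k else 0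

/-- The length of a guess. -/
def guessLength (k : ℕ) : ℕ := k + k + (k + k) + k * k

theorem guessBase_pos (k i : ℕ) : 0 < guessBase k i := by unfold guessBase; omega

/-- `incrementS` adds `1` to the string, and variable `6` tells whether the last digit overflowed. -/
theorem eval_incrementS {k T : ℕ} {s : State} (hk : s.reg 3 = k)
    (hcap : guessLength k + 2 ≤ s.reg capVar) (hw : s.mem 4 = digit (guessBase k) T) :
    (∀ i, (incrementS.eval s).mem 4 i = if i < guessLength k then
      digit (guessBase k) (T + 1) i else digit (guessBase k) T i) ∧
    ((incrementS.eval s).reg 6 ≠ 0 ↔ weight (guessBase k) (guessLength k) ∣ T + 1) := by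
  have hcap' : guessLength k + 2 ≤ s.reg 2 := hcap
  have hk2 : k + 2 ≤ s.reg 2 := by unfold guessLength at hcap'; omega
  rw [incrementS, Stmt.eval]
  set s1 := (Stmt.assign 6 (.const 1)).eval s with hs1
  have h6 : s1.reg 6 = 1 := by
    simp only [hs1, Stmt.eval, Expr.cval, eval, State.setReg_reg, capVar, if_true]; omega
  have h2 : s1.reg 2 = s.reg 2 := by simp [hs1, Stmt.eval]
  have h3 : s1.reg 3 = k := by simp [hs1, Stmt.eval, hk]
  have h4 : s1.mem 4 = digit (guessBase k) T := by simp [hs1, Stmt.eval, hw]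
  clear_value s1
  have hL : lengthE.cval s1 = guessLength k := by
    simp only [Expr.cval, capVar, lengthE, mul, eval, h3, State.setReg_reg]
    rw [min_eq_left] <;> simp [guessLength, h2] at hcap' ⊢
    omega
  have := Stmt.loop_induction (x := 10) (e := lengthE) (p := carryS) (s := s1)
    (fun i τ => τ.reg 2 = s.reg 2 ∧ τ.reg 3 = k ∧
      (τ.reg 6 ≠ 0 ↔ weight (guessBase k) i ∣ T + 1) ∧
      ∀ j, τ.mem 4 j = if j < i then digit (guessBase k) (T + 1) j else digit (guessBase k) T j)
    ⟨h2, h3, by simp [h6, weight], by simp [h4]⟩ (by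
      rintro i τ - ⟨t2, t3, t6, tm⟩
      have hbase : baseE.eval (τ.setReg 10 i) = guessBase k i := by
        have hand : ∀ t : State, ((Expr.lt (.var 10) (.add (.var 3) (.var 3))).not.and
            (.lt (.var 10) (.add (.add (.var 3) (.var 3)) (.var 3)))).eval t =
            if t.reg 3 + t.reg 3 ≤ t.reg 10 ∧ t.reg 10 < t.reg 3 + t.reg 3 + t.reg 3
            then 1 else 0 := by
          intro t
          classical
          rw [eval_and]
          simp only [holds_and, holds_not, holds_lt, eval, not_lt]
        simp only [baseE, mul, eval, guessBase]
        rw [hand]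
        simp only [State.setReg_reg, t3]
        split_ifs <;> simp_all
      have hd : digit (guessBase k) T i < k + 2 :=
        (digit_lt (guessBase_pos k) T i).trans_le (by unfold guessBase; split_ifs <;> omega)
      have hmi : τ.mem 4 i = digit (guessBase k) T i := by rw [tm, if_neg (lt_irrefl i)]
      have hsucc := digit_succ (guessBase_pos k) T i
      have hdvd := weight_dvd_succ (guessBase_pos k) T i
      have hlt' : (Expr.lt (.add (.get 4 (.var 10)) (.const 1)) baseE).Holds (τ.setReg 10 i) ↔
          digit (guessBase k) T i + 1 < guessBase k i := by
        rw [holds_lt, hbase]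
        simp [eval, hmi]
      rw [carryS]
      by_cases hc : weight (guessBase k) i ∣ T + 1
      · have hc6 := t6.2 hc
        rw [if_pos hc] at hsucc
        by_cases hlt : digit (guessBase k) T i + 1 < guessBase k i
        · rw [if_pos hlt] at hsucc
          rw [Stmt.eval_ite_pos (by simpa [Holds, eval] using hc6), Stmt.eval_ite_pos (hlt'.2 hlt)]
          refine ⟨by simp [Stmt.eval, t2], by simp [Stmt.eval, t3], ?_, fun j => ?_⟩
          · simp [Stmt.eval, Expr.cval, eval, hdvd, hlt]
          · simp only [Stmt.eval, State.setReg_mem, State.setMem_mem, eval, State.setReg_reg,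
              Expr.cval, capVar, tm, if_true, true_and]
            by_cases hj : j = i
            · subst hj
              simp only [lt_irrefl, if_false, if_true, lt_add_one, if_true, hsucc]
              simp [t2]
              omega
            · have : j < i + 1 ↔ j < i := by omega
              simp [hj, this]
        · rw [if_neg hlt] at hsucc
          rw [Stmt.eval_ite_pos (by simpa [Holds, eval] using hc6),
            Stmt.eval_ite_neg fun h => hlt (hlt'.1 h)]
          refine ⟨by simp [Stmt.eval, t2], by simp [Stmt.eval, t3], ?_, fun j => ?_⟩
          · simp [Stmt.eval, hdvd, hlt, t6]
          · simp only [Stmt.eval, State.setReg_mem, State.setMem_mem, eval, State.setReg_reg,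
              Expr.cval, capVar, tm, if_true, true_and]
            by_cases hj : j = i
            · subst hj
              simp [hsucc]
            · have : j < i + 1 ↔ j < i := by omega
              simp [hj, this]
      · rw [if_neg hc] at hsucc
        have hc6 : τ.reg 6 = 0 := by by_contra h; exact hc (t6.1 h)
        rw [Stmt.eval_ite_neg (by simpa [Holds, eval] using hc6)]
        refine ⟨by simp [Stmt.eval, t2], by simp [Stmt.eval, t3], ?_, fun j => ?_⟩
        · simp [Stmt.eval, hdvd, hc, hc6]
        · simp only [Stmt.eval, State.setReg_mem, tm]
          by_cases hj : j = i
          · subst hj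
            simp [hsucc]
          · have : j < i + 1 ↔ j < i := by omega
            simp [this])
  rw [hL] at this
  exact ⟨this.2.2.2, this.2.2.1⟩

/-! ### Components -/

theorem preconnected_induce_insert {V : Type*} {G : SimpleGraph V} {X : Set V} {u v : V}
    (hX : (G.induce X).Preconnected) (hu : u ∈ X) (h : G.Adj u v) :
    (G.induce (insert v X)).Preconnected := by
  have h1 := (SimpleGraph.induce_pair_connected_of_adj h).preconnected
  have h2 := (SimpleGraph.induce_union_connected hX h1 ⟨u, hu, by simp⟩).preconnected
  have h3 : X ∪ {u, v} = insert v X := by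
    ext x
    simp only [Set.mem_union, Set.mem_insert_iff, Set.mem_singleton_iff]
    constructor
    · rintro (h | rfl | h)
      exacts [.inr h, .inr hu, .inl h]
    · rintro (h | h)
      exacts [.inr (.inr h), .inl h]
  rwa [h3] at h2

section Meaning

variable {I : GraphPair} {k : ℕ} {w a₁ a₂ : ℕ → ℕ} {s : State}

theorem Env.setMem (h : Env I k w a₁ a₂ s) {a : ℕ} (ha : a = 2 ∨ a = 3 ∨ a = 7) (i v : ℕ) :
    Env I k w a₁ a₂ (s.setMem a i v) := by
  have h0 : 0 ≠ a ∧ 1 ≠ a ∧ 4 ≠ a ∧ 5 ≠ a ∧ 6 ≠ a := by omega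
  obtain ⟨h1, h2, h3, h4, h5, h6, h7, h8, h9⟩ := h
  constructor <;> simp_all

/-- Statements that leave the data of the instance and of the guess alone preserve `Env`. -/
theorem Env.eval_of_frame (h : Env I k w a₁ a₂ s) (p : Stmt)
    (hr : 0 ∉ p.regs ∧ 1 ∉ p.regs ∧ capVar ∉ p.regs ∧ 3 ∉ p.regs)
    (hm : 0 ∉ p.arrs ∧ 1 ∉ p.arrs ∧ 4 ∉ p.arrs ∧ 5 ∉ p.arrs ∧ 6 ∉ p.arrs) :
    Env I k w a₁ a₂ (p.eval s) := by
  obtain ⟨h1, h2, h3, h4, h5, h6, h7, h8, h9⟩ := h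
  obtain ⟨r1, r2, r3, r4⟩ := hr
  obtain ⟨m1, m2, m3, m4, m5⟩ := hm
  constructor <;> simp [Stmt.eval_reg, Stmt.eval_mem, *]

theorem Env.lt_cap (h : Env I k w a₁ a₂ s) : I.n₁ + I.n₂ + 2 < s.reg capVar := by
  rw [h.cap]; nlinarith

theorem Env.cval_var_zero (h : Env I k w a₁ a₂ s) : (Expr.var 0).cval s = I.n₁ := by
  have := h.lt_cap
  simp only [Expr.cval, eval, h.n₁]
  omega

theorem Env.cval_var_one (h : Env I k w a₁ a₂ s) : (Expr.var 1).cval s = I.n₂ := by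
  have := h.lt_cap
  simp only [Expr.cval, eval, h.n₂]
  omega

theorem Env.cval_ne_zero (h : Env I k w a₁ a₂ s) (e : Expr) : e.cval s ≠ 0 ↔ e.Holds s := by
  have := h.lt_cap
  simp only [Expr.cval, Holds]
  omega

theorem cval_and_le (e f : Expr) : (e.and f).cval s ≤ 1 := by
  classical
  refine (min_le_left _ _).trans ?_
  rw [eval_and]
  split_ifs <;> simp

/-- The component algorithm finds a connected part of the domain of the candidate that contains
every vertex which is reached from the root in at most as many steps as there are vertices. The
sets `Y t` abstract from the vertices that are at most `t` steps away from the root. -/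
theorem Env.eval_componentS (h : Env I k w a₁ a₂ s) {r : Fin I.n₁} (hr : s.reg 12 = r)
    (Y : ℕ → Set (Fin I.n₁)) (hY : ∀ t, ∀ u ∈ Y t, ∃ v, Candidate I k w a₁ a₂ u v)
    (hY0 : Y 0 ⊆ {r})
    (hYs : ∀ t, ∀ u ∈ Y (t + 1), u ∈ Y t ∨ ∃ v ∈ Y t, I.G₁.Adj v u) :
    (∀ u ∈ (componentS.eval s).vertexSet 7 I.n₁, ∃ v, Candidate I k w a₁ a₂ u v) ∧
    (I.G₁.induce ((componentS.eval s).vertexSet 7 I.n₁)).Preconnected ∧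
    (∀ u : Fin I.n₁, (componentS.eval s).mem 7 u ≤ 1) ∧
    Y I.n₁ ⊆ (componentS.eval s).vertexSet 7 I.n₁ := by
  rw [componentS, Stmt.eval]
  set p1 : Stmt := .loop 13 (.var 0)
    (.store 7 (.var 13) ((Expr.eq (.var 13) (.var 12)).and (domE 13))) with hp1
  have he1 : Env I k w a₁ a₂ (p1.eval s) := h.eval_of_frame p1 (by decide) (by decide)
  have hm1 : (∀ u : Fin I.n₁, (p1.eval s).mem 7 u ≤ 1) ∧ ∀ u : Fin I.n₁,
      (p1.eval s).mem 7 u ≠ 0 ↔ u = r ∧ ∃ v, Candidate I k w a₁ a₂ u v := by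
    have := Stmt.loop_induction (x := 13) (e := .var 0)
      (p := .store 7 (.var 13) ((Expr.eq (.var 13) (.var 12)).and (domE 13))) (s := s)
      (fun i τ => Env I k w a₁ a₂ τ ∧ τ.reg 12 = r ∧ ∀ u : Fin I.n₁, u.1 < i →
        (τ.mem 7 u ≤ 1 ∧ (τ.mem 7 u ≠ 0 ↔ u = r ∧ ∃ v, Candidate I k w a₁ a₂ u v)))
      ⟨h, hr, by simp⟩ (by
        rw [h.cval_var_zero]
        rintro i τ hi ⟨hE, hτ, hu⟩
        have hE' : Env I k w a₁ a₂ (τ.setReg 13 i) := hE.setReg (by decide) i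
        have r1 : (τ.setReg 13 i).reg 13 = i := by simp
        refine ⟨hE'.setMem (by decide) _ _, by simpa [Stmt.eval] using hτ, fun u hui => ?_⟩
        simp only [Stmt.eval, State.setMem_mem, eval, r1, true_and]
        by_cases hiu : u.1 = i
        · rw [if_pos hiu]
          refine ⟨cval_and_le _ _, ?_⟩
          rw [hE'.cval_ne_zero, holds_and, holds_eq, hE'.holds_domE (by decide) (by rwa [r1])]
          simp only [eval, r1]
          subst hiu
          simp [hτ, Fin.ext_iff]
        · rw [if_neg hiu]
          exact hu u (by omega))
    rw [h.cval_var_zero] at this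
    exact ⟨fun u => (this.2.2 u u.2).1, fun u => (this.2.2 u u.2).2⟩
  clear_value p1
  set s1 := p1.eval s with hs1
  clear_value s1
  -- The part of the loop invariant that does not involve the number of rounds.
  let P : State → Prop := fun τ => Env I k w a₁ a₂ τ ∧
    (∀ u ∈ τ.vertexSet 7 I.n₁, ∃ v, Candidate I k w a₁ a₂ u v) ∧
    (I.G₁.induce (τ.vertexSet 7 I.n₁)).Preconnected ∧ ∀ u : Fin I.n₁, τ.mem 7 u ≤ 1
  have hPr : ∀ {τ x v}, 9 < x → P τ → P (τ.setReg x v) := fun hx hP =>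
    ⟨hP.1.setReg hx _, hP.2⟩
  have hinit : P s1 := by
    refine ⟨he1, fun u hu => ((hm1.2 u).1 hu).2, ?_, hm1.1⟩
    rintro ⟨u, hu⟩ ⟨v, hv⟩
    obtain rfl : u = v := ((hm1.2 u).1 hu).1.trans ((hm1.2 v).1 hv).1.symm
    exact SimpleGraph.Reachable.refl _
  have hinner : ∀ t τ, P τ → Y t ⊆ τ.vertexSet 7 I.n₁ →
      ∀ τ', τ' = (Stmt.loop 13 (.var 0) (.ite ((domE 13).and (ex 16 (.var 0)
        ((Expr.get 7 (.var 16)).and (adjE 0 0 16 13)))) (.store 7 (.var 13) (.const 1))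
          .skip)).eval τ → P τ' ∧ Y (t + 1) ⊆ τ'.vertexSet 7 I.n₁ := by
    rintro t τ hP hYt τ' rfl
    have := Stmt.loop_induction (x := 13) (e := .var 0) (p := (.ite ((domE 13).and (ex 16 (.var 0)
        ((Expr.get 7 (.var 16)).and (adjE 0 0 16 13)))) (.store 7 (.var 13) (.const 1))
          .skip)) (s := τ)
      (fun i τ => P τ ∧ Y t ⊆ τ.vertexSet 7 I.n₁ ∧
        ∀ u ∈ Y (t + 1), u.1 < i → u ∈ τ.vertexSet 7 I.n₁)
      ⟨hP, hYt, by simp⟩ (by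
        rw [hP.1.cval_var_zero]
        rintro i τ hi ⟨hP, hYt, hYi⟩
        have hP' := hPr (x := 13) (v := i) (by decide) hP
        obtain ⟨hE', hdom', hconn', hle'⟩ := hP'
        have r1 : (τ.setReg 13 i).reg 13 = i := by simp
        have key : ((domE 13).and (ex 16 (.var 0)
            ((Expr.get 7 (.var 16)).and (adjE 0 0 16 13)))).Holds (τ.setReg 13 i) ↔
            (∃ v, Candidate I k w a₁ a₂ ⟨i, hi⟩ v) ∧
            ∃ u ∈ τ.vertexSet 7 I.n₁, I.G₁.Adj u ⟨i, hi⟩ := by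
          rw [holds_and, hE'.holds_domE (by decide) (by rwa [r1]), holds_ex]
          have inner : ∀ j (hj : j < I.n₁), ((Expr.get 7 (.var 16)).and (adjE 0 0 16 13)).Holds
              ((τ.setReg 13 i).setReg 16 j) ↔ τ.mem 7 j ≠ 0 ∧ I.G₁.Adj ⟨j, hj⟩ ⟨i, hi⟩ := by
            intro j hj
            have hE'' := hE'.setReg (x := 16) (by decide) j
            rw [holds_and, hE''.holds_adjE₁ (by simpa) (by simpa)]
            simp [Holds, eval]
          simp only [r1]
          refine and_congr Iff.rfl ⟨?_, ?_⟩
          · rintro ⟨j, hj, hh⟩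
            have hj' : j < I.n₁ := by simpa only [eval, hE'.n₁] using hj
            exact ⟨⟨j, hj'⟩, (inner j hj').1 hh⟩
          · rintro ⟨⟨j, hj'⟩, hh⟩
            exact ⟨j, by simpa only [eval, hE'.n₁] using hj', (inner j hj').2 hh⟩
        by_cases hc : ((domE 13).and (ex 16 (.var 0)
            ((Expr.get 7 (.var 16)).and (adjE 0 0 16 13)))).Holds (τ.setReg 13 i)
        · rw [Stmt.eval_ite_pos hc]
          obtain ⟨hd, u, hu, hadj⟩ := key.1 hc
          have hval : (Expr.const 1).cval (τ.setReg 13 i) = 1 := by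
            have := hE'.lt_cap
            simp only [Expr.cval, eval]; omega
          have hset : ((Stmt.store 7 (.var 13) (.const 1)).eval (τ.setReg 13 i)).vertexSet 7 I.n₁ =
              insert ⟨i, hi⟩ (τ.vertexSet 7 I.n₁) := by
            ext x
            simp only [Stmt.eval, State.vertexSet, Set.mem_ofPred_eq, State.setMem_mem, hval, eval,
              r1, true_and, Set.mem_insert_iff, State.setReg_mem, Fin.ext_iff]
            by_cases hx : x.1 = i <;> simp [hx]
          refine ⟨⟨hE'.setMem (by decide) _ _, ?_, ?_, ?_⟩, ?_, ?_⟩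
          · rw [hset]
            rintro x (rfl | hx)
            exacts [hd, hdom' x hx]
          · rw [hset]
            exact preconnected_induce_insert hconn' hu hadj
          · intro x
            simp only [Stmt.eval, State.setMem_mem, hval]
            split_ifs
            exacts [le_rfl, hle' x]
          · rw [hset]
            exact hYt.trans (Set.subset_insert _ _)
          · rw [hset]
            intro x hx hxi
            by_cases hxi' : x.1 = i
            · exact .inl (Fin.ext hxi')
            · exact .inr (hYi x hx (by omega))
        · rw [Stmt.eval_ite_neg hc]
          refine ⟨⟨hE', hdom', hconn', hle'⟩, hYt, fun x hx hxi => ?_⟩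
          by_cases hxi' : x.1 = i
          · obtain rfl : x = ⟨i, hi⟩ := Fin.ext hxi'
            rcases hYs t _ hx with h1 | ⟨v, hv, hadj⟩
            · exact hYt h1
            · exact absurd (key.2 ⟨hY _ _ hx, v, hYt hv, hadj⟩) hc
          · exact hYi x hx (by omega))
    rw [hP.1.cval_var_zero] at this
    exact ⟨this.1, fun u hu => this.2.2 u hu u.2⟩
  have := Stmt.loop_induction (x := 15) (e := .var 0) (p := .loop 13 (.var 0)
      (.ite ((domE 13).and (ex 16 (.var 0)
        ((Expr.get 7 (.var 16)).and (adjE 0 0 16 13)))) (.store 7 (.var 13) (.const 1))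
          .skip)) (s := s1)
    (fun t τ => P τ ∧ Y t ⊆ τ.vertexSet 7 I.n₁)
    ⟨hinit, fun u hu => (hm1.2 u).2 ⟨hY0 hu, hY 0 u hu⟩⟩
    (fun t τ _ hP => hinner t _ (hPr (by decide) hP.1) hP.2 _ rfl)
  rw [he1.cval_var_zero] at this
  exact ⟨this.1.2.1, this.1.2.2.1, this.1.2.2.2, this.2⟩

/-! ### The update of the best solution -/

variable (I) in
/-- The output arrays hold a common connected induced subgraph whose size is in variable `7`. -/
def HoldsSolution (s : State) : Prop :=
  IsCommonConnectedInducedSubgraph I.G₁ I.G₂ (s.vertexSet 2 I.n₁) (s.vertexSet 3 I.n₂) ∧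
    (s.vertexSet 2 I.n₁).ncard = s.reg 7

/-- A partial isomorphism restricts to every part of its domain. -/
theorem _root_.IsPartialIso.nonempty_iso {V₁ V₂ : Type*} {G₁ : SimpleGraph V₁}
    {G₂ : SimpleGraph V₂} {P : V₁ → V₂ → Prop} (hP : IsPartialIso G₁ G₂ P) {X : Set V₁}
    (hX : ∀ u ∈ X, ∃ v, P u v) :
    Nonempty (G₁.induce X ≃g G₂.induce {v | ∃ u ∈ X, P u v}) := by
  choose f hf using hX
  let F : X → {v | ∃ u ∈ X, P u v} := fun u => ⟨f u u.2, u, u.2, hf u u.2⟩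
  have hF : Function.Bijective F := by
    constructor
    · rintro ⟨u, hu⟩ ⟨v, hv⟩ huv
      exact Subtype.ext ((hP _ _ _ _ (hf u hu) (hf v hv)).1.2 (congrArg Subtype.val huv))
    · rintro ⟨v, u, hu, huv⟩
      exact ⟨⟨u, hu⟩, Subtype.ext ((hP _ _ _ _ (hf u hu) huv).1.1 rfl)⟩
  exact ⟨{ toEquiv := Equiv.ofBijective F hF
           map_rel_iff' := fun {x y} => (hP _ _ _ _ (hf x x.2) (hf y y.2)).2.symm }⟩

theorem Env.sum_eq_ncard (h : Env I k w a₁ a₂ s) (hle : ∀ u : Fin I.n₁, s.mem 7 u ≤ 1) :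
    (Expr.sum 13 (.var 0) (.get 7 (.var 13))).eval s = (s.vertexSet 7 I.n₁).ncard := by
  classical
  have h1 : s.vertexSet 7 I.n₁ =
      ((Finset.univ.filter fun u : Fin I.n₁ => s.mem 7 u ≠ 0 : Finset (Fin I.n₁)) : Set _) := by
    ext; simp [State.vertexSet]
  rw [h1, Set.ncard_coe_finset, Finset.card_filter]
  simp only [eval, State.setReg_mem, State.setReg_reg, if_true, h.n₁]
  rw [Finset.sum_range]
  refine Finset.sum_congr rfl fun u _ => ?_
  have := hle u
  split_ifs <;> omega

/-- After the update, the best solution is at least as large as the component in array `7`. -/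
theorem Env.eval_updateS (h : Env I k w a₁ a₂ s)
    (hiso : IsPartialIso I.G₁ I.G₂ (Candidate I k w a₁ a₂))
    (hdom : ∀ u ∈ s.vertexSet 7 I.n₁, ∃ v, Candidate I k w a₁ a₂ u v)
    (hconn : (I.G₁.induce (s.vertexSet 7 I.n₁)).Preconnected)
    (hle : ∀ u : Fin I.n₁, s.mem 7 u ≤ 1) (hs : HoldsSolution I s) :
    HoldsSolution I (updateS.eval s) ∧ s.reg 7 ≤ (updateS.eval s).reg 7 ∧
      (s.vertexSet 7 I.n₁).ncard ≤ (updateS.eval s).reg 7 := by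
  have hsum := h.sum_eq_ncard hle
  rw [updateS]
  by_cases hc : (Expr.lt (.var 7) (.sum 13 (.var 0) (.get 7 (.var 13)))).Holds s
  swap
  · rw [Stmt.eval_ite_neg hc]
    rw [holds_lt, hsum] at hc
    exact ⟨hs, le_rfl, by simpa [eval, Stmt.eval] using hc⟩
  rw [Stmt.eval_ite_pos hc]
  rw [holds_lt, hsum] at hc
  set X := s.vertexSet 7 I.n₁ with hX
  have hXle : X.ncard ≤ I.n₁ := by
    simpa using Set.ncard_le_card X
  have hcap := h.lt_cap
  have hval : (Expr.sum 13 (.var 0) (.get 7 (.var 13))).cval s = X.ncard := by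
    rw [Expr.cval, hsum]; omega
  rw [Stmt.eval, Stmt.eval, Stmt.eval, hval]
  set s1 := s.setReg 7 X.ncard with hs1
  have hE1 : Env I k w a₁ a₂ s1 := by
    obtain ⟨h1, h2, h3, h4, h5, h6, h7, h8, h9⟩ := h
    constructor <;> simp_all [capVar]
  set p2 : Stmt := .loop 13 (.var 0) (.store 2 (.var 13) (.get 7 (.var 13))) with hp2
  have hE2 : Env I k w a₁ a₂ (p2.eval s1) := hE1.eval_of_frame p2 (by decide) (by decide)
  have h27 : (p2.eval s1).mem 7 = s.mem 7 := p2.eval_mem (by decide) s1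
  have h2r : (p2.eval s1).reg 7 = X.ncard := by rw [p2.eval_reg (by decide)]; simp [hs1]
  have h22 : (p2.eval s1).vertexSet 2 I.n₁ = X := by
    have := Stmt.loop_induction (x := 13) (e := .var 0)
      (p := .store 2 (.var 13) (.get 7 (.var 13))) (s := s1)
      (fun i τ => Env I k w a₁ a₂ τ ∧ τ.mem 7 = s.mem 7 ∧
        ∀ u : Fin I.n₁, u.1 < i → (τ.mem 2 u ≠ 0 ↔ u ∈ X))
      ⟨hE1, rfl, by simp⟩ (by
        rw [hE1.cval_var_zero]
        rintro i τ hi ⟨hE, hτ, hu⟩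
        have hE' : Env I k w a₁ a₂ (τ.setReg 13 i) := hE.setReg (by decide) i
        have r1 : (τ.setReg 13 i).reg 13 = i := by simp
        refine ⟨hE'.setMem (by decide) _ _, by simpa [Stmt.eval] using hτ, fun u hui => ?_⟩
        simp only [Stmt.eval, State.setMem_mem, r1, eval, true_and]
        by_cases hiu : u.1 = i
        · rw [if_pos hiu, hE'.cval_ne_zero]
          simp [Holds, eval, hτ, ← hiu, hX, State.vertexSet]
        · rw [if_neg hiu]
          exact hu u (by omega))
    rw [hE1.cval_var_zero] at this
    exact Set.ext fun u => this.2.2 u u.2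
  clear_value p2
  set s2 := p2.eval s1 with hs2
  clear_value s2
  set p3 : Stmt := .loop 14 (.var 1) (.store 3 (.var 14)
        (ex 13 (.var 0) ((Expr.get 7 (.var 13)).and (matchE 13 14)))) with hp3
  have h3r : (p3.eval s2).reg 7 = X.ncard := by rw [p3.eval_reg (by decide), h2r]
  have h32 : (p3.eval s2).vertexSet 2 I.n₁ = X := by
    rw [← h22]
    simp only [State.vertexSet, p3.eval_mem (show 2 ∉ p3.arrs by decide)]
  have h33 : (p3.eval s2).vertexSet 3 I.n₂ = {v | ∃ u ∈ X, Candidate I k w a₁ a₂ u v} := by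
    have := Stmt.loop_induction (x := 14) (e := .var 1)
      (p := .store 3 (.var 14) (ex 13 (.var 0) ((Expr.get 7 (.var 13)).and (matchE 13 14))))
      (s := s2)
      (fun i τ => Env I k w a₁ a₂ τ ∧ τ.mem 7 = s.mem 7 ∧
        ∀ v : Fin I.n₂, v.1 < i → (τ.mem 3 v ≠ 0 ↔ ∃ u ∈ X, Candidate I k w a₁ a₂ u v))
      ⟨hE2, h27, by simp⟩ (by
        rw [hE2.cval_var_one]
        rintro i τ hi ⟨hE, hτ, hu⟩
        have hE' : Env I k w a₁ a₂ (τ.setReg 14 i) := hE.setReg (by decide) i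
        have r1 : (τ.setReg 14 i).reg 14 = i := by simp
        refine ⟨hE'.setMem (by decide) _ _, by simpa [Stmt.eval] using hτ, fun v hvi => ?_⟩
        simp only [Stmt.eval, State.setMem_mem, r1, eval, true_and]
        by_cases hiv : v.1 = i
        · rw [if_pos hiv, hE'.cval_ne_zero, holds_ex]
          have inner : ∀ j (hj : j < I.n₁), ((Expr.get 7 (.var 13)).and (matchE 13 14)).Holds
              ((τ.setReg 14 i).setReg 13 j) ↔ s.mem 7 j ≠ 0 ∧
                Candidate I k w a₁ a₂ ⟨j, hj⟩ v := by
            intro j hj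
            have hE'' := hE'.setReg (x := 13) (by decide) j
            rw [holds_and, hE''.holds_matchE (by decide) (by decide) (by simpa) (by simpa)]
            have hv : v = ⟨i, hi⟩ := Fin.ext hiv
            simp [Holds, eval, hτ, hv]
          constructor
          · rintro ⟨j, hj, hh⟩
            have hj' : j < I.n₁ := by simpa only [eval, hE'.n₁] using hj
            exact ⟨⟨j, hj'⟩, (inner j hj').1 hh⟩
          · rintro ⟨⟨j, hj'⟩, hh⟩
            exact ⟨j, by simpa only [eval, hE'.n₁] using hj', (inner j hj').2 hh⟩
        · rw [if_neg hiv]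
          exact hu v (by omega))
    rw [hE2.cval_var_one] at this
    exact Set.ext fun u => this.2.2 u u.2
  refine ⟨⟨⟨?_, ?_⟩, ?_⟩, ?_, h3r.ge⟩
  · rwa [h32]
  · rw [h32, h33]
    exact hiso.nonempty_iso hdom
  · rw [h32, h3r]
  · rw [h3r]
    simpa [eval] using hc.le

/-! ### The treatment of a guess -/

/-- A connected set is exhausted by the sets `Y t` of vertices that are at most `t` steps away from
`r` within it. -/
theorem exists_walk_sets {V : Type*} [Fintype V] {G : SimpleGraph V} {X : Set V}
    (hX : (G.induce X).Preconnected) {r : V} (hr : r ∈ X) :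
    ∃ Y : ℕ → Set V, (∀ t, Y t ⊆ X) ∧ Y 0 ⊆ {r} ∧
      (∀ t, ∀ u ∈ Y (t + 1), u ∈ Y t ∨ ∃ v ∈ Y t, G.Adj v u) ∧ X ⊆ Y (Fintype.card V) := by
  classical
  refine ⟨fun t => {u | ∃ (hu : u ∈ X) (p : (G.induce X).Walk ⟨u, hu⟩ ⟨r, hr⟩), p.length ≤ t},
    fun t u hu => hu.1, ?_, ?_, ?_⟩
  · rintro u ⟨hu, p, hp⟩
    exact congrArg Subtype.val (SimpleGraph.Walk.eq_of_length_eq_zero (Nat.le_zero.1 hp))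
  · rintro t u ⟨hu, p, hp⟩
    cases p with
    | nil => exact .inl ⟨hu, .nil, by simp⟩
    | cons hadj q =>
      rename_i v
      exact .inr ⟨v, ⟨v.2, q, by simpa using hp⟩, SimpleGraph.Adj.symm hadj⟩
  · intro u hu
    obtain ⟨p, hp⟩ := (hX ⟨u, hu⟩ ⟨r, hr⟩).exists_isPath
    refine ⟨hu, p, hp.length_lt.le.trans ?_⟩
    exact Fintype.card_subtype_le _

/-- After a guess has been treated, the best solution is at least as large as every connected part of
the candidate. Trying every vertex as a root covers all its components. -/
theorem Env.eval_tryS (h : Env I k w a₁ a₂ s) (hs : HoldsSolution I s) :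
    HoldsSolution I (tryS.eval s) ∧ s.reg 7 ≤ (tryS.eval s).reg 7 ∧
      (IsPartialIso I.G₁ I.G₂ (Candidate I k w a₁ a₂) →
        ∀ Y : Set (Fin I.n₁), (∀ u ∈ Y, ∃ v, Candidate I k w a₁ a₂ u v) →
          (I.G₁.induce Y).Preconnected → Y.ncard ≤ (tryS.eval s).reg 7) := by
  rw [tryS]
  by_cases hc : checkE.Holds s
  swap
  · rw [Stmt.eval_ite_neg hc]
    rw [h.holds_checkE] at hc
    exact ⟨hs, le_rfl, fun h' => absurd h' hc⟩
  rw [Stmt.eval_ite_pos hc]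
  rw [h.holds_checkE] at hc
  have := Stmt.loop_induction (x := 12) (e := .var 0) (p := .seq componentS updateS) (s := s)
    (fun i τ => Env I k w a₁ a₂ τ ∧ HoldsSolution I τ ∧ s.reg 7 ≤ τ.reg 7 ∧
      ∀ r : Fin I.n₁, r.1 < i → ∀ Y : Set (Fin I.n₁), r ∈ Y →
        (∀ u ∈ Y, ∃ v, Candidate I k w a₁ a₂ u v) → (I.G₁.induce Y).Preconnected →
        Y.ncard ≤ τ.reg 7)
    ⟨h, hs, le_rfl, by simp⟩ (by
      rw [h.cval_var_zero]
      rintro i τ hi ⟨hE, hsol, hle, hY⟩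
      have hE1 := hE.setReg (x := 12) (by decide) i
      have r1 : (τ.setReg 12 i).reg 12 = (⟨i, hi⟩ : Fin I.n₁) := by simp
      set τ1 := τ.setReg 12 i with hτ1
      have hsol1 : HoldsSolution I τ1 := by
        simpa [HoldsSolution, hτ1, State.vertexSet] using hsol
      have h71 : τ1.reg 7 = τ.reg 7 := by simp [hτ1]
      have hE2 : Env I k w a₁ a₂ (componentS.eval τ1) :=
        hE1.eval_of_frame componentS (by decide) (by decide)
      have h72 : (componentS.eval τ1).reg 7 = τ.reg 7 := by
        rw [componentS.eval_reg (by decide), h71]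
      have hsol2 : HoldsSolution I (componentS.eval τ1) := by
        have := hsol1
        simp only [HoldsSolution, State.vertexSet] at this ⊢
        rwa [componentS.eval_mem (show 2 ∉ componentS.arrs by decide),
          componentS.eval_mem (show 3 ∉ componentS.arrs by decide),
          componentS.eval_reg (show 7 ∉ componentS.regs by decide)]
      have hcomp := hE1.eval_componentS r1
      obtain ⟨c1, c2, c3, -⟩ := hcomp (fun _ => ∅) (by simp) (by simp) (by simp)
      obtain ⟨u1, u2, u3⟩ := hE2.eval_updateS hc c1 c2 c3 hsol2
      have hE3 : Env I k w a₁ a₂ (updateS.eval (componentS.eval τ1)) :=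
        hE2.eval_of_frame updateS (by decide) (by decide)
      rw [Stmt.eval]
      refine ⟨hE3, u1, ?_, fun r hr Y hrY hYd hYc => ?_⟩
      · exact hle.trans (h72.ge.trans u2)
      · by_cases hri : r.1 = i
        · obtain rfl : r = ⟨i, hi⟩ := Fin.ext hri
          obtain ⟨Z, z1, z2, z3, z4⟩ := exists_walk_sets hYc hrY
          obtain ⟨-, -, -, c4⟩ := hcomp Z (fun t u hu => hYd u (z1 t hu)) z2 z3
          rw [Fintype.card_fin] at z4
          exact (Set.ncard_le_ncard (z4.trans c4)).trans u3
        · exact (hY r (by omega) Y hrY hYd hYc).trans (h72.ge.trans u2))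
  rw [h.cval_var_zero] at this
  refine ⟨this.2.1, this.2.2.1, fun _ Y hYd hYc => ?_⟩
  obtain rfl | ⟨r, hr⟩ := Y.eq_empty_or_nonempty
  · simp
  · exact this.2.2.2 r r.2 Y hr hYd hYc

end Meaning

/-! ### Completeness of the search -/

/-- The vertex cover that belongs to the bits `w`, with its size. -/
noncomputable def coverOf {n : ℕ} (G : SimpleGraph (Fin n)) (w : ℕ → ℕ) : (ℕ → ℕ) × ℕ :=
  coverFold (fun i j => adjArray G (i * n + j) ≠ 0) w (fun _ => 0, 0) (pairs n n)

section

variable {n : ℕ} (G : SimpleGraph (Fin n)) (w : ℕ → ℕ)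

theorem coverInv_coverOf : CoverInv n (coverOf G w) :=
  (coverInv_zero n).fold fun _ he => mem_pairs.1 he

theorem isVertexCover_coverOf : G.IsVertexCover {v | (coverOf G w).1 v ≠ 0} := by
  intro u v h
  exact coverFold_covers (e := (u.1, v.1)) (mem_pairs.2 ⟨u.2, v.2⟩)
    ((adjArray_ne_zero G u.2 v.2).2 h)

theorem vertexCoverNum_le_coverOf : G.vertexCoverNum ≤ ((coverOf G w).2 : ℕ∞) := by
  refine (isVertexCover_coverOf G w).vertexCoverNum_le.trans ?_
  obtain ⟨s, hs, hmem⟩ := (coverInv_coverOf G w).card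
  rw [← hs, ← Set.encard_coe_eq_coe_finsetCard]
  refine Set.encard_le_encard_of_injOn (f := Fin.val) (fun v hv => (hmem v).2 hv) ?_
  exact Fin.val_injective.injOn

/-- If `G` has a vertex cover with at most `k` elements, some `k` bits lead to such a cover, whatever
the bits that follow. -/
theorem exists_coverOf_le {k : ℕ} (h : G.vertexCoverNum ≤ k) :
    ∃ (w : ℕ → ℕ) (st : (ℕ → ℕ) × ℕ), (∀ p, w p < 2) ∧ st.2 ≤ k ∧
      ∀ w' : ℕ → ℕ, (∀ p < k, w' p = w p) → coverOf G w' = st := by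
  classical
  obtain ⟨X, hXc, hX⟩ := G.vertexCoverNum_exists
  set F : Finset ℕ := X.toFinset.map ⟨Fin.val, Fin.val_injective⟩ with hF
  have hFc : F.card ≤ k := by
    rw [hF, Finset.card_map]
    have h1 : (X.toFinset.card : ℕ∞) ≤ k := by
      rw [← Set.encard_coe_eq_coe_finsetCard, Set.coe_toFinset, hXc]
      exact h
    exact_mod_cast h1
  obtain ⟨w, st, hw, hst, hw'⟩ := exists_coverFold_subset
    (g := fun i j => adjArray G (i * n + j) ≠ 0) (n := n) hFc
    (es := pairs n n) (fun e he => mem_pairs.1 he) (by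
      rintro ⟨i, j⟩ he hij
      obtain ⟨hi, hj⟩ := mem_pairs.1 he
      refine (hX ((adjArray_ne_zero G hi hj).1 hij)).imp (fun h => ?_) (fun h => ?_)
      · exact Finset.mem_map.2 ⟨⟨i, hi⟩, by simpa using h, rfl⟩
      · exact Finset.mem_map.2 ⟨⟨j, hj⟩, by simpa using h, rfl⟩)
    (coverInv_zero n) (by simp)
  have hcov : ∀ w' : ℕ → ℕ, (∀ p < k, w' p = w p) → coverOf G w' = st :=
    fun w' h => hw' w' fun p _ hp => h p hp
  refine ⟨w, st, hw, ?_, hcov⟩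
  obtain ⟨s, hs, hmem⟩ := (coverInv_coverOf G w).card
  rw [hcov w fun _ _ => rfl] at hs hmem
  rw [← hs]
  exact (Finset.card_le_card fun v hv => hst v ((hmem v).1 hv)).trans hFc

end

/-- The bits at the start of `W` lead to vertex covers with at most `k` elements. -/
def CoversFound (I : GraphPair) (k : ℕ) (W : ℕ → ℕ) : Prop :=
  (coverOf I.G₁ fun q => W (0 + q)).2 ≤ k ∧ (coverOf I.G₂ fun q => W (k + q)).2 ≤ k

/-- The candidate that belongs to the string `W`, for the vertex covers that `W` encodes. -/
def CandidateOf (I : GraphPair) (k : ℕ) (W : ℕ → ℕ) : Fin I.n₁ → Fin I.n₂ → Prop :=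
  Candidate I k W (coverOf I.G₁ fun q => W (0 + q)).1 (coverOf I.G₂ fun q => W (k + q)).1

/-- Of the guessed adjacency `H`, only the part between `B` and `D` matters. -/
theorem compat_congr {V₁ V₂ : Type*} {G₁ : SimpleGraph V₁} {G₂ : SimpleGraph V₂} {C₁ : Set V₁}
    {C₂ : Set V₂} {g g' : Guess V₁ V₂} (hA : g.A = g'.A) (hB : g.B = g'.B) (hD : g.D = g'.D)
    (hH : ∀ b d, g.B b → g.D d → (g.H b d ↔ g'.H b d)) :
    g.Compat G₁ G₂ C₁ C₂ = g'.Compat G₁ G₂ C₁ C₂ := by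
  funext u v
  apply propext
  unfold Guess.Compat
  rw [← hA, ← hB, ← hD]
  refine and_congr Iff.rfl (and_congr Iff.rfl (and_congr Iff.rfl (and_congr ?_ ?_)))
  · refine forall_congr' fun b => forall_congr' fun hb => ?_
    rw [and_congr_right fun hv => hH b v hb hv]
  · refine forall_congr' fun d => forall_congr' fun hd => ?_
    rw [and_congr_right fun hu => hH u d hu hd]

/-- Matching by rank, transferred from numbers to vertices. -/
theorem isMaximalMatching_rankMatch_compatN (I : GraphPair) (k : ℕ) (w a₁ a₂ : ℕ → ℕ) :
    IsMaximalMatching ((guessOf I.n₁ I.n₂ k w a₁ a₂).Compat I.G₁ I.G₂ {u | a₁ u ≠ 0}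
      {v | a₂ v ≠ 0}) fun u v => RankMatch (CompatN I k w a₁ a₂) u v := by
  have hK : Difunctional (CompatN I k w a₁ a₂) := by
    rintro u v u' v' ⟨hu, hv, h1⟩ ⟨hu', _, h2⟩ ⟨_, hv', h3⟩
    exact ⟨hu, hv', Guess.difunctional_compat _ _ _ _ _ _ _ _ _ h1 h2 h3⟩
  have h := isMaximalMatching_rankMatch hK fun u v ⟨hu, hv, _⟩ => ⟨hu, hv⟩
  refine ⟨fun u v huv => ?_, fun u v u' v' h1 h2 => ?_, fun u v huv => ?_⟩
  · obtain ⟨_, _, h'⟩ := h.le _ _ huv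
    exact h'
  · simpa [Fin.ext_iff] using h.inj _ _ _ _ h1 h2
  · rcases h.maximal u v ⟨u.2, v.2, huv⟩ with ⟨v', hv'⟩ | ⟨u', hu'⟩
    · obtain ⟨_, hlt, -⟩ := h.le _ _ hv'
      exact .inl ⟨⟨v', hlt⟩, hv'⟩
    · obtain ⟨hlt, _, -⟩ := h.le _ _ hu'
      exact .inr ⟨⟨u', hlt⟩, hu'⟩

/-- If the graphs have vertex covers with at most `k` elements, then every connected common induced
subgraph is matched in size by the candidate of some string. -/
theorem exists_guess {I : GraphPair} {k : ℕ} (h₁ : I.G₁.vertexCoverNum ≤ k)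
    (h₂ : I.G₂.vertexCoverNum ≤ k) {P : Fin I.n₁ → Fin I.n₂ → Prop}
    (hP : IsPartialIso I.G₁ I.G₂ P) (hconn : (I.G₁.induce {u | ∃ v, P u v}).Preconnected) :
    ∃ T < weight (guessBase k) (guessLength k), CoversFound I k (digit (guessBase k) T) ∧
      IsPartialIso I.G₁ I.G₂ (CandidateOf I k (digit (guessBase k) T)) ∧
      ∃ Y : Set (Fin I.n₁), (∀ u ∈ Y, ∃ v, CandidateOf I k (digit (guessBase k) T) u v) ∧
        (I.G₁.induce Y).Preconnected ∧ Y.ncard = {u | ∃ v, P u v}.ncard := by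
  classical
  obtain ⟨w₁, ⟨a₁, p₁⟩, hw₁, hp₁, hc₁⟩ := exists_coverOf_le I.G₁ h₁
  obtain ⟨w₂, ⟨a₂, p₂⟩, hw₂, hp₂, hc₂⟩ := exists_coverOf_le I.G₂ h₂
  have hI₁ := coverInv_coverOf I.G₁ w₁
  have hI₂ := coverInv_coverOf I.G₂ w₂
  have hC₁ := isVertexCover_coverOf I.G₁ w₁
  have hC₂ := isVertexCover_coverOf I.G₂ w₂
  rw [hc₁ w₁ fun _ _ => rfl] at hI₁ hC₁
  rw [hc₂ w₂ fun _ _ => rfl] at hI₂ hC₂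
  dsimp only at hC₁ hC₂ hp₁ hp₂
  have ha₁ : ∀ u, a₁ u ≤ k := fun u => (hI₁.le u).trans hp₁
  have ha₂ : ∀ u, a₂ u ≤ k := fun u => (hI₂.le u).trans hp₂
  have inj₁ : ∀ u u' : Fin I.n₁, a₁ u ≠ 0 → a₁ u = a₁ u' → u = u' := fun u u' h h' =>
    Fin.ext (hI₁.inj u u' h h')
  have inj₂ : ∀ u u' : Fin I.n₂, a₂ u ≠ 0 → a₂ u = a₂ u' → u = u' := fun u u' h h' =>
    Fin.ext (hI₂.inj u u' h h')
  set C₁ : Set (Fin I.n₁) := {u | a₁ u ≠ 0} with hC₁def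
  set C₂ : Set (Fin I.n₂) := {u | a₂ u ≠ 0} with hC₂def
  set g := Guess.ofIso I.G₁ C₁ C₂ P with hg
  -- The roles of the elements of the first cover, indexed by their numbers.
  have hrole : ∀ i, ∃ r, r < k + 2 ∧ (∀ u v, a₁ u.1 = i → g.A u v → r = a₂ v + 1) ∧
      (∀ u, a₁ u.1 = i → g.B u → r = 1) ∧
      (r ≠ 0 → ∃ u, a₁ u.1 = i ∧ (g.B u ∧ r = 1 ∨ ∃ v, g.A u v ∧ r = a₂ v + 1)) := by
    intro i
    by_cases h1 : ∃ u v, a₁ u.1 = i ∧ g.A u v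
    · obtain ⟨u, v, hu, huv⟩ := h1
      have hu' : a₁ u ≠ 0 := huv.2.1
      refine ⟨a₂ v + 1, by have := ha₂ v; omega, fun x y hx hxy => ?_, fun x hx hb => ?_,
        fun _ => ⟨u, hu, .inr ⟨v, huv, rfl⟩⟩⟩
      · obtain rfl := inj₁ u x hu' (hu.trans hx.symm)
        rw [(hP _ _ _ _ huv.1 hxy.1).1.1 rfl]
      · obtain rfl := inj₁ u x hu' (hu.trans hx.symm)
        obtain ⟨-, y, hy, hy'⟩ := hb
        obtain rfl := (hP _ _ _ _ huv.1 hy).1.1 rfl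
        exact absurd huv.2.2 hy'
    by_cases h2 : ∃ u, a₁ u.1 = i ∧ g.B u
    · obtain ⟨u, hu, hb⟩ := h2
      exact ⟨1, by omega, fun x y hx hxy => absurd ⟨x, y, hx, hxy⟩ h1, fun _ _ _ => rfl,
        fun _ => ⟨u, hu, .inl ⟨hb, rfl⟩⟩⟩
    · exact ⟨0, by omega, fun x y hx hxy => absurd ⟨x, y, hx, hxy⟩ h1,
        fun x hx hb => absurd ⟨x, hx, hb⟩ h2, fun h => absurd rfl h⟩
  choose role hrole_lt hroleA hroleB hrole using hrole
  -- The string: the bits for the two covers, the roles, the bits for `D`, and the adjacency row by row.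
  let W : ℕ → ℕ := fun q =>
    if q < k then w₁ q else if q < k + k then w₂ (q - k) else
    if q < k + k + k then role (q - (k + k) + 1) else
    if q < k + k + (k + k) then
      if ∃ v : Fin I.n₂, a₂ v = q - (k + k + k) + 1 ∧ g.D v then 1 else 0
    else if ∃ (u : Fin I.n₁) (v : Fin I.n₂), a₁ u = (q - (k + k + (k + k))) / k + 1 ∧
      a₂ v = (q - (k + k + (k + k))) % k + 1 ∧ g.H u v then 1 else 0
  have hWlt : ∀ q, W q < guessBase k q := by
    intro q
    have h1 := hw₁ q
    have h2 := hw₂ (q - k)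
    have h3 := hrole_lt (q - (k + k) + 1)
    simp only [W, guessBase]
    split_ifs <;> omega
  obtain ⟨T, hT, hTd⟩ := exists_digit_eq (guessBase_pos k) W hWlt (guessLength k)
  have hcov₁ : coverOf I.G₁ (fun q => digit (guessBase k) T (0 + q)) = (a₁, p₁) := by
    refine hc₁ _ fun p hp => ?_
    rw [hTd _ (by unfold guessLength; omega)]
    simp [W, hp]
  have hcov₂ : coverOf I.G₂ (fun q => digit (guessBase k) T (k + q)) = (a₂, p₂) := by
    refine hc₂ _ fun p hp => ?_
    rw [hTd _ (by unfold guessLength; omega)]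
    simp [W, hp]
  set d := digit (guessBase k) T with hd
  have hdrole : ∀ u, a₁ u ≠ 0 → d (k + k + a₁ u - 1) = role (a₁ u) := by
    intro u hu
    have := ha₁ u
    rw [hTd _ (by unfold guessLength; omega)]
    simp only [W]
    rw [if_neg (by omega), if_neg (by omega), if_pos (by omega)]
    congr 1
    omega
  have hdD : ∀ v : Fin I.n₂, a₂ v ≠ 0 → (d (k + k + k + a₂ v - 1) = 1 ↔ g.D v) := by
    intro v hv
    have := ha₂ v
    rw [hTd _ (by unfold guessLength; omega)]
    simp only [W]
    rw [if_neg (by omega), if_neg (by omega), if_neg (by omega), if_pos (by omega),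
      show k + k + k + a₂ v - 1 - (k + k + k) + 1 = a₂ v by omega]
    constructor
    · intro h
      split_ifs at h with h'
      · obtain ⟨x, hx, hx'⟩ := h'
        obtain rfl := inj₂ v x hv hx.symm
        exact hx'
    · intro h
      rw [if_pos ⟨v, rfl, h⟩]
  have hdH : ∀ (u : Fin I.n₁) (v : Fin I.n₂), a₁ u ≠ 0 → a₂ v ≠ 0 →
      (d (k + k + (k + k) + (a₁ u - 1) * k + (a₂ v - 1)) = 1 ↔ g.H u v) := by
    intro u v hu hv
    have h1 := ha₁ u
    have h2 := ha₂ v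
    have h3 : (a₁ u - 1) * k + k ≤ k * k := by
      rw [← Nat.succ_mul]; exact Nat.mul_le_mul_right k (by omega)
    rw [hTd _ (by unfold guessLength; omega)]
    simp only [W]
    rw [if_neg (by omega), if_neg (by omega), if_neg (by omega), if_neg (by omega),
      show k + k + (k + k) + (a₁ u - 1) * k + (a₂ v - 1) - (k + k + (k + k)) =
        a₂ v - 1 + (a₁ u - 1) * k by omega, Nat.add_mul_div_right _ _ (by omega),
      Nat.add_mul_mod_self_right, Nat.div_eq_of_lt (by omega), Nat.mod_eq_of_lt (by omega),
      show 0 + (a₁ u - 1) + 1 = a₁ u by omega, show a₂ v - 1 + 1 = a₂ v by omega]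
    constructor
    · intro h
      split_ifs at h with h'
      · obtain ⟨x, y, hx, hy, hxy⟩ := h'
        obtain rfl := inj₁ u x hu hx.symm
        obtain rfl := inj₂ v y hv hy.symm
        exact hxy
    · intro h
      rw [if_pos ⟨u, v, rfl, rfl, h⟩]
  have hA : (guessOf I.n₁ I.n₂ k d a₁ a₂).A = g.A := by
    funext u v
    apply propext
    constructor
    · rintro ⟨hu, hv, h⟩
      rw [hdrole u hu] at h
      obtain ⟨x, hx, ⟨-, h1⟩ | ⟨y, hxy, h1⟩⟩ := hrole (a₁ u) (by omega)
      · omega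
      · obtain rfl := inj₁ u x hu hx.symm
        obtain rfl := inj₂ v y hv (by omega)
        exact hxy
    · intro h
      have hu : a₁ u ≠ 0 := h.2.1
      exact ⟨hu, h.2.2, by rw [hdrole u hu]; exact hroleA _ u v rfl h⟩
  have hB : (guessOf I.n₁ I.n₂ k d a₁ a₂).B = g.B := by
    funext u
    apply propext
    constructor
    · rintro ⟨hu, h⟩
      rw [hdrole u hu] at h
      obtain ⟨x, hx, ⟨h1, -⟩ | ⟨y, hxy, h1⟩⟩ := hrole (a₁ u) (by omega)
      · obtain rfl := inj₁ u x hu hx.symm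
        exact h1
      · have : a₂ y ≠ 0 := hxy.2.2
        omega
    · intro h
      have hu : a₁ u ≠ 0 := h.1
      exact ⟨hu, by rw [hdrole u hu]; exact hroleB _ u rfl h⟩
  have hD : (guessOf I.n₁ I.n₂ k d a₁ a₂).D = g.D := by
    funext v
    apply propext
    constructor
    · rintro ⟨hv, h⟩
      exact (hdD v hv).1 h
    · intro h
      have hv : a₂ v ≠ 0 := h.1
      exact ⟨hv, (hdD v hv).2 h⟩
  have hcompat : (guessOf I.n₁ I.n₂ k d a₁ a₂).Compat I.G₁ I.G₂ C₁ C₂ =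
      g.Compat I.G₁ I.G₂ C₁ C₂ :=
    compat_congr hA hB hD fun b v hb hv => hdH b v hb.1 hv.1
  have hM := isMaximalMatching_rankMatch_compatN I k d a₁ a₂
  rw [← hC₁def, ← hC₂def, hcompat] at hM
  have hcand : CandidateOf I k d = fun u v => g.A u v ∨ RankMatch (CompatN I k d a₁ a₂) u v := by
    unfold CandidateOf
    rw [hcov₁, hcov₂, ← hA]
    rfl
  refine ⟨T, hT, ⟨by rw [hcov₁]; exact hp₁, by rw [hcov₂]; exact hp₂⟩, ?_, ?_⟩
  · rw [hcand]
    exact hP.extend hC₁ hC₂ hM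
  · rw [hcand]
    exact hP.exists_connected hC₁ hC₂ hM hconn

/-! ### The search -/

/-- The size `m` is at least that of every connected part of the candidate of `W`. -/
def Tried (I : GraphPair) (k : ℕ) (W : ℕ → ℕ) (m : ℕ) : Prop :=
  CoversFound I k W → IsPartialIso I.G₁ I.G₂ (CandidateOf I k W) →
    ∀ Y : Set (Fin I.n₁), (∀ u ∈ Y, ∃ v, CandidateOf I k W u v) → (I.G₁.induce Y).Preconnected →
      Y.ncard ≤ m

theorem Tried.mono {I : GraphPair} {k m m' : ℕ} {W : ℕ → ℕ} (h : Tried I k W m) (hm : m ≤ m') :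
    Tried I k W m' := fun h1 h2 Y h3 h4 => (h h1 h2 Y h3 h4).trans hm

/-- The part of a round before the guess is incremented. -/
def tryGuessS : Stmt :=
  .seq (coverS 0 0 5 8 (.const 0)) <| .seq (coverS 1 1 6 9 (.var 3)) <|
  .ite ((Expr.lt (.var 3) (.var 8)).or (.lt (.var 3) (.var 9))) .skip
    (.seq (.assign 4 (.const 1)) tryS)

/-- The part of a round in which the guess is incremented. -/
def nextGuessS : Stmt :=
  .seq incrementS <|
  .ite (.var 6)
    (.ite (.var 4) (.assign 5 (.const 1)) (.assign 3 (.add (.var 3) (.const 1)))) .skip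

theorem eval_roundS (s : State) : roundS.eval s = nextGuessS.eval (tryGuessS.eval s) := rfl

/-- The part of a round before the increment treats the string `W`: it computes its vertex covers and,
if they are small enough, its candidate. -/
theorem eval_tryGuessS {I : GraphPair} {k : ℕ} {W : ℕ → ℕ} {s : State}
    (h : Env I k W (s.mem 5) (s.mem 6) s) (h5 : ∀ v, I.n₁ ≤ v → s.mem 5 v = 0)
    (h6 : ∀ v, I.n₂ ≤ v → s.mem 6 v = 0) (hs : HoldsSolution I s) :
    HoldsSolution I (tryGuessS.eval s) ∧ s.reg 7 ≤ (tryGuessS.eval s).reg 7 ∧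
      ((tryGuessS.eval s).reg 4 ≠ 0 ↔ s.reg 4 ≠ 0 ∨ CoversFound I k W) ∧
      Tried I k W ((tryGuessS.eval s).reg 7) ∧
      (∀ v, I.n₁ ≤ v → (tryGuessS.eval s).mem 5 v = 0) ∧
      (∀ v, I.n₂ ≤ v → (tryGuessS.eval s).mem 6 v = 0) := by
  have hcap := h.lt_cap
  rw [tryGuessS, Stmt.eval, Stmt.eval]
  set p1 := coverS 0 0 5 8 (.const 0) with hp1
  set p2 := coverS 1 1 6 9 (.var 3) with hp2
  have e1 : ((p1.eval s).mem 5, (p1.eval s).reg 8) = coverOf I.G₁ fun q => W (0 + q) := by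
    have := eval_coverS (g := 0) (n := 0) (a := 5) (p := 8) (off := .const 0) (s := s) (o := 0)
      (by decide) (by decide) (by decide) (by decide) h.n₁ (by omega) (fun _ _ => rfl) h5
    rwa [h.g₁, h.w] at this
  have f1 : Env I k W ((p1.eval s).mem 5) (s.mem 6) (p1.eval s) := by
    obtain ⟨q1, q2, q3, q4, q5, q6, q7, q8, q9⟩ := h
    exact ⟨(p1.eval_reg (by decide) s).trans q1, (p1.eval_reg (by decide) s).trans q2,
      (p1.eval_reg (by decide) s).trans q3, (p1.eval_reg (by decide) s).trans q4,
      (p1.eval_mem (by decide) s).trans q5, (p1.eval_mem (by decide) s).trans q6,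
      (p1.eval_mem (by decide) s).trans q7, rfl, p1.eval_mem (by decide) s⟩
  have e2 : ((p2.eval (p1.eval s)).mem 6, (p2.eval (p1.eval s)).reg 9) =
      coverOf I.G₂ fun q => W (k + q) := by
    have := eval_coverS (g := 1) (n := 1) (a := 6) (p := 9) (off := .var 3) (s := p1.eval s)
      (o := k) (by decide) (by decide) (by decide) (by decide) f1.n₂
      (by have := f1.lt_cap; omega) (fun τ hτ => hτ.trans f1.k) (by rwa [f1.a₂])
    rwa [f1.g₂, f1.w] at this
  have f2 : Env I k W ((p1.eval s).mem 5) ((p2.eval (p1.eval s)).mem 6) (p2.eval (p1.eval s)) := by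
    obtain ⟨q1, q2, q3, q4, q5, q6, q7, q8, q9⟩ := f1
    exact ⟨(p2.eval_reg (by decide) _).trans q1, (p2.eval_reg (by decide) _).trans q2,
      (p2.eval_reg (by decide) _).trans q3, (p2.eval_reg (by decide) _).trans q4,
      (p2.eval_mem (by decide) _).trans q5, (p2.eval_mem (by decide) _).trans q6,
      (p2.eval_mem (by decide) _).trans q7, p2.eval_mem (by decide) _, rfl⟩
  have e8 : (p2.eval (p1.eval s)).reg 8 = (p1.eval s).reg 8 := p2.eval_reg (by decide) _
  have e7 : (p2.eval (p1.eval s)).reg 7 = s.reg 7 :=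
    (p2.eval_reg (by decide) _).trans (p1.eval_reg (by decide) _)
  have e4 : (p2.eval (p1.eval s)).reg 4 = s.reg 4 :=
    (p2.eval_reg (by decide) _).trans (p1.eval_reg (by decide) _)
  have m2 : (p2.eval (p1.eval s)).mem 2 = s.mem 2 :=
    (p2.eval_mem (by decide) _).trans (p1.eval_mem (by decide) _)
  have m3 : (p2.eval (p1.eval s)).mem 3 = s.mem 3 :=
    (p2.eval_mem (by decide) _).trans (p1.eval_mem (by decide) _)
  have hs2 : HoldsSolution I (p2.eval (p1.eval s)) := by
    simpa only [HoldsSolution, State.vertexSet, m2, m3, e7] using hs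
  set s2 := p2.eval (p1.eval s) with hs2def
  obtain ⟨e11, e12⟩ := Prod.ext_iff.1 e1
  obtain ⟨e21, e22⟩ := Prod.ext_iff.1 e2
  dsimp only at e11 e12 e21 e22
  have z5 : ∀ v, I.n₁ ≤ v → s2.mem 5 v = 0 := by
    intro v hv
    by_contra h0
    rw [f2.a₁, e11] at h0
    exact absurd ((coverInv_coverOf _ _).lt v h0) (by omega)
  have z6 : ∀ v, I.n₂ ≤ v → s2.mem 6 v = 0 := by
    intro v hv
    by_contra h0
    rw [e21] at h0
    exact absurd ((coverInv_coverOf _ _).lt v h0) (by omega)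
  rw [e11, e21] at f2
  have hcond : ((Expr.lt (.var 3) (.var 8)).or (.lt (.var 3) (.var 9))).Holds s2 ↔
      ¬ CoversFound I k W := by
    rw [holds_or, holds_lt, holds_lt]
    simp only [eval, f2.k, e8, e12, e22, CoversFound, not_and_or, not_le]
  by_cases hc : CoversFound I k W
  swap
  · rw [Stmt.eval_ite_pos (hcond.2 hc)]
    exact ⟨hs2, e7.ge, by rw [Stmt.eval, e4]; simp [hc], fun h' => absurd h' hc, z5, z6⟩
  rw [Stmt.eval_ite_neg fun h' => hcond.1 h' hc, Stmt.eval]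
  set p3 : Stmt := .assign 4 (.const 1) with hp3
  have f3 := f2.eval_of_frame p3 (by decide) (by decide)
  have h34 : (p3.eval s2).reg 4 = 1 := by
    have := f2.lt_cap
    simp only [hp3, Stmt.eval, Expr.cval, eval, State.setReg_reg, if_true]; omega
  have hs3 : HoldsSolution I (p3.eval s2) := by
    simpa [hp3, HoldsSolution, State.vertexSet, Stmt.eval] using hs2
  have h37 : (p3.eval s2).reg 7 = s.reg 7 := by
    rw [← e7]; exact p3.eval_reg (by decide) _
  obtain ⟨t1, t2, t3⟩ := f3.eval_tryS hs3
  refine ⟨t1, h37.ge.trans t2, ?_, fun _ => t3, ?_, ?_⟩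
  · rw [tryS.eval_reg (by decide), h34]
    simp [hc]
  · rw [tryS.eval_mem (by decide)]
    exact z5
  · rw [tryS.eval_mem (by decide)]
    exact z6

/-- The number of strings of level `k`. -/
def levelSize (k : ℕ) : ℕ := weight (guessBase k) (guessLength k)

/-- The state before the string number `T` of level `k` is tried. -/
structure SearchInv (I : GraphPair) (k T : ℕ) (s : State) : Prop where
  env : Env I k (digit (guessBase k) T) (s.mem 5) (s.mem 6) s
  a₁ : ∀ v, I.n₁ ≤ v → s.mem 5 v = 0
  a₂ : ∀ v, I.n₂ ≤ v → s.mem 6 v = 0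
  lt : T < levelSize k
  notDone : s.reg 5 = 0
  sol : HoldsSolution I s
  found : s.reg 4 ≠ 0 ↔ ∃ T' < T, CoversFound I k (digit (guessBase k) T')
  tried : ∀ T' < T, Tried I k (digit (guessBase k) T') (s.reg 7)

/-- The state after a search that was completed on level `k`. -/
structure SearchEnd (I : GraphPair) (k : ℕ) (s : State) : Prop where
  done : s.reg 5 ≠ 0
  sol : HoldsSolution I s
  found : ∃ T' < levelSize k, CoversFound I k (digit (guessBase k) T')
  tried : ∀ T' < levelSize k, Tried I k (digit (guessBase k) T') (s.reg 7)

/-- There are only zeros behind the digits of a string. -/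
theorem digit_eq_zero {b : ℕ → ℕ} (hb : ∀ i, 0 < b i) {T L i : ℕ} (hT : T < weight b L)
    (hi : L ≤ i) : digit b T i = 0 := by
  unfold digit
  have h1 : weight b L ≤ weight b i :=
    Nat.le_of_dvd (weight_pos hb i) (Finset.prod_dvd_prod_of_subset _ _ _ (by simpa using hi))
  rw [Nat.div_eq_of_lt (hT.trans_le h1), Nat.zero_mod]

/-- One round of the search: either the next string of the level is prepared, or the level is
complete. In the latter case the search ends if vertex covers have been found, else it proceeds to
the next level. -/
theorem SearchInv.round {I : GraphPair} {k T : ℕ} {s : State} (h : SearchInv I k T s)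
    (hk : k ≤ I.n₁ + I.n₂) :
    (T + 1 < levelSize k ∧ SearchInv I k (T + 1) (roundS.eval s)) ∨
    (T + 1 = levelSize k ∧ (¬ ∃ T' < levelSize k, CoversFound I k (digit (guessBase k) T')) ∧
      SearchInv I (k + 1) 0 (roundS.eval s)) ∨
    (T + 1 = levelSize k ∧ SearchEnd I k (roundS.eval s)) := by
  obtain ⟨t1, t2, t3, t4, t5, t6⟩ := eval_tryGuessS h.env h.a₁ h.a₂ h.sol
  have hE : Env I k (digit (guessBase k) T) ((tryGuessS.eval s).mem 5) ((tryGuessS.eval s).mem 6)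
      (tryGuessS.eval s) := by
    obtain ⟨q1, q2, q3, q4, q5, q6, q7, q8, q9⟩ := h.env
    exact ⟨(Stmt.eval_reg _ (by decide) s).trans q1, (Stmt.eval_reg _ (by decide) s).trans q2,
      (Stmt.eval_reg _ (by decide) s).trans q3, (Stmt.eval_reg _ (by decide) s).trans q4,
      (Stmt.eval_mem _ (by decide) s).trans q5, (Stmt.eval_mem _ (by decide) s).trans q6,
      (Stmt.eval_mem _ (by decide) s).trans q7, rfl, rfl⟩
  have h5 : (tryGuessS.eval s).reg 5 = 0 := (Stmt.eval_reg _ (by decide) s).trans h.notDone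
  have hfound : (tryGuessS.eval s).reg 4 ≠ 0 ↔
      ∃ T' < T + 1, CoversFound I k (digit (guessBase k) T') := by
    rw [t3, h.found]
    constructor
    · rintro (⟨T', hT', h'⟩ | h')
      exacts [⟨T', by omega, h'⟩, ⟨T, by omega, h'⟩]
    · rintro ⟨T', hT', h'⟩
      rcases Nat.lt_succ_iff_lt_or_eq.1 hT' with h0 | rfl
      exacts [.inl ⟨T', h0, h'⟩, .inr h']
  have htried : ∀ T' < T + 1, Tried I k (digit (guessBase k) T') ((tryGuessS.eval s).reg 7) := by
    intro T' hT'
    rcases Nat.lt_succ_iff_lt_or_eq.1 hT' with h0 | rfl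
    exacts [(h.tried T' h0).mono t2, t4]
  rw [eval_roundS, nextGuessS, Stmt.eval]
  set s1 := tryGuessS.eval s with hs1
  clear_value s1
  have hcap1 := hE.cap
  have hcap : guessLength k + 2 ≤ s1.reg capVar := by
    rw [hcap1]; unfold guessLength; nlinarith
  obtain ⟨i1, i2⟩ := eval_incrementS hE.k hcap hE.w
  have frame : ∀ x, x ∉ incrementS.regs → (incrementS.eval s1).reg x = s1.reg x :=
    fun x hx => incrementS.eval_reg hx s1
  have framem : ∀ x, x ∉ incrementS.arrs → (incrementS.eval s1).mem x = s1.mem x :=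
    fun x hx => incrementS.eval_mem hx s1
  have hsol : HoldsSolution I (incrementS.eval s1) := by
    simpa only [HoldsSolution, State.vertexSet, framem 2 (by decide), framem 3 (by decide),
      frame 7 (by decide)] using t1
  have hw : T + 1 < levelSize k →
      (incrementS.eval s1).mem 4 = digit (guessBase k) (T + 1) := by
    intro hT
    funext i
    rw [i1]
    split_ifs with hi
    · rfl
    · rw [digit_eq_zero (guessBase_pos k) h.lt (not_lt.1 hi),
        digit_eq_zero (guessBase_pos k) hT (not_lt.1 hi)]
  have hdvd : levelSize k ∣ T + 1 ↔ T + 1 = levelSize k := by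
    constructor
    · intro hd
      have := Nat.le_of_dvd (by omega) hd
      have := h.lt
      omega
    · rintro h'; rw [h']
  change _ ↔ levelSize k ∣ T + 1 at i2
  have hE2 : ∀ W, (incrementS.eval s1).mem 4 = W → Env I k W ((incrementS.eval s1).mem 5)
      ((incrementS.eval s1).mem 6) (incrementS.eval s1) := by
    intro W hW
    obtain ⟨q1, q2, q3, q4, q5, q6, q7, q8, q9⟩ := hE
    exact ⟨(frame _ (by decide)).trans q1, (frame _ (by decide)).trans q2,
      (frame _ (by decide)).trans q3, (frame _ (by decide)).trans q4,
      (framem _ (by decide)).trans q5, (framem _ (by decide)).trans q6, hW, rfl, rfl⟩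
  have g4 := frame 4 (by decide)
  have g5 := frame 5 (by decide)
  have g7 := frame 7 (by decide)
  have m5 := framem 5 (by decide)
  have m6 := framem 6 (by decide)
  set s2 := incrementS.eval s1 with hs2
  clear_value s2
  by_cases hT : T + 1 = levelSize k
  swap
  · have h6 : ¬ (Expr.var 6).Holds s2 := fun h' => hT (hdvd.1 (i2.1 h'))
    rw [Stmt.eval_ite_neg h6]
    have hlt : T + 1 < levelSize k := lt_of_le_of_ne h.lt hT
    exact .inl ⟨hlt, hE2 _ (hw hlt), by rwa [Stmt.eval, m5], by rwa [Stmt.eval, m6], hlt,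
      g5.trans h5, hsol, by rw [Stmt.eval, g4]; exact hfound,
      by rw [Stmt.eval, g7]; exact htried⟩
  have h6 : (Expr.var 6).Holds s2 := i2.2 (hdvd.2 hT)
  rw [Stmt.eval_ite_pos h6]
  have hcap2 : s2.reg capVar = (I.n₁ + I.n₂ + 5) * (I.n₁ + I.n₂ + 5) := (hE2 _ rfl).cap
  by_cases hf : (Expr.var 4).Holds s2
  · rw [Stmt.eval_ite_pos hf]
    have hf' := hf
    simp only [Holds, eval, g4] at hf'
    have hfin := hfound.1 hf'
    refine .inr (.inr ⟨hT, ?_, ?_, hT ▸ hfin, ?_⟩)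
    · simp only [Stmt.eval, Expr.cval, eval, State.setReg_reg, if_true, hcap2]
      have : 0 < (I.n₁ + I.n₂ + 5) * (I.n₁ + I.n₂ + 5) := by positivity
      omega
    · simpa [HoldsSolution, State.vertexSet, Stmt.eval] using hsol
    · rw [← hT]
      simpa [Stmt.eval, g7] using htried
  · rw [Stmt.eval_ite_neg hf]
    have hf' := hf
    simp only [Holds, eval, g4] at hf'
    have hnone : ¬ ∃ T' < levelSize k, CoversFound I k (digit (guessBase k) T') := by
      rw [← hT]; exact fun h' => hf' (hfound.2 h')
    refine .inr (.inl ⟨hT, hnone, ?_⟩)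
    have hval : (Expr.add (.var 3) (.const 1)).cval s2 = k + 1 := by
      simp only [Expr.cval, eval, hcap2, (hE2 _ rfl).k]
      refine min_eq_left ?_
      nlinarith
    have hW : s2.mem 4 = digit (guessBase (k + 1)) 0 := by
      funext i
      rw [digit_zero, i1]
      split_ifs with hi
      · rw [digit_succ (guessBase_pos k)]
        have hd1 : weight (guessBase k) (i + 1) ∣ T + 1 := by
          rw [hT]
          unfold levelSize weight
          exact Finset.prod_dvd_prod_of_subset _ _ _
            (Finset.range_subset_range.2 (Nat.succ_le_of_lt hi))
        have hd2 := (weight_dvd_succ (guessBase_pos k) T i).1 hd1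
        rw [if_pos hd2.1, if_neg hd2.2]
      · exact digit_eq_zero (guessBase_pos k) h.lt (not_lt.1 hi)
    obtain ⟨q1, q2, q3, q4, q5, q6, q7, q8, q9⟩ := hE2 _ rfl
    rw [Stmt.eval, hval]
    refine ⟨⟨by simpa using q1, by simpa using q2, by simpa [capVar] using q3, by simp,
      q5, q6, hW, rfl, rfl⟩, by rwa [State.setReg_mem, m5], by rwa [State.setReg_mem, m6],
      weight_pos (guessBase_pos _) _, by simpa [g5] using h5, ?_, ?_, by simp⟩
    · simpa [HoldsSolution, State.vertexSet] using hsol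
    · simpa [g4] using hf'

/-- A level that is at least the vertex cover numbers is never passed without covers: apply the
completeness of the guesses to the empty isomorphism. -/
theorem exists_coversFound {I : GraphPair} {k : ℕ} (h₁ : I.G₁.vertexCoverNum ≤ k)
    (h₂ : I.G₂.vertexCoverNum ≤ k) :
    ∃ T < levelSize k, CoversFound I k (digit (guessBase k) T) := by
  obtain ⟨T, hT, h, -⟩ := exists_guess (P := fun _ _ => False) h₁ h₂ (fun u v _ _ h => h.elim)
    (by rintro ⟨u, v, h⟩; exact h.elim)
  exact ⟨T, hT, h⟩

/-- The search ends on a level of at most `K`, after at most as many rounds as there are strings on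
the levels up to `K`, where `K` bounds the vertex cover numbers. -/
theorem SearchInv.exists_end {I : GraphPair} {K : ℕ} (h₁ : I.G₁.vertexCoverNum ≤ K)
    (h₂ : I.G₂.vertexCoverNum ≤ K) (hK : K ≤ I.n₁ + I.n₂) (μ : ℕ) :
    ∀ {k T : ℕ} {s : State}, k ≤ K → SearchInv I k T s →
      levelSize k - T + ∑ j ∈ Finset.Ico (k + 1) (K + 1), levelSize j ≤ μ →
      ∃ m ≤ μ, (∀ i < m, (roundS.eval^[i] s).reg 5 = 0) ∧
        ∃ k', SearchEnd I k' (roundS.eval^[m] s) := by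
  induction μ with
  | zero =>
    intro k T s hk h hμ
    have := h.lt
    omega
  | succ μ ih =>
    intro k T s hk h hμ
    have hlt := h.lt
    have step : (∃ m ≤ μ, (∀ i < m, (roundS.eval^[i] (roundS.eval s)).reg 5 = 0) ∧
        ∃ k', SearchEnd I k' (roundS.eval^[m] (roundS.eval s))) →
        ∃ m ≤ μ + 1, (∀ i < m, (roundS.eval^[i] s).reg 5 = 0) ∧
          ∃ k', SearchEnd I k' (roundS.eval^[m] s) := by
      rintro ⟨m, hm, hi, hend⟩
      refine ⟨m + 1, by omega, fun i him => ?_, ?_⟩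
      · cases i with
        | zero => exact h.notDone
        | succ i =>
          rw [Function.iterate_succ_apply]
          exact hi i (by omega)
      · rw [Function.iterate_succ_apply]
        exact hend
    rcases h.round (hk.trans hK) with ⟨-, h'⟩ | ⟨hT, hnone, h'⟩ | ⟨-, h'⟩
    · exact step (ih hk h' (by omega))
    · have hkK : k < K := by
        by_contra hle
        have hle' : (K : ℕ∞) ≤ k := by exact_mod_cast not_lt.1 hle
        exact hnone (exists_coversFound (h₁.trans hle') (h₂.trans hle'))
      have hsum : ∑ j ∈ Finset.Ico (k + 1) (K + 1), levelSize j =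
          levelSize (k + 1) + ∑ j ∈ Finset.Ico (k + 1 + 1) (K + 1), levelSize j :=
        Finset.sum_eq_sum_Ico_succ_bot (by omega) _
      refine step (ih (k := k + 1) hkK h' ?_)
      omega
    · refine step ⟨0, Nat.zero_le _, fun i hi => absurd hi (Nat.not_lt_zero i), k, ?_⟩
      rw [Function.iterate_zero_apply]
      exact h'

/-- The output of a complete search is optimal. -/
theorem SearchEnd.isOutput {I : GraphPair} {k : ℕ} {s : State} (h : SearchEnd I k s) :
    IsMaxCommonConnectedInducedSubgraph I.G₁ I.G₂ (s.vertexSet 2 I.n₁) (s.vertexSet 3 I.n₂) := by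
  refine ⟨h.sol.1, fun T₁ T₂ hT => ?_⟩
  rw [h.sol.2]
  obtain ⟨hconn, ⟨φ⟩⟩ := hT
  obtain ⟨T', -, hc₁, hc₂⟩ := h.found
  have h₁ : I.G₁.vertexCoverNum ≤ k :=
    (vertexCoverNum_le_coverOf _ _).trans (by exact_mod_cast hc₁)
  have h₂ : I.G₂.vertexCoverNum ≤ k :=
    (vertexCoverNum_le_coverOf _ _).trans (by exact_mod_cast hc₂)
  -- The isomorphism between the induced subgraphs, as a relation between vertices.
  let P : Fin I.n₁ → Fin I.n₂ → Prop := fun u v => ∃ hu : u ∈ T₁, (φ ⟨u, hu⟩).1 = v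
  have hP : IsPartialIso I.G₁ I.G₂ P := by
    rintro u v u' v' ⟨hu, rfl⟩ ⟨hu', rfl⟩
    constructor
    · constructor
      · rintro rfl; rfl
      · intro h'
        exact congrArg Subtype.val (φ.injective (Subtype.ext h'))
    · exact (φ.map_rel_iff (a := ⟨u, hu⟩) (b := ⟨u', hu'⟩)).symm
  have hdom : {u | ∃ v, P u v} = T₁ := by
    ext u
    exact ⟨fun ⟨v, hu, _⟩ => hu, fun hu => ⟨_, hu, rfl⟩⟩
  obtain ⟨T, hT, hc, hiso, Y, hY, hYc, hYn⟩ := exists_guess h₁ h₂ hP (by rwa [hdom])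
  rw [hdom] at hYn
  rw [← hYn]
  exact h.tried T hT hc hiso Y hY hYc

/-! ### The running time -/

/-- The first `2 * k` digits are bits, the next `k` digits have base `k + 2`, and the remaining
`k + k ^ 2` digits are bits. -/
theorem levelSize_eq (k : ℕ) : levelSize k = (k + 2) ^ k * 2 ^ (3 * k + k ^ 2) := by
  have h1 : guessLength k = k + k + (k + (k + k * k)) := by unfold guessLength; ring
  unfold levelSize weight
  rw [h1, Finset.prod_range_add _ (k + k), Finset.prod_range_add _ k (k + k * k)]
  have e1 : ∀ i ∈ Finset.range (k + k), guessBase k i = 2 := by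
    intro i hi
    rw [Finset.mem_range] at hi
    unfold guessBase
    rw [if_neg (by omega)]
  have e2 : ∀ i ∈ Finset.range k, guessBase k (k + k + i) = k + 2 := by
    intro i hi
    rw [Finset.mem_range] at hi
    unfold guessBase
    rw [if_pos (by omega)]
    omega
  have e3 : ∀ i ∈ Finset.range (k + k * k), guessBase k (k + k + (k + i)) = 2 := by
    intro i hi
    unfold guessBase
    rw [if_neg (by omega)]
  rw [Finset.prod_congr rfl e1, Finset.prod_congr rfl e2, Finset.prod_congr rfl e3]
  simp only [Finset.prod_const, Finset.card_range]
  rw [show 3 * k + k ^ 2 = (k + k) + (k + k * k) by ring, pow_add 2 (k + k)]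
  ring

theorem fptBound_mono {k K : ℕ} (h : k ≤ K) : fptBound k ≤ fptBound K := by
  rcases Nat.eq_zero_or_pos K with rfl | hK
  · obtain rfl := Nat.le_zero.1 h
    rfl
  · unfold fptBound
    exact Nat.mul_le_mul
      ((Nat.pow_le_pow_left (by omega) k).trans (Nat.pow_le_pow_right (by omega) h))
      (Nat.pow_le_pow_right (by norm_num) (Nat.pow_le_pow_left h 2))

theorem fptBound_pos (k : ℕ) : 0 < fptBound k := by
  rcases Nat.eq_zero_or_pos k with rfl | hk
  · decide
  · unfold fptBound; positivity

theorem sum_levelSize_le (K : ℕ) :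
    levelSize 0 - 0 + ∑ j ∈ Finset.Ico 1 (K + 1), levelSize j ≤ (K + 1) * (9 * fptBound K) := by
  rw [Nat.sub_zero, ← Finset.sum_eq_sum_Ico_succ_bot (by omega), Nat.Ico_zero_eq_range]
  refine (Finset.sum_le_card_nsmul _ _ (9 * fptBound K) fun j hj => ?_).trans (by simp)
  rw [levelSize_eq]
  exact (add_two_pow_mul_le j).trans
    (Nat.mul_le_mul_left 9 (fptBound_mono (by simpa [Nat.lt_succ_iff] using hj)))

theorem adjArray_le_one {n : ℕ} (G : SimpleGraph (Fin n)) (p : ℕ) : adjArray G p ≤ 1 := by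
  unfold adjArray
  split_ifs <;> simp

theorem bounded_input (I : GraphPair) : Bounded (I.n₁ + I.n₂ + 1) I.input := by
  refine ⟨fun x => ?_, fun a i => ?_⟩
  · simp only [GraphPair.input]
    split_ifs <;> omega
  · simp only [GraphPair.input]
    have h1 := adjArray_le_one I.G₁ i
    have h2 := adjArray_le_one I.G₂ i
    split_ifs <;> simp <;> omega

/-- The initial solution is empty. -/
theorem holdsSolution_of_empty {I : GraphPair} {s : State} (h7 : s.reg 7 = 0)
    (h2 : s.mem 2 = fun _ => 0) (h3 : s.mem 3 = fun _ => 0) : HoldsSolution I s := by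
  have e2 : s.vertexSet 2 I.n₁ = ∅ := by ext; simp [State.vertexSet, h2]
  have e3 : s.vertexSet 3 I.n₂ = ∅ := by ext; simp [State.vertexSet, h3]
  refine ⟨⟨?_, ?_⟩, by rw [e2, h7]; simp⟩
  · rw [e2]
    rintro ⟨u, hu⟩
    exact hu.elim
  · rw [e2, e3]
    exact ⟨{ toEquiv := Equiv.equivOfIsEmpty _ _
             map_rel_iff' := fun {x} => x.2.elim }⟩

theorem searchInv_init (I : GraphPair) :
    SearchInv I 0 0 (I.input.setReg capVar ((I.n₁ + I.n₂ + 5) * (I.n₁ + I.n₂ + 5))) where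
  env := by
    constructor
    all_goals first
      | rfl
      | (simp [capVar, GraphPair.input]; done)
      | (funext i; simp [GraphPair.input, digit_zero])
  a₁ v _ := rfl
  a₂ v _ := rfl
  lt := weight_pos (guessBase_pos _) _
  notDone := rfl
  sol := holdsSolution_of_empty rfl rfl rfl
  found := by simp [capVar, GraphPair.input]
  tried := by simp

/-- The program solves the problem within a number of rounds that the parameter bounds, each of
polynomial length. -/
theorem exists_time_mainProg :
    ∃ T₁ T₂, PolyBd T₁ ∧ PolyBd T₂ ∧ ∀ (I : GraphPair) (K : ℕ), I.G₁.vertexCoverNum ≤ K →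
      I.G₂.vertexCoverNum ≤ K → K ≤ I.n₁ + I.n₂ →
      Ensures mainProg I.input (T₁ (I.n₁ + I.n₂ + 1) + 2 + ((K + 1) * (9 * fptBound K) + 1) *
        T₂ ((I.n₁ + I.n₂ + 5) * (I.n₁ + I.n₂ + 5))) fun s =>
          IsMaxCommonConnectedInducedSubgraph I.G₁ I.G₂ (s.vertexSet 2 I.n₁)
            (s.vertexSet 3 I.n₂) := by
  obtain ⟨T₁, hT₁, h₁⟩ := capE.exists_time
  obtain ⟨T₂, hT₂, h₂⟩ := exists_time_whileProg (Expr.not (.var 5)) roundS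
  refine ⟨T₁, T₂, hT₁, hT₂, fun I K hG₁ hG₂ hK => ?_⟩
  set cap := (I.n₁ + I.n₂ + 5) * (I.n₁ + I.n₂ + 5) with hcap
  set σ := I.input.setReg capVar cap with hσ
  obtain ⟨m, hm, hrun, k', hend⟩ := (searchInv_init I).exists_end hG₁ hG₂ hK _ (Nat.zero_le K) le_rfl
  have hm' := hm.trans (sum_levelSize_le K)
  have hbd : Bounded cap σ := by
    have : I.n₁ + I.n₂ + 1 ≤ cap := by rw [hcap]; nlinarith
    exact ((bounded_input I).mono this).setReg le_rfl _
  have hwhile := h₂ cap σ hbd m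
    (fun i hi => (holds_not _ _).2 fun h' => h' (hrun i hi))
    (by
      have := hend.done
      by_contra h'
      exact (holds_not _ _).1 h' this)
  refine Ensures.mono (Ensures.seq (T := 1) (T' := T₁ (I.n₁ + I.n₂ + 1) + (1 + (m + 1) * T₂ cap))
    (Ensures.instr (Ensures.seq ((h₁ _ I.input (bounded_input I) 0 _ ?_).mono le_rfl ?_))))
    ?_ (fun _ h => h)
  · refine ⟨fun x => ?_, rfl⟩
    simp only [Instr.run, State.setReg_reg]
    by_cases hx : x = 1
    · subst hx; rfl
    · rw [if_neg (by omega)]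
      simp only [GraphPair.input]
      split_ifs <;> omega
  · rintro s1 ⟨ha, hv, -⟩
    refine Ensures.seq (Ensures.instr ?_)
    have hv' : s1.reg (tmp 0) = cap := by
      rw [hv]
      simp [capE, mul, eval, GraphPair.input, hcap]
    refine (hwhile _ ?_).mono le_rfl ?_
    · simpa only [Instr.run, hv', hσ] using ha.setReg capVar cap
    · rintro s2 ha2
      have := hend.isOutput
      rw [← hσ] at this
      simpa only [State.vertexSet, ha2.2] using this
  · have : (m + 1) * T₂ cap ≤ ((K + 1) * (9 * fptBound K) + 1) * T₂ cap :=
      Nat.mul_le_mul_right _ (by omega)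
    omega

end RAM

open RAM in
/-- The running time of the program, with polynomials in the cap replaced by powers of the size `z` of
the instance. The cap is at most `z ^ 6`; as `2 ≤ z`, powers of `z` absorb constants. -/
theorem MCCIS_solvableInOStar : MCCIS.SolvableInOStar fptBound := by
  obtain ⟨T₁, T₂, ⟨D, hD⟩, ⟨E, hE⟩, h⟩ := exists_time_mainProg
  refine ⟨mainProg, 13, 7 * D + 7 * E + 1, fun I => ?_⟩
  change GraphPair at I
  set K := MCCIS.param I with hKdef
  set z := MCCIS.size I with hz
  have hz' : z = I.n₁ ^ 2 + I.n₂ ^ 2 + 2 := rfl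
  have hle₁ : I.G₁.vertexCoverNum ≤ (I.n₁ : ℕ∞) := by
    simpa using (I.G₁.isVertexCover_univ).vertexCoverNum_le
  have hle₂ : I.G₂.vertexCoverNum ≤ (I.n₂ : ℕ∞) := by
    simpa using (I.G₂.isVertexCover_univ).vertexCoverNum_le
  have hmax : max I.G₁.vertexCoverNum I.G₂.vertexCoverNum ≤ ((I.n₁ + I.n₂ : ℕ) : ℕ∞) :=
    max_le (hle₁.trans (by exact_mod_cast Nat.le_add_right _ _))
      (hle₂.trans (by exact_mod_cast Nat.le_add_left _ _))
  have hcoe : ((K : ℕ) : ℕ∞) = max I.G₁.vertexCoverNum I.G₂.vertexCoverNum :=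
    ENat.natCast_toNat (ne_top_of_le_ne_top (ENat.natCast_ne_top _) hmax)
  have hK : K ≤ I.n₁ + I.n₂ := by
    have h' := hmax
    rw [← hcoe] at h'
    exact_mod_cast h'
  obtain ⟨s, t, he, ht, hs⟩ := h I K (by rw [hcoe]; exact le_max_left _ _)
    (by rw [hcoe]; exact le_max_right _ _) hK
  refine ⟨s, t, he, ht.trans ?_, hs⟩
  have hsq₁ : I.n₁ ≤ I.n₁ ^ 2 := Nat.le_self_pow (by decide) _
  have hsq₂ : I.n₂ ≤ I.n₂ ^ 2 := Nat.le_self_pow (by decide) _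
  have hz2 : 2 ≤ z := by omega
  have hn : I.n₁ + I.n₂ + 5 ≤ z ^ 3 := by
    have : I.n₁ + I.n₂ + 5 ≤ z + 3 := by omega
    nlinarith [Nat.mul_le_mul hz2 hz2, Nat.mul_le_mul (Nat.mul_le_mul hz2 hz2) hz2]
  have hp : ∀ a b, a ≤ b → z ^ a ≤ z ^ b := fun a b hab => Nat.pow_le_pow_right (by omega) hab
  have hcap : (I.n₁ + I.n₂ + 5) * (I.n₁ + I.n₂ + 5) + 2 ≤ z ^ 7 := by
    have h1 : (I.n₁ + I.n₂ + 5) * (I.n₁ + I.n₂ + 5) ≤ z ^ 6 := by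
      calc _ ≤ z ^ 3 * z ^ 3 := Nat.mul_le_mul hn hn
        _ = z ^ 6 := by ring
    have h2 : z ^ 6 * 2 ≤ z ^ 7 := by rw [pow_succ z 6]; exact Nat.mul_le_mul_left _ hz2
    have h3 : 2 ≤ z ^ 6 := hz2.trans (Nat.le_self_pow (by decide) _)
    omega
  have hT₁ : T₁ (I.n₁ + I.n₂ + 1) ≤ z ^ (7 * D) := by
    refine (hD _).trans ?_
    rw [pow_mul]
    refine Nat.pow_le_pow_left ?_ D
    have := hp 3 7 (by decide)
    omega
  have hT₂ : T₂ ((I.n₁ + I.n₂ + 5) * (I.n₁ + I.n₂ + 5)) ≤ z ^ (7 * E) := by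
    refine (hE _).trans ?_
    rw [pow_mul]
    exact Nat.pow_le_pow_left hcap E
  have hF := fptBound_pos K
  set F := fptBound K with hFdef
  set Z := z ^ (7 * D + 7 * E + 1) with hZ
  have hZ1 : 1 ≤ Z := Nat.one_le_pow _ _ (by omega)
  have hA : T₁ (I.n₁ + I.n₂ + 1) ≤ Z := hT₁.trans (hp _ _ (by omega))
  have hB : z * T₂ ((I.n₁ + I.n₂ + 5) * (I.n₁ + I.n₂ + 5)) ≤ Z := by
    calc _ ≤ z * z ^ (7 * E) := Nat.mul_le_mul_left _ hT₂
      _ = z ^ (7 * E + 1) := by ring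
      _ ≤ Z := hp _ _ (by omega)
  have hKz : K + 1 ≤ z := by omega
  have hround : (K + 1) * (9 * F) + 1 ≤ z * (10 * F) := by nlinarith
  calc _ ≤ Z + 2 + (z * (10 * F)) * T₂ ((I.n₁ + I.n₂ + 5) * (I.n₁ + I.n₂ + 5)) := by gcongr
    _ = Z + 2 + 10 * F * (z * T₂ ((I.n₁ + I.n₂ + 5) * (I.n₁ + I.n₂ + 5))) := by ring
    _ ≤ Z + 2 + 10 * F * Z := by gcongr
    _ ≤ 13 * F * Z := by nlinarith [Nat.mul_le_mul hF hZ1]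

theorem mainTheorem2 :
    MCCIS.IsFPT ∧ MCCIS.SolvableInOStar (fun k => (9 * k) ^ k * 2 ^ (k ^ 2)) :=
  ⟨⟨fptBound, computable_fptBound, MCCIS_solvableInOStar⟩, MCCIS_solvableInOStar⟩
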